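/- **Setting.** Let $\Theta^\star=[\theta_1^\star,\dots,\theta_T^\star]\in\mathbb R^{d\times T}$ have rank $r\ge 1$ and reduced singular value decomposition $\Theta^\star=U^\star\Sigma^\star V^{\star\top}$, with $U^\star\in\mathbb R^{d\times r}$, $V^\star\in\mathbb R^{T\times r}$ having orthonormal columns and $\Sigma^\star$ diagonal with positive diagonal entries. Let $\sigma_{\max}^\star,\sigma_{\min}^\star$ be the largest and smallest singular values in $\Sigma^\star$, $\kappa=\sigma_{\max}^\star/\sigma_{\min}^\star$, and $B^\star=\Sigma^\star V^{\star\top}=[b_1^\star,\dots,b_T^\star]$. Assume the incoherence condition $\|b_t^\star\|^2\le\mu^2\frac rT{\sigma_{\max}^\star}^2$ for all $t\in[T]$, where $\mu>1$. Let $\mathcal G$ be an undirected connected graph on the nodes $[L]$, $L\ge1$, with neighbourhoods $\mathcal N_g$; let $W\in\mathbb R^{L\times L}$ be a symmetric doubly stochastic matrix with $W_{gj}=0$ whenever $g\ne j$ are not adjacent, with eigenvalues $\lambda_1\ge\dots\ge\lambda_L$, and assume that $\gamma(W):=\max(|\lambda_2|,|\lambda_L|)<1$ (with $\gamma(W):=0$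 if $L=1$). Let $\mathcal S_1,\dots,\mathcal S_L$ partition $[T]$. Let $X_t^{(00)},X_t^{(0)}\in\mathbb R^{n\times d}$ ($t\in[T]$) and $Z\in\mathbb R^{d\times r}$ be random matrices all of whose entries are jointly independent standard Gaussian, and set $y_t^{(\ell)}=X_t^{(\ell)}\theta_t^\star$ for $\ell\in\{00,0\}$. **Algorithm.** For inputs $z_1,\dots,z_L$ (numbers or matrices), $\textsc{Agree}$ performs $T_{\mathrm{con,init}}$ rounds of the simultaneous update $z_g\leftarrow z_g+\sum_{j\in\mathcal N_g}W_{gj}(z_j-z_g)$, $g\in[L]$. 1. Node $g$ forms $\alpha_g^{\mathrm{in}}=9\kappa^2\mu^2\frac{L}{nT}\sum_{t\in\mathcal S_g}\sum_{i=1}^n (y^{(00)}_{ti})^2$, and $(\alpha_g)_g$ is the output of $\textsc{Agree}$ on $(\alpha_g^{\mathrm{in}})_g$. 2. Node $g$ forms the matrix $\Theta_{0,g}$ with columns $\frac1n X_t^{(0)\top}y_{t,\mathrm{trnc}}$, $t\in\mathcal S_g$, where $y_{t,\mathrm{trnc}}$ is $y_t^{(0)}$ with every entry satisfying $(y^{(0)}_{ti})^2>\alpha_g$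 replaced by $0$. 3. Every node starts from the $Q$-factor $U_g^{(0)}$ of the same matrix $Z$ (the same QR routine, with any sign convention, is used throughout). 4. For $\tau=1,\dots,T_{\mathrm{pm}}$: $\textsc{Agree}$ is applied to $(\Theta_{0,g}\Theta_{0,g}^\top U_g^{(\tau-1)})_g$; node $g$ takes the $Q$-factor $U_g^{(\tau)}$ of its output; then $U_g^{(\tau)}$ is set to $0$ for all $g\ne1$, and for $\mathrm{ecc}(1)$ rounds (the eccentricity of node 1 in $\mathcal G$) every node whose matrix is nonzero sends it to its neighbours, and every node that receives a nonzero matrix replaces its own by it. For matrices with orthonormal columns let $\mathrm{SD}(U_1,U_2)=\|(I-U_1U_1^\top)U_2\|$ (spectral norm), and let $P_{U^\star_\perp}=I-U^\star U^{\star\top}$. **Claim.** There is an absolute constant $C>1$ such that the following holds for all such data and every $\delta_0\in(0,1)$. If $T_{\mathrm{con,init}}\ge1$ and $$T_{\mathrm{con,init}}\ge \frac{C}{\log(1/\gamma(W))}\Big(\log L+\log d+\log\kappa+\log\frac1{\delta_0}\Big),\quad T_{\mathrm{pm}}\ge C\kappa^2\log\frac d{\delta_0},\quad nT\ge C\kappa^4\mu^2(d+T)\frac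 r{\delta_0^2}$$ (where $1/\log(1/\gamma(W))$ is read as $0$ if $\gamma(W)=0$), then, with probability at least $1-1/d$, simultaneously: 1. $\|U_g^{(T_{\mathrm{pm}})}-U_{g'}^{(T_{\mathrm{pm}})}\|_F=0$ for all $g,g'\in[L]$; 2. $\|P_{U^\star_\perp}(U_g^{(T_{\mathrm{pm}})}-U_{g'}^{(T_{\mathrm{pm}})})\|_F=0$ for all $g,g'\in[L]$; 3. for all $g\in[L]$, $U_g^{(T_{\mathrm{pm}})}$ has orthonormal columns and $\mathrm{SD}(U_g^{(T_{\mathrm{pm}})},U^\star)\le\delta_0$. -/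

import Mathlib

open Matrix MeasureTheory ProbabilityTheory

universe u

noncomputable section

namespace DecMTRL

/-! ### Matrix norms and the subspace distance -/

section Frobenius
open scoped Matrix.Norms.Frobenius

/-- The Frobenius norm of a real matrix. -/
def frobNorm {m k : ℕ} (M : Matrix (Fin m) (Fin k) ℝ) : ℝ := ‖M‖

end Frobenius

section Spectral
open scoped Matrix.Norms.L2Operator

/-- The norm of a real matrix induced by the Euclidean norms. -/
def specNorm {m k : ℕ} (M : Matrix (Fin m) (Fin k) ℝ) : ℝ := ‖M‖

end Spectral

/-- The projection `I - U Uᵀ` onto the orthogonal complement of the column space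
of a matrix `U` with orthonormal columns. -/
def projPerp {d r : ℕ} (U : Matrix (Fin d) (Fin r) ℝ) : Matrix (Fin d) (Fin d) ℝ :=
  1 - U * Uᵀ

/-- The subspace distance `‖(I - U₁ U₁ᵀ) U₂‖` of two matrices with orthonormal columns. -/
def subspaceDist {d r : ℕ} (U₁ U₂ : Matrix (Fin d) (Fin r) ℝ) : ℝ :=
  specNorm (projPerp U₁ * U₂)

/-! ### Reduced singular value decomposition of the feature matrix -/

/-- `Θ = U diag(σ) Vᵀ` is a reduced singular value decomposition with `r` positive
singular values. -/
structure IsReducedSVD {d T r : ℕ} (Θ : Matrix (Fin d) (Fin T) ℝ)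
    (U : Matrix (Fin d) (Fin r) ℝ) (σ : Fin r → ℝ) (V : Matrix (Fin T) (Fin r) ℝ) : Prop where
  left_orthonormal : Uᵀ * U = 1
  right_orthonormal : Vᵀ * V = 1
  pos : ∀ i, 0 < σ i
  eq : Θ = U * Matrix.diagonal σ * Vᵀ

/-- Largest singular value. -/
def sigmaMax {r : ℕ} (σ : Fin r → ℝ) : ℝ := ⨆ i, σ i

/-- Smallest singular value. -/
def sigmaMin {r : ℕ} (σ : Fin r → ℝ) : ℝ := ⨅ i, σ i

/-- Condition number. -/
def condNumber {r : ℕ} (σ : Fin r → ℝ) : ℝ := sigmaMax σ / sigmaMin σ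

/-- Incoherence: with `B = diag(σ) Vᵀ = [b₁, …, b_T]`, every column satisfies
`‖b_t‖² ≤ μ² (r / T) σ_max²`. -/
def Incoherent {T r : ℕ} (σ : Fin r → ℝ) (V : Matrix (Fin T) (Fin r) ℝ) (μ : ℝ) : Prop :=
  ∀ t : Fin T, ∑ k : Fin r, (Matrix.diagonal σ * Vᵀ) k t ^ 2
    ≤ μ ^ 2 * ((r : ℝ) / T) * sigmaMax σ ^ 2

/-! ### QR decomposition -/

/-- `M = Q R` is a (reduced) QR decomposition: `Q` has orthonormal columns and `R` is upper
triangular. -/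
structure IsQR {d r : ℕ} (M Q : Matrix (Fin d) (Fin r) ℝ) (R : Matrix (Fin r) (Fin r) ℝ) :
    Prop where
  orthonormal : Qᵀ * Q = 1
  upper : R.BlockTriangular id
  eq : M = Q * R

/-- `qr` returns the `Q`-factor of some QR decomposition of every matrix with linearly
independent columns. (The factor is unique up to signs of the columns; any sign convention is
allowed. On other matrices, the output of `qr` is arbitrary.) -/
def IsQRRoutine {d r : ℕ} (qr : Matrix (Fin d) (Fin r) ℝ → Matrix (Fin d) (Fin r) ℝ) : Prop :=
  ∀ M : Matrix (Fin d) (Fin r) ℝ, LinearIndependent ℝ Mᵀ → ∃ R, IsQR M (qr M) R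

/-! ### Network, weights and the agreement protocol -/

/-- `W` is a symmetric doubly stochastic weight matrix of the network `G`: only a node itself
and its neighbours may get nonzero weight. -/
structure IsWeightMatrix {L : ℕ} (G : SimpleGraph (Fin L)) (W : Matrix (Fin L) (Fin L) ℝ) :
    Prop where
  doublyStochastic : W ∈ doublyStochastic ℝ (Fin L)
  hermitian : W.IsHermitian
  support : ∀ g j, g ≠ j → ¬ G.Adj g j → W g j = 0

/-- Connectivity `γ(W) = max (|λ₂(W)|, |λ_L(W)|)`, where `λ₁ ≥ λ₂ ≥ … ≥ λ_L` are the eigenvalues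
of the symmetric matrix `W` with multiplicity; it is `0` for a network with a single node. -/
def connectivity {L : ℕ} (W : Matrix (Fin L) (Fin L) ℝ) (hW : W.IsHermitian) : ℝ :=
  if h : 2 ≤ L then
    max |hW.eigenvalues₀ ⟨1, by rw [Fintype.card_fin]; omega⟩|
      |hW.eigenvalues₀ ⟨L - 1, by rw [Fintype.card_fin]; omega⟩|
  else 0

/-- One agreement round `Z_g ← Z_g + ∑_{j ∈ N_g} W_{gj} (Z_j - Z_g)`. -/
def agreeStep {L : ℕ} (G : SimpleGraph (Fin L)) [DecidableRel G.Adj]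
    (W : Matrix (Fin L) (Fin L) ℝ) {E : Type*} [AddCommGroup E] [Module ℝ E]
    (Z : Fin L → E) : Fin L → E :=
  fun g => Z g + ∑ j ∈ G.neighborFinset g, W g j • (Z j - Z g)

/-- The agreement protocol with `Tcon` rounds. -/
def agree {L : ℕ} (G : SimpleGraph (Fin L)) [DecidableRel G.Adj]
    (W : Matrix (Fin L) (Fin L) ℝ) {E : Type*} [AddCommGroup E] [Module ℝ E] (Tcon : ℕ)
    (Z : Fin L → E) : Fin L → E :=
  (agreeStep G W)^[Tcon] Z

open Classical in
/-- One broadcast round: every node with a nonzero matrix sends it to its neighbours, and every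
node that receives a nonzero matrix replaces its own by (one of) the received. -/
def broadcastStep {L : ℕ} (G : SimpleGraph (Fin L)) {E : Type*} [Zero E] (U : Fin L → E) : Fin L → E :=
  fun g => if h : ∃ j, G.Adj g j ∧ U j ≠ 0 then U h.choose else U g

/-- Zeroing of all matrices except that of the node `root`, followed by as many broadcast rounds
as the eccentricity of `root`. -/
def broadcast {L : ℕ} (G : SimpleGraph (Fin L)) {E : Type*} [Zero E] (root : Fin L) (U : Fin L → E) : Fin L → E :=
  (broadcastStep G)^[(G.eccent root).toNat] (fun g => if g = root then U g else 0)

/-! ### The initialization algorithm -/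

/-- Responses `y_t = X_t θ_t`, where `θ_t` is the `t`-th column of `Θ`. -/
def responses {d T n : ℕ} (Θ : Matrix (Fin d) (Fin T) ℝ) (X : Fin T → Matrix (Fin n) (Fin d) ℝ) :
    Fin T → Fin n → ℝ :=
  fun t => X t *ᵥ (fun a => Θ a t)

/-- Truncation: entries with `y_i² > α` are replaced by zero. -/
def truncate {n : ℕ} (α : ℝ) (y : Fin n → ℝ) : Fin n → ℝ :=
  fun i => if y i ^ 2 ≤ α then y i else 0

/-- Local threshold `9 κ² μ² (L / (n T)) ∑_{t ∈ S_g} ∑_i y_{ti}²` of node `g`. -/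
def thresholdIn {L T n : ℕ} (S : Fin L → Finset (Fin T)) (κ μ : ℝ) (y : Fin T → Fin n → ℝ)
    (g : Fin L) : ℝ :=
  9 * κ ^ 2 * μ ^ 2 * ((L : ℝ) / ((n : ℝ) * (T : ℝ))) * ∑ t ∈ S g, ∑ i, y t i ^ 2

/-- The matrix `[(1/n) X_tᵀ y_{t,trnc}, t ∈ S_g]` of node `g`, truncated at level `α`. -/
def localTheta {L d T n : ℕ} (S : Fin L → Finset (Fin T)) (X : Fin T → Matrix (Fin n) (Fin d) ℝ)
    (y : Fin T → Fin n → ℝ) (α : ℝ) (g : Fin L) : Matrix (Fin d) {t // t ∈ S g} ℝ :=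
  Matrix.of fun a t => (1 / (n : ℝ)) * ((X t)ᵀ *ᵥ truncate α (y t)) a

section Algorithm

variable {L d T n r : ℕ} [NeZero L] (G : SimpleGraph (Fin L)) [DecidableRel G.Adj]
  (W : Matrix (Fin L) (Fin L) ℝ)
  (qr : Matrix (Fin d) (Fin r) ℝ → Matrix (Fin d) (Fin r) ℝ)

/-- One round of the decentralized power method: local multiplication, agreement, QR at every
node, and broadcast of the result of the first node (node `0` of `Fin L`). -/
def pmRound {ι : Fin L → Type*} [∀ g, Fintype (ι g)] (Tcon : ℕ)
    (Θ₀ : ∀ g, Matrix (Fin d) (ι g) ℝ) (U : Fin L → Matrix (Fin d) (Fin r) ℝ) :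
    Fin L → Matrix (Fin d) (Fin r) ℝ :=
  broadcast G 0 (fun g => qr (agree G W Tcon (fun g' => Θ₀ g' * (Θ₀ g')ᵀ * U g') g))

/-- The modified decentralized spectral initialization: the list of node estimates after `Tpm`
rounds. The inputs `(X₀₀, y₀₀)` and `(X₀, y₀)` are the two disjoint sample sets used for the
thresholds and for the power method, and `Z` is the random start, common to all nodes. -/
def spectralInit (S : Fin L → Finset (Fin T)) (κ μ : ℝ) (Tcon Tpm : ℕ)
    (y₀₀ : Fin T → Fin n → ℝ)
    (X₀ : Fin T → Matrix (Fin n) (Fin d) ℝ) (y₀ : Fin T → Fin n → ℝ)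
    (Z : Matrix (Fin d) (Fin r) ℝ) : Fin L → Matrix (Fin d) (Fin r) ℝ :=
  let α : Fin L → ℝ := agree G W Tcon (thresholdIn S κ μ y₀₀)
  (pmRound G W qr Tcon (fun g => localTheta S X₀ y₀ (α g) g))^[Tpm] (fun _ => qr Z)

end Algorithm

/-! ### The random inputs -/

/-- All scalar random inputs in one family: the entries of the two groups of sample matrices
`X₀₀` and `X₀`, and those of the random start `Z`. -/
def randomEntries {Ω : Type*} {T n d r : ℕ} (X₀₀ X₀ : Ω → Fin T → Matrix (Fin n) (Fin d) ℝ)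
    (Z : Ω → Matrix (Fin d) (Fin r) ℝ) :
    (Fin T × Fin n × Fin d) ⊕ (Fin T × Fin n × Fin d) ⊕ (Fin d × Fin r) → Ω → ℝ
  | .inl (t, i, a), ω => X₀₀ ω t i a
  | .inr (.inl (t, i, a)), ω => X₀ ω t i a
  | .inr (.inr (a, k)), ω => Z ω a k

/-- All entries of `X₀₀`, `X₀` and `Z` are jointly independent standard Gaussian. -/
structure IIDStdGaussian {Ω : Type*} [MeasurableSpace Ω] (P : Measure Ω) {T n d r : ℕ}
    (X₀₀ X₀ : Ω → Fin T → Matrix (Fin n) (Fin d) ℝ) (Z : Ω → Matrix (Fin d) (Fin r) ℝ) :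
    Prop where
  law : ∀ k, HasLaw (randomEntries X₀₀ X₀ Z k) (gaussianReal 0 1) P
  indep : iIndepFun (randomEntries X₀₀ X₀ Z) P

end DecMTRL

end

/-! The broadcast makes all nodes hold the same matrix `Q` at the start of every round, so agreement
only forms a linear image of `Q`, and one round is `Q ↦ qr (M * Q)` with one fixed symmetric matrix
`M = ∑ⱼ (W ^ Tcon) 0 j • Θ₀ⱼ Θ₀ⱼᵀ`. The decentralized method is therefore an exact power iteration.
By `pmRound_iterate`, the common matrix after `k` rounds is an orthonormal basis of the range of `M
^ k * Z`, whichever QR routine is used. Consensus errors never accumulate: the only requirement is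
that the entries of `W ^ Tcon` lie within ten percent of `1 / L`, which follows from the spectral
bound `abs_pow_sub_le`.

These weights compare the quadratic form of `M` with that of `Y Yᵀ / L`, where `Y` is the truncated
data matrix. Given the first sample, the thresholds are constants. By rotation invariance, the mean
of the column of task `t` is a multiple `β_t θ_t`, with `β_t ≥ 1/2` once the threshold exceeds a
constant times `‖θ_t‖²` (`exists_truncMean_eq`). Thresholds may differ between nodes: rescaling
columns by factors at least `1/2` keeps the column space of `U⋆` and loses a bounded factor in the
least singular value. Truncation makes each noise term sub-Gaussian, so a net argument bounds `Y - E
Y` in operator norm by a small multiple of `σ_min δ₀` (`sampleLaw_noise_le`). Hence `M` has `r`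
eigenvalues of size at least `σ_min² / (10 L)`, all others are at most `σ_min² / (5000 L)`, and the
leading eigenspace is close to the range of `U⋆` (`exists_leading_space`).

The ratio of these two levels is the constant 500, so a multiple of `log (d / δ₀)` rounds suffices,
provided that `M ^ k * Z` is not nearly degenerate. This is a small-ball estimate for the Gaussian
start, conditional on both samples (`startLaw_exists_le`).

The events are nested: energy of the first sample, noise of the second at the resulting thresholds,
and degeneracy of the start for the resulting `M`. Each is bounded on slices with the earlier data
fixed. The exceptional set is described through `M ^ k * Z` alone and never mentions `qr`, so no
measurability of the QR routine is needed. -/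

namespace DecMTRL

open scoped NNReal ENNReal

/-! ### Squared Euclidean norms of coordinate vectors -/

section DotProduct

variable {ι : Type*} [Fintype ι]

lemma dotProduct_self_nonneg' (x : ι → ℝ) : 0 ≤ x ⬝ᵥ x :=
  Finset.sum_nonneg fun i _ => mul_self_nonneg (x i)

lemma dotProduct_sq_le (x y : ι → ℝ) : (x ⬝ᵥ y) ^ 2 ≤ (x ⬝ᵥ x) * (y ⬝ᵥ y) := by
  simpa only [dotProduct, sq] using Finset.sum_mul_sq_le_sq_mul_sq Finset.univ x y

lemma dotProduct_sub_self_le (x y : ι → ℝ) :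
    (x - y) ⬝ᵥ (x - y) ≤ 2 * (x ⬝ᵥ x) + 2 * (y ⬝ᵥ y) := by
  have h := dotProduct_self_nonneg' (x + y)
  simp only [dotProduct_sub, sub_dotProduct, dotProduct_add, add_dotProduct] at h ⊢
  linarith

lemma mulVec_dotProduct_self_of_orthonormal {κ : Type*} [Fintype κ] [DecidableEq κ]
    {U : Matrix ι κ ℝ} (hU : Uᵀ * U = 1) (c : κ → ℝ) : (U *ᵥ c) ⬝ᵥ (U *ᵥ c) = c ⬝ᵥ c := by
  rw [dotProduct_mulVec, vecMul_mulVec, hU, vecMul_one]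

lemma mulVec_dotProduct_eq {κ : Type*} [Fintype κ] (A : Matrix ι κ ℝ) (c : κ → ℝ) (x : ι → ℝ) :
    (A *ᵥ c) ⬝ᵥ x = c ⬝ᵥ (Aᵀ *ᵥ x) := by
  rw [dotProduct_comm, dotProduct_mulVec, dotProduct_comm, mulVec_transpose]

end DotProduct

/-! ### Orthonormal eigenbases in coordinates -/

/-- `v` is an orthonormal basis of eigenvectors of `M`, with eigenvalues `lam`. -/
structure IsEigenbasis {ι : Type*} [Fintype ι] [DecidableEq ι] (M : Matrix ι ι ℝ)
    (v : ι → ι → ℝ) (lam : ι → ℝ) : Prop where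
  orth : ∀ i j, v i ⬝ᵥ v j = if i = j then 1 else 0
  eig : ∀ i, M *ᵥ v i = lam i • v i
  expand : ∀ x, x = ∑ i, (v i ⬝ᵥ x) • v i

section Eigen

variable {ι : Type*} [Fintype ι] [DecidableEq ι] {M : Matrix ι ι ℝ} {v : ι → ι → ℝ} {lam : ι → ℝ}

lemma exists_isEigenbasis (hM : M.IsHermitian) : ∃ v, IsEigenbasis M v hM.eigenvalues := by
  refine ⟨fun i => ⇑(hM.eigenvectorBasis i), ?_, ?_, ?_⟩
  · intro i j
    have h := orthonormal_iff_ite.1 hM.eigenvectorBasis.orthonormal i j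
    rw [← h, EuclideanSpace.inner_eq_star_dotProduct, dotProduct_comm]
    simp
  · intro i
    simpa using hM.mulVec_eigenvectorBasis i
  · intro x
    have h := hM.eigenvectorBasis.sum_repr' (WithLp.toLp 2 x)
    have h2 := congrArg WithLp.ofLp h
    simp only [WithLp.ofLp_sum, WithLp.ofLp_smul] at h2
    rw [← h2]
    refine Finset.sum_congr rfl fun i _ => ?_
    congr 1
    rw [EuclideanSpace.inner_eq_star_dotProduct, dotProduct_comm, h2]
    simp

namespace IsEigenbasis

lemma dotProduct_sum (h : IsEigenbasis M v lam) (s : Finset ι) (c : ι → ℝ) (i : ι) :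
    v i ⬝ᵥ (∑ j ∈ s, c j • v j) = if i ∈ s then c i else 0 := by
  simp [_root_.dotProduct_sum, dotProduct_smul, h.orth]

lemma dotProduct_eq (h : IsEigenbasis M v lam) (x y : ι → ℝ) :
    x ⬝ᵥ y = ∑ i, (v i ⬝ᵥ x) * (v i ⬝ᵥ y) := by
  conv_lhs => rw [h.expand x]
  simp [sum_dotProduct, smul_dotProduct]

lemma dotProduct_mulVec_eq (h : IsEigenbasis M v lam) (x : ι → ℝ) (i : ι) :
    v i ⬝ᵥ (M *ᵥ x) = lam i * (v i ⬝ᵥ x) := by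
  conv_lhs => rw [h.expand x]
  have : M *ᵥ (∑ j, (v j ⬝ᵥ x) • v j) = ∑ j, ((v j ⬝ᵥ x) * lam j) • v j := by
    simp only [mulVec_sum, mulVec_smul, h.eig, smul_smul]
  rw [this, h.dotProduct_sum]
  simp [mul_comm]

lemma quadForm_eq (h : IsEigenbasis M v lam) (x : ι → ℝ) :
    x ⬝ᵥ (M *ᵥ x) = ∑ i, lam i * (v i ⬝ᵥ x) ^ 2 := by
  rw [h.dotProduct_eq]
  refine Finset.sum_congr rfl fun i _ => ?_
  rw [h.dotProduct_mulVec_eq]; ring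

lemma self_eq (h : IsEigenbasis M v lam) (x : ι → ℝ) : x ⬝ᵥ x = ∑ i, (v i ⬝ᵥ x) ^ 2 := by
  rw [h.dotProduct_eq]
  exact Finset.sum_congr rfl fun i _ => (sq _).symm

lemma pow (h : IsEigenbasis M v lam) (k : ℕ) : IsEigenbasis (M ^ k) v (fun i => lam i ^ k) := by
  refine ⟨h.orth, fun i => ?_, h.expand⟩
  induction k with
  | zero => simp
  | succ k ih => rw [pow_succ, ← mulVec_mulVec, h.eig, mulVec_smul, ih, smul_smul, pow_succ,
      mul_comm]

lemma mulVec_self_eq (h : IsEigenbasis M v lam) (x : ι → ℝ) :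
    (M *ᵥ x) ⬝ᵥ (M *ᵥ x) = ∑ i, lam i ^ 2 * (v i ⬝ᵥ x) ^ 2 := by
  rw [h.self_eq]
  refine Finset.sum_congr rfl fun i _ => ?_
  rw [h.dotProduct_mulVec_eq]; ring

/-- If the quadratic form of `M` is at most `t₁` on the orthogonal complement of an
`r`-dimensional space and at least `t₂ > t₁` on that space, then exactly `r` eigenvalues of `M` are
at least `t₂`, and all the others are at most `t₁`. -/
lemma exists_spectral_gap (h : IsEigenbasis M v lam) {r : ℕ} {U : Matrix ι (Fin r) ℝ}
    (hU : Uᵀ * U = 1) {t₁ t₂ : ℝ} (ht : t₁ < t₂)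
    (hperp : ∀ x, Uᵀ *ᵥ x = 0 → x ⬝ᵥ (M *ᵥ x) ≤ t₁ * (x ⬝ᵥ x))
    (hrange : ∀ c, t₂ * (c ⬝ᵥ c) ≤ (U *ᵥ c) ⬝ᵥ (M *ᵥ (U *ᵥ c))) :
    ∃ I : Finset ι, I.card = r ∧ (∀ i ∈ I, t₂ ≤ lam i) ∧ ∀ i ∉ I, lam i ≤ t₁ := by
  classical
  set I : Finset ι := {i | t₁ < lam i} with hI
  set J : Finset ι := {i | t₂ ≤ lam i} with hJ
  have hJI : J ⊆ I := fun i hi => by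
    simp only [hI, hJ, Finset.mem_filter, Finset.mem_univ, true_and] at hi ⊢
    linarith
  -- If `I` had more than `r` elements, the span of its eigenvectors would contain a nonzero vector
  -- killed by `Uᵀ`; its quadratic form would exceed the bound `t₁` on the orthogonal complement.
  have hIr : I.card ≤ r := by
    by_contra hlt
    push Not at hlt
    let f : (I → ℝ) →ₗ[ℝ] (Fin r → ℝ) :=
      (Uᵀ).mulVecLin ∘ₗ (Matrix.of (fun a (i : I) => v i a)).mulVecLin
    have hker := LinearMap.ker_ne_bot_of_finrank_lt (f := f) (by simpa using hlt)
    obtain ⟨c, hc, hc0⟩ := Submodule.exists_mem_ne_zero_of_ne_bot hker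
    set c' : ι → ℝ := fun i => if hi : i ∈ I then c ⟨i, hi⟩ else 0 with hc'
    have hx : (Matrix.of (fun a (i : I) => v i a)) *ᵥ c = ∑ i ∈ I, c' i • v i := by
      ext a
      simp only [mulVec, dotProduct, of_apply, Finset.sum_apply, Pi.smul_apply, smul_eq_mul]
      rw [← Finset.sum_coe_sort I]
      refine Finset.sum_congr rfl fun i _ => ?_
      simp [hc', mul_comm]
    set x : ι → ℝ := ∑ i ∈ I, c' i • v i with hxdef
    have hcoef : ∀ i, v i ⬝ᵥ x = c' i := fun i => by
      rw [hxdef, h.dotProduct_sum]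
      by_cases hi : i ∈ I <;> simp [hi, hc']
    have hUx : Uᵀ *ᵥ x = 0 := by
      have := LinearMap.mem_ker.1 hc
      rwa [LinearMap.comp_apply, mulVecLin_apply, mulVecLin_apply, hx] at this
    have h1 := hperp x hUx
    rw [h.quadForm_eq, h.self_eq, Finset.mul_sum] at h1
    obtain ⟨i, hi⟩ := Function.ne_iff.1 hc0
    refine absurd h1 (not_le.2 (Finset.sum_lt_sum (fun j _ => ?_) ⟨i.1, Finset.mem_univ _, ?_⟩))
    · rw [hcoef]
      by_cases hj : j ∈ I
      · have : t₁ < lam j := by simpa [hI] using hj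
        gcongr
      · simp [hc', hj]
    · rw [hcoef]
      have h2 : t₁ < lam i.1 := (Finset.mem_filter.1 i.2).2
      have h3 : c' i.1 = c i := by simp [hc', i.2]
      rw [h3]
      have : 0 < c i ^ 2 := by
        have : c i ≠ 0 := hi
        positivity
      gcongr
  -- The dual count: if `J` had fewer than `r` elements, some nonzero `U *ᵥ c` would be orthogonal
  -- to all its eigenvectors, so its form would fall below `t₂`.
  have hJr : r ≤ J.card := by
    by_contra hlt
    push Not at hlt
    let f : (Fin r → ℝ) →ₗ[ℝ] (J → ℝ) :=
      (Matrix.of (fun (i : J) a => v i a)).mulVecLin ∘ₗ U.mulVecLin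
    have hker := LinearMap.ker_ne_bot_of_finrank_lt (f := f) (by simpa using hlt)
    obtain ⟨c, hc, hc0⟩ := Submodule.exists_mem_ne_zero_of_ne_bot hker
    have hz : ∀ i ∈ J, v i ⬝ᵥ (U *ᵥ c) = 0 := fun i hi => by
      have := congrFun (LinearMap.mem_ker.1 hc) ⟨i, hi⟩
      simpa [f, mulVec] using this
    have h1 := hrange c
    rw [← mulVec_dotProduct_self_of_orthonormal hU, h.quadForm_eq, h.self_eq, Finset.mul_sum] at h1
    have hpos : 0 < (U *ᵥ c) ⬝ᵥ (U *ᵥ c) := by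
      rw [mulVec_dotProduct_self_of_orthonormal hU]
      exact lt_of_le_of_ne (dotProduct_self_nonneg' c)
        (fun h0 => hc0 (dotProduct_self_eq_zero.1 h0.symm))
    have hex : ∃ i, v i ⬝ᵥ (U *ᵥ c) ≠ 0 := by
      by_contra hall
      push Not at hall
      rw [h.self_eq] at hpos
      simp [hall] at hpos
    obtain ⟨i, hi⟩ := hex
    refine absurd h1 (not_le.2 (Finset.sum_lt_sum (fun j _ => ?_) ⟨i, Finset.mem_univ _, ?_⟩))
    · by_cases hj : j ∈ J
      · simp [hz j hj]
      · have : lam j < t₂ := by simpa [hJ] using hj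
        gcongr
    · have hiJ : i ∉ J := fun hiJ => hi (hz i hiJ)
      have : lam i < t₂ := by simpa [hJ] using hiJ
      gcongr
  have hIJ : J = I := Finset.eq_of_subset_of_card_le hJI (hIr.trans hJr)
  refine ⟨I, le_antisymm hIr (hIJ ▸ hJr), fun i hi => ?_, fun i hi => ?_⟩
  · rw [← hIJ] at hi
    simpa [hJ] using hi
  · simpa [hI] using hi

/-- Power iteration: the range of `M ^ k * Z` contains a good approximation of each vector that is
nearly orthogonal to the eigenvectors of small eigenvalue. -/
lemma exists_power_approx (h : IsEigenbasis M v lam) {r : ℕ} {I : Finset ι} (hcard : I.card = r)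
    {U Z : Matrix ι (Fin r) ℝ} {t₁ R ρ β ε : ℝ} {k : ℕ} (hρ : 0 < ρ) (hβ : 0 ≤ β)
    (hε0 : 0 ≤ ε)
    (hlam : ∀ i ∉ I, 0 ≤ lam i ∧ lam i ≤ t₁)
    (hZ : ∀ a, (Z *ᵥ a) ⬝ᵥ (Z *ᵥ a) ≤ R * (a ⬝ᵥ a))
    (hMZ : ∀ a, ρ * (a ⬝ᵥ a) ≤ ((M ^ k * Z) *ᵥ a) ⬝ᵥ ((M ^ k * Z) *ᵥ a))
    (hε : t₁ ^ (2 * k) * R ≤ ε * ρ) (hε' : ε ≤ 1 / 2)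
    (hU : ∀ y, (∀ i ∈ I, v i ⬝ᵥ y = 0) → (Uᵀ *ᵥ y) ⬝ᵥ (Uᵀ *ᵥ y) ≤ β * (y ⬝ᵥ y))
    (hU1 : Uᵀ * U = 1) (c : Fin r → ℝ) :
    ∃ a, (U *ᵥ c - (M ^ k * Z) *ᵥ a) ⬝ᵥ (U *ᵥ c - (M ^ k * Z) *ᵥ a)
      ≤ (2 * β + 4 * ε) * (c ⬝ᵥ c) := by
  classical
  have hk := h.pow k
  have hlow : ∀ a, ∑ i ∈ Iᶜ, (v i ⬝ᵥ ((M ^ k * Z) *ᵥ a)) ^ 2 ≤ ε * ρ * (a ⬝ᵥ a) := by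
    intro a
    have h1 : ∑ i ∈ Iᶜ, (v i ⬝ᵥ ((M ^ k * Z) *ᵥ a)) ^ 2
        ≤ ∑ i ∈ Iᶜ, t₁ ^ (2 * k) * (v i ⬝ᵥ (Z *ᵥ a)) ^ 2 := by
      refine Finset.sum_le_sum fun i hi => ?_
      rw [← mulVec_mulVec, hk.dotProduct_mulVec_eq, mul_pow, ← pow_mul, mul_comm k 2]
      have := hlam i (Finset.mem_compl.1 hi)
      exact mul_le_mul_of_nonneg_right (pow_le_pow_left₀ this.1 this.2 _) (sq_nonneg _)
    have h2 : ∑ i ∈ Iᶜ, t₁ ^ (2 * k) * (v i ⬝ᵥ (Z *ᵥ a)) ^ 2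
        ≤ t₁ ^ (2 * k) * ((Z *ᵥ a) ⬝ᵥ (Z *ᵥ a)) := by
      rw [h.self_eq, Finset.mul_sum]
      refine Finset.sum_le_univ_sum_of_nonneg fun i => ?_
      rw [mul_comm 2 k, pow_mul]; positivity
    have h3 : t₁ ^ (2 * k) * ((Z *ᵥ a) ⬝ᵥ (Z *ᵥ a)) ≤ t₁ ^ (2 * k) * (R * (a ⬝ᵥ a)) :=
      mul_le_mul_of_nonneg_left (hZ a) (by rw [mul_comm 2 k, pow_mul]; positivity)
    have h4 : t₁ ^ (2 * k) * R * (a ⬝ᵥ a) ≤ ε * ρ * (a ⬝ᵥ a) :=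
      mul_le_mul_of_nonneg_right hε (dotProduct_self_nonneg' a)
    linarith
  have hhigh : ∀ a, ρ / 2 * (a ⬝ᵥ a) ≤ ∑ i ∈ I, (v i ⬝ᵥ ((M ^ k * Z) *ᵥ a)) ^ 2 := by
    intro a
    have h1 := hMZ a
    rw [h.self_eq, ← Finset.sum_add_sum_compl I] at h1
    have h2 := hlow a
    have h3 : ε * ρ * (a ⬝ᵥ a) ≤ 1 / 2 * ρ * (a ⬝ᵥ a) :=
      mul_le_mul_of_nonneg_right (mul_le_mul_of_nonneg_right hε' hρ.le) (dotProduct_self_nonneg' a)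
    linarith
  -- The leading coordinates of `M ^ k * Z * a`. This map is injective by `hhigh`, hence bijective
  -- because `I` has `r` elements; so `a` can be chosen to match the leading coordinates of `U *ᵥ c`
  -- exactly, and only tail coordinates remain to be bounded.
  let f : (Fin r → ℝ) →ₗ[ℝ] (I → ℝ) :=
    (Matrix.of (fun (i : I) a => v i a)).mulVecLin ∘ₗ (M ^ k * Z).mulVecLin
  have hf : ∀ a i, f a i = v i ⬝ᵥ ((M ^ k * Z) *ᵥ a) := fun a i => by
    simp [f, mulVec]
  have hinj : Function.Injective f := by
    rw [← LinearMap.ker_eq_bot, LinearMap.ker_eq_bot']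
    intro a ha
    have h1 := hhigh a
    have h2 : ∑ i ∈ I, (v i ⬝ᵥ ((M ^ k * Z) *ᵥ a)) ^ 2 = 0 := by
      refine Finset.sum_eq_zero fun i hi => ?_
      rw [← hf a ⟨i, hi⟩, ha]; simp
    have h3 := dotProduct_self_nonneg' a
    exact dotProduct_self_eq_zero.1 (by nlinarith)
  have hsurj : Function.Surjective f :=
    (LinearMap.injective_iff_surjective_of_finrank_eq_finrank (by simp [hcard])).1 hinj
  set x := U *ᵥ c with hx
  obtain ⟨a, ha⟩ := hsurj (fun i => v i ⬝ᵥ x)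
  have hcoef : ∀ i ∈ I, v i ⬝ᵥ ((M ^ k * Z) *ᵥ a) = v i ⬝ᵥ x := fun i hi => by
    rw [← hf a ⟨i, hi⟩, ha]
  have hxx : x ⬝ᵥ x = c ⬝ᵥ c := mulVec_dotProduct_self_of_orthonormal hU1 c
  have hcc := dotProduct_self_nonneg' c
  have hIle : ∑ i ∈ I, (v i ⬝ᵥ x) ^ 2 ≤ c ⬝ᵥ c := by
    rw [← hxx, h.self_eq]
    exact Finset.sum_le_univ_sum_of_nonneg fun i => sq_nonneg _
  have hanorm : ρ / 2 * (a ⬝ᵥ a) ≤ c ⬝ᵥ c := by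
    refine (hhigh a).trans (le_trans (le_of_eq ?_) hIle)
    exact Finset.sum_congr rfl fun i hi => by rw [hcoef i hi]
  -- the part of `x` outside the leading eigenspace
  set y : ι → ℝ := ∑ i ∈ Iᶜ, (v i ⬝ᵥ x) • v i with hy
  have hycoef : ∀ i, v i ⬝ᵥ y = if i ∈ Iᶜ then v i ⬝ᵥ x else 0 := fun i => h.dotProduct_sum _ _ i
  have hyy : y ⬝ᵥ y = ∑ i ∈ Iᶜ, (v i ⬝ᵥ x) ^ 2 := by
    rw [h.self_eq, ← Finset.sum_add_sum_compl I, Finset.sum_eq_zero, zero_add]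
    · exact Finset.sum_congr rfl fun i hi => by rw [hycoef, if_pos hi]
    · intro i hi
      rw [hycoef, if_neg (by simpa using hi)]; simp
  have hyx : y ⬝ᵥ x = y ⬝ᵥ y := by
    rw [hyy, hy, sum_dotProduct]
    exact Finset.sum_congr rfl fun i _ => by rw [smul_dotProduct, smul_eq_mul, sq]
  -- Duality: `y ⬝ᵥ y = y ⬝ᵥ (U *ᵥ c) = c ⬝ᵥ (Uᵀ *ᵥ y)`, and `hU` applies to `y` since its leading
  -- coordinates vanish.
  have hyb : y ⬝ᵥ y ≤ β * (c ⬝ᵥ c) := by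
    have h1 := hU y (fun i hi => by rw [hycoef, if_neg (by simpa using hi)])
    have h2 : y ⬝ᵥ y = c ⬝ᵥ (Uᵀ *ᵥ y) := by
      rw [← hyx, dotProduct_comm, hx, mulVec_dotProduct_eq]
    have h3 := dotProduct_sq_le c (Uᵀ *ᵥ y)
    rw [← h2] at h3
    have h4 := dotProduct_self_nonneg' y
    have h5 : (y ⬝ᵥ y) * (y ⬝ᵥ y) ≤ (β * (c ⬝ᵥ c)) * (y ⬝ᵥ y) := by nlinarith
    rcases h4.eq_or_lt with h0 | h0
    · rw [← h0]; positivity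
    · exact le_of_mul_le_mul_right h5 h0
  refine ⟨a, ?_⟩
  have hsplit : ∑ i, (v i ⬝ᵥ (x - (M ^ k * Z) *ᵥ a)) ^ 2
      = ∑ i ∈ Iᶜ, (v i ⬝ᵥ (x - (M ^ k * Z) *ᵥ a)) ^ 2 := by
    rw [← Finset.sum_add_sum_compl I, Finset.sum_eq_zero, zero_add]
    intro i hi
    rw [dotProduct_sub, hcoef i hi, sub_self]; simp
  rw [h.self_eq, hsplit]
  calc ∑ i ∈ Iᶜ, (v i ⬝ᵥ (x - (M ^ k * Z) *ᵥ a)) ^ 2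
      ≤ ∑ i ∈ Iᶜ, (2 * (v i ⬝ᵥ x) ^ 2 + 2 * (v i ⬝ᵥ ((M ^ k * Z) *ᵥ a)) ^ 2) := by
        refine Finset.sum_le_sum fun i _ => ?_
        rw [dotProduct_sub]
        nlinarith [sq_nonneg (v i ⬝ᵥ x + v i ⬝ᵥ ((M ^ k * Z) *ᵥ a))]
    _ = 2 * (y ⬝ᵥ y) + 2 * ∑ i ∈ Iᶜ, (v i ⬝ᵥ ((M ^ k * Z) *ᵥ a)) ^ 2 := by
        rw [hyy, Finset.sum_add_distrib, Finset.mul_sum, Finset.mul_sum]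
    _ ≤ 2 * (β * (c ⬝ᵥ c)) + 2 * (2 * ε * (c ⬝ᵥ c)) := by
        have h1 := hlow a
        have h2 := mul_le_mul_of_nonneg_left hanorm (mul_nonneg zero_le_two hε0)
        nlinarith
    _ = _ := by ring

end IsEigenbasis

end Eigen

/-! ### Agreement and broadcast -/

section Network

variable {L : ℕ} {G : SimpleGraph (Fin L)} {W : Matrix (Fin L) (Fin L) ℝ}

/-- The difference form of the update is multiplication by `W`: non-neighbours have zero weight, and
unit row sums absorb the term `Z g`. -/
lemma agreeStep_eq [DecidableRel G.Adj] (hW : IsWeightMatrix G W) {E : Type*} [AddCommGroup E]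
    [Module ℝ E] (Z : Fin L → E) (g : Fin L) : agreeStep G W Z g = ∑ j, W g j • Z j := by
  have h1 : ∑ j ∈ G.neighborFinset g, W g j • (Z j - Z g) = ∑ j, W g j • (Z j - Z g) := by
    refine Finset.sum_subset (Finset.subset_univ _) fun j _ hj => ?_
    rw [SimpleGraph.mem_neighborFinset] at hj
    rcases eq_or_ne g j with rfl | hne
    · simp
    · rw [hW.support g j hne hj, zero_smul]
  rw [agreeStep, h1]
  simp only [smul_sub, Finset.sum_sub_distrib, ← Finset.sum_smul,
    sum_row_of_mem_doublyStochastic hW.doublyStochastic, one_smul, add_sub_cancel]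

lemma agree_eq [DecidableRel G.Adj] (hW : IsWeightMatrix G W) {E : Type*} [AddCommGroup E]
    [Module ℝ E] (k : ℕ) (Z : Fin L → E) (g : Fin L) :
    agree G W k Z g = ∑ j, (W ^ k) g j • Z j := by
  induction k generalizing g with
  | zero => simp [agree, one_apply]
  | succ k ih =>
    have h : agree G W (k + 1) Z g = agreeStep G W (agree G W k Z) g := by
      simp only [agree, Function.iterate_succ_apply']
    rw [h, agreeStep_eq hW]
    simp only [ih, Finset.smul_sum, smul_smul, pow_succ', mul_apply, Finset.sum_smul]
    exact Finset.sum_comm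

/-- Discard the index that comes first in the decreasing order; every other eigenvalue lies between
the second and the last. That the discarded one equals `1` is established only in `abs_pow_sub_le`.
-/
lemma exists_abs_eigenvalues_le (hW : W.IsHermitian) [NeZero L] :
    ∃ i₀, ∀ i, i ≠ i₀ → |hW.eigenvalues i| ≤ connectivity W hW := by
  by_cases h : 2 ≤ L
  · set e : Fin (Fintype.card (Fin L)) ≃ Fin L := Fintype.equivOfCardEq (Fintype.card_fin _)
    have hc : Fintype.card (Fin L) = L := Fintype.card_fin L
    refine ⟨e ⟨0, by omega⟩, fun i hi => ?_⟩
    have hne : (e.symm i).1 ≠ 0 := fun h0 => hi <| by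
      rw [← e.apply_symm_apply i]
      exact congrArg e (Fin.ext h0)
    have hlt := (e.symm i).2
    rw [connectivity, dif_pos h, IsHermitian.eigenvalues, max_comm]
    refine abs_le_max_abs_abs (hW.eigenvalues₀_antitone ?_) (hW.eigenvalues₀_antitone ?_)
    · rw [Fin.le_def]
      change (e.symm i).1 ≤ L - 1
      omega
    · rw [Fin.le_def]
      change 1 ≤ (e.symm i).1
      omega
  · have hL : L = 1 := by have := NeZero.ne L; omega
    subst hL
    exact ⟨0, fun i hi => absurd (Subsingleton.elim i 0) hi⟩

lemma connectivity_nonneg (hW : W.IsHermitian) : 0 ≤ connectivity W hW := by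
  rw [connectivity]
  split_ifs
  · exact le_max_of_le_left (abs_nonneg _)
  · exact le_rfl

/-- The all-ones vector is fixed by `W`, hence orthogonal to every eigenvector with eigenvalue
different from `1`. So it is a multiple of the single remaining eigenvector, whose share of each
entry of `W ^ k` is exactly `1 / L`. The other eigenvectors contribute at most `γ ^ k`, because the
coordinates of an orthonormal basis at a fixed position have squares summing to one. -/
lemma abs_pow_sub_le [NeZero L] (hW : IsWeightMatrix G W)
    (hγ : connectivity W hW.hermitian < 1) (k : ℕ) (g j : Fin L) :
    |(W ^ k) g j - 1 / L| ≤ connectivity W hW.hermitian ^ k := by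
  set γ := connectivity W hW.hermitian with hγdef
  have hγ0 : 0 ≤ γ := connectivity_nonneg _
  obtain ⟨i₀, hi₀⟩ := exists_abs_eigenvalues_le hW.hermitian
  obtain ⟨v, hv⟩ := exists_isEigenbasis hW.hermitian
  set lam := hW.hermitian.eigenvalues
  have hone : ∀ i, lam i * (v i ⬝ᵥ 1) = v i ⬝ᵥ 1 := fun i => by
    rw [← hv.dotProduct_mulVec_eq, mulVec_one_of_mem_doublyStochastic hW.doublyStochastic]
  have hzero : ∀ i, i ≠ i₀ → v i ⬝ᵥ (1 : Fin L → ℝ) = 0 := fun i hi => by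
    have h1 : lam i < 1 := (le_abs_self _).trans_lt ((hi₀ i hi).trans_lt hγ)
    have h2 := hone i
    have h3 : (1 - lam i) * (v i ⬝ᵥ (1 : Fin L → ℝ)) = 0 := by linarith
    exact (mul_eq_zero.1 h3).resolve_left (by linarith)
  set s := v i₀ ⬝ᵥ (1 : Fin L → ℝ) with hs
  have hL : (0 : ℝ) < L := Nat.cast_pos.2 (Nat.pos_of_ne_zero (NeZero.ne L))
  have hss : s ^ 2 = L := by
    have h1 := hv.self_eq (1 : Fin L → ℝ)
    rw [Finset.sum_eq_single i₀ (fun i _ hi => by rw [hzero i hi]; simp) (by simp)] at h1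
    rw [hs, ← h1]
    simp [dotProduct]
  have hs0 : s ≠ 0 := fun h0 => by rw [h0] at hss; norm_num at hss; linarith
  have hlam0 : lam i₀ = 1 := by
    have := hone i₀
    exact mul_right_cancel₀ hs0 (by rw [this, one_mul])
  have hv0 : ∀ a, s * v i₀ a = 1 := fun a => by
    have h1 := congrFun (hv.expand (1 : Fin L → ℝ)) a
    rw [Finset.sum_eq_single i₀ (fun i _ hi => by rw [hzero i hi, zero_smul]) (by simp)] at h1
    simpa using h1.symm
  have hentry : (W ^ k) g j = ∑ i, lam i ^ k * (v i g * v i j) := by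
    have h1 : (W ^ k) g j = Pi.single g 1 ⬝ᵥ ((W ^ k) *ᵥ Pi.single j 1) := by simp
    rw [h1, hv.dotProduct_eq]
    refine Finset.sum_congr rfl fun i _ => ?_
    rw [(hv.pow k).dotProduct_mulVec_eq]
    simp
    ring
  have hsq : ∀ a : Fin L, ∑ i, v i a ^ 2 = 1 := fun a => by
    have := hv.self_eq (Pi.single a 1)
    simpa using this.symm
  have h0 : v i₀ g * v i₀ j = 1 / L := by
    rw [eq_div_iff hL.ne', ← hss]
    have := hv0 g; have := hv0 j
    calc v i₀ g * v i₀ j * s ^ 2 = (s * v i₀ g) * (s * v i₀ j) := by ring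
      _ = 1 := by rw [hv0, hv0, one_mul]
  rw [hentry, ← Finset.add_sum_erase _ _ (Finset.mem_univ i₀), hlam0, one_pow, one_mul, h0,
    add_sub_cancel_left]
  calc |∑ i ∈ Finset.univ.erase i₀, lam i ^ k * (v i g * v i j)|
      ≤ ∑ i ∈ Finset.univ.erase i₀, γ ^ k * ((v i g ^ 2 + v i j ^ 2) / 2) := by
        refine (Finset.abs_sum_le_sum_abs _ _).trans (Finset.sum_le_sum fun i hi => ?_)
        rw [abs_mul, abs_pow]
        refine mul_le_mul (pow_le_pow_left₀ (abs_nonneg _) (hi₀ i (Finset.ne_of_mem_erase hi)) k)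
          ?_ (abs_nonneg _) (by positivity)
        rw [abs_le]
        constructor <;> nlinarith [sq_nonneg (v i g + v i j), sq_nonneg (v i g - v i j)]
    _ ≤ ∑ i, γ ^ k * ((v i g ^ 2 + v i j ^ 2) / 2) :=
        Finset.sum_le_univ_sum_of_nonneg fun i => by positivity
    _ = γ ^ k := by
        rw [← Finset.mul_sum, ← Finset.sum_div, Finset.sum_add_distrib, hsq, hsq]; norm_num

/-- Every node always holds `0` or `Q`, so the arbitrary choice among received matrices is harmless;
`Q` then advances one edge per round along the walk. -/
lemma broadcastStep_iterate {E : Type*} [Zero E] (root : Fin L) {Q : E} (hQ : Q ≠ 0)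
    (k : ℕ) (g : Fin L) (p : G.Walk g root) (hp : p.length ≤ k) {U : Fin L → E}
    (hU : U root = Q) (h : ∀ g, U g = 0 ∨ U g = Q) :
    (∀ g, (broadcastStep G)^[k] U g = 0 ∨ (broadcastStep G)^[k] U g = Q) ∧
      (broadcastStep G)^[k] U g = Q := by
  have hval : ∀ k g, (broadcastStep G)^[k] U g = 0 ∨ (broadcastStep G)^[k] U g = Q := by
    intro k
    induction k with
    | zero => exact h
    | succ k ih =>
      intro g
      rw [Function.iterate_succ_apply', broadcastStep]
      split_ifs with hex
      · exact ih _
      · exact ih _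
  have hstep : ∀ k g, ((broadcastStep G)^[k] U g = Q ∨
      ∃ j, G.Adj g j ∧ (broadcastStep G)^[k] U j = Q) → (broadcastStep G)^[k + 1] U g = Q := by
    intro k g hg
    rw [Function.iterate_succ_apply', broadcastStep]
    split_ifs with hex
    · exact (hval k _).resolve_left hex.choose_spec.2
    · rcases hg with hg | ⟨j, hj, hjQ⟩
      · exact hg
      · exact absurd ⟨j, hj, by rw [hjQ]; exact hQ⟩ hex
  refine ⟨hval k, ?_⟩
  induction k generalizing g with
  | zero =>
    have : p.length = 0 := by omega
    have := SimpleGraph.Walk.eq_of_length_eq_zero this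
    subst this
    exact hU
  | succ k ih =>
    cases p with
    | nil => exact hstep k _ (Or.inl (ih _ SimpleGraph.Walk.nil (by simp)))
    | cons hadj q =>
      exact hstep k _ (Or.inr ⟨_, hadj, ih _ q (by simpa using hp)⟩)

/-- Zero plays the role of "nothing to send", hence the hypothesis that the root's matrix is
nonzero. Connectedness makes the eccentricity finite, so `toNat` does not lose it. -/
lemma broadcast_eq {E : Type*} [Zero E] (hG : G.Connected) (root : Fin L) {U : Fin L → E}
    (hU : U root ≠ 0) (g : Fin L) : broadcast G root U g = U root := by
  obtain ⟨p, hp⟩ := hG.exists_walk_length_eq_edist g root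
  obtain ⟨v, hv⟩ := haveI : Nonempty (Fin L) := ⟨root⟩; G.exists_edist_eq_eccent_of_finite root
  have hfin : G.eccent root ≠ ⊤ := by
    rw [← hv]; exact SimpleGraph.edist_ne_top_iff_reachable.2 (hG root v)
  have hle : p.length ≤ (G.eccent root).toNat := by
    have h1 : (p.length : ℕ∞) ≤ G.eccent root := by
      rw [hp, SimpleGraph.edist_comm]; exact SimpleGraph.edist_le_eccent
    rw [← ENat.natCast_toNat hfin] at h1
    exact_mod_cast h1
  refine (broadcastStep_iterate root hU _ g p hle (by simp) fun g => ?_).2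
  by_cases hg : g = root <;> simp [hg]

end Network

/-! ### The decentralized power method as a power iteration -/

section PowerMethod

variable {L d r : ℕ} {G : SimpleGraph (Fin L)} [DecidableRel G.Adj]
  {W : Matrix (Fin L) (Fin L) ℝ} {qr : Matrix (Fin d) (Fin r) ℝ → Matrix (Fin d) (Fin r) ℝ}

/-- The weighted Gram matrix which the first node multiplies by in each round. -/
def gramMix {ι : Fin L → Type*} [∀ g, Fintype (ι g)] (w : Fin L → ℝ)
    (Θ₀ : ∀ g, Matrix (Fin d) (ι g) ℝ) : Matrix (Fin d) (Fin d) ℝ :=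
  ∑ j, w j • (Θ₀ j * (Θ₀ j)ᵀ)

lemma gramMix_isHermitian {ι : Fin L → Type*} [∀ g, Fintype (ι g)] (w : Fin L → ℝ)
    (Θ₀ : ∀ g, Matrix (Fin d) (ι g) ℝ) : (gramMix w Θ₀).IsHermitian := by
  rw [gramMix, IsHermitian, conjTranspose_sum]
  refine Finset.sum_congr rfl fun j _ => ?_
  simp

lemma IsQRRoutine.exists_of_injective (hqr : IsQRRoutine qr) {A : Matrix (Fin d) (Fin r) ℝ}
    (hA : ∀ a, A *ᵥ a = 0 → a = 0) : ∃ R, IsQR A (qr A) R := by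
  refine hqr A ?_
  change LinearIndependent ℝ A.col
  rw [← mulVec_injective_iff]
  exact (injective_iff_map_eq_zero A.mulVecLin).2 hA

/-- When all nodes hold the same `Q`, it factors out of the agreement sum. Results of nodes other
than `0` are discarded, so only row `0` of `W ^ Tcon` enters. -/
lemma pmRound_const [NeZero L] (hG : G.Connected) (hW : IsWeightMatrix G W) {ι : Fin L → Type*}
    [∀ g, Fintype (ι g)] (Tcon : ℕ) (Θ₀ : ∀ g, Matrix (Fin d) (ι g) ℝ)
    (Q : Matrix (Fin d) (Fin r) ℝ) (hne : qr (gramMix (fun j => (W ^ Tcon) 0 j) Θ₀ * Q) ≠ 0) :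
    pmRound G W qr Tcon Θ₀ (fun _ => Q) = fun _ => qr (gramMix (fun j => (W ^ Tcon) 0 j) Θ₀ * Q) := by
  have h0 : agree G W Tcon (fun g' => Θ₀ g' * (Θ₀ g')ᵀ * Q) 0
      = gramMix (fun j => (W ^ Tcon) 0 j) Θ₀ * Q := by
    rw [agree_eq hW, gramMix, Matrix.sum_mul]
    simp only [Matrix.smul_mul]
  funext g
  rw [pmRound, broadcast_eq hG _ (by rw [h0]; exact hne), h0]

/-- As long as `M ^ k * Z` has linearly independent columns, where `M` is the weighted Gram
matrix, after `k` rounds all nodes hold the same orthonormal basis of its column space. -/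
lemma pmRound_iterate [NeZero L] (hG : G.Connected) (hW : IsWeightMatrix G W) (hqr : IsQRRoutine qr)
    (hr : 0 < r) {ι : Fin L → Type*} [∀ g, Fintype (ι g)] (Tcon : ℕ)
    (Θ₀ : ∀ g, Matrix (Fin d) (ι g) ℝ) (Z : Matrix (Fin d) (Fin r) ℝ) (k : ℕ)
    (hinj : ∀ a, (gramMix (fun j => (W ^ Tcon) 0 j) Θ₀ ^ k * Z) *ᵥ a = 0 → a = 0) :
    ∃ (Q : Matrix (Fin d) (Fin r) ℝ) (R : Matrix (Fin r) (Fin r) ℝ),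
      (pmRound G W qr Tcon Θ₀)^[k] (fun _ => qr Z) = (fun _ => Q) ∧ Qᵀ * Q = 1 ∧
        gramMix (fun j => (W ^ Tcon) 0 j) Θ₀ ^ k * Z = Q * R := by
  set M := gramMix (fun j => (W ^ Tcon) 0 j) Θ₀ with hM
  induction k with
  | zero =>
    obtain ⟨R, hR⟩ := hqr.exists_of_injective (A := Z) (by simpa using hinj)
    exact ⟨qr Z, R, rfl, hR.orthonormal, by simpa using hR.eq⟩
  | succ k ih =>
    have hinj' : ∀ a, (M ^ k * Z) *ᵥ a = 0 → a = 0 := fun a ha => hinj a <| by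
      rw [pow_succ', Matrix.mul_assoc, ← mulVec_mulVec, ha, mulVec_zero]
    obtain ⟨Q, R, hQ, horth, hQR⟩ := ih hinj'
    -- `R` is invertible, so every vector `b` is of the form `R *ᵥ a`, and injectivity of `M * Q`
    -- reduces to that of `M ^ (k + 1) * Z`.
    have hRinj : Function.Injective R.mulVecLin :=
      (injective_iff_map_eq_zero R.mulVecLin).2 fun a ha => hinj' a <| by
        rw [hQR, ← mulVec_mulVec, ← mulVecLin_apply R, ha, mulVec_zero]
    have hRsurj : Function.Surjective R.mulVecLin := LinearMap.injective_iff_surjective.1 hRinj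
    obtain ⟨R', hR'⟩ := hqr.exists_of_injective (A := M * Q) fun b hb => by
      obtain ⟨a, rfl⟩ := hRsurj b
      have : a = 0 := hinj a <| by
        rw [pow_succ', Matrix.mul_assoc, hQR, ← Matrix.mul_assoc, ← mulVec_mulVec]
        exact hb
      rw [this, map_zero]
    -- A matrix with orthonormal columns is nonzero because there is at least one column; without
    -- this the broadcast would carry nothing.
    have hne : qr (M * Q) ≠ 0 := fun h0 => by
      have h1 := hR'.orthonormal
      rw [h0, Matrix.mul_zero] at h1
      have := congrFun (congrFun h1 ⟨0, hr⟩) ⟨0, hr⟩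
      simp at this
    refine ⟨qr (M * Q), R' * R, ?_, hR'.orthonormal, ?_⟩
    · rw [Function.iterate_succ_apply', hQ, pmRound_const hG hW _ _ _ hne]
    · rw [pow_succ', Matrix.mul_assoc, hQR, ← Matrix.mul_assoc, ← Matrix.mul_assoc, ← hR'.eq]

end PowerMethod

/-! ### Subspace distance as an approximation error. -/

section SubspaceDist

variable {d r : ℕ}

lemma projPerp_mulVec_self_le {Q : Matrix (Fin d) (Fin r) ℝ} (hQ : Qᵀ * Q = 1) (x : Fin d → ℝ) :
    (projPerp Q *ᵥ x) ⬝ᵥ (projPerp Q *ᵥ x) ≤ x ⬝ᵥ x := by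
  have h1 : (Q *ᵥ (Qᵀ *ᵥ x)) ⬝ᵥ (Q *ᵥ (Qᵀ *ᵥ x)) = (Qᵀ *ᵥ x) ⬝ᵥ (Qᵀ *ᵥ x) :=
    mulVec_dotProduct_self_of_orthonormal hQ _
  have h2 : (Q *ᵥ (Qᵀ *ᵥ x)) ⬝ᵥ x = (Qᵀ *ᵥ x) ⬝ᵥ (Qᵀ *ᵥ x) := mulVec_dotProduct_eq _ _ _
  have h3 := dotProduct_self_nonneg' (Qᵀ *ᵥ x)
  rw [projPerp, sub_mulVec, one_mulVec, ← mulVec_mulVec]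
  simp only [dotProduct_sub, sub_dotProduct]
  rw [dotProduct_comm x (Q *ᵥ _), h1, h2]
  linarith

/-- `projPerp Q` is a contraction that annihilates the range of `Q`, so any element of that range
may be subtracted before projecting. -/
lemma subspaceDist_le {Q Ustar : Matrix (Fin d) (Fin r) ℝ} (hQ : Qᵀ * Q = 1) {δ : ℝ} (hδ : 0 ≤ δ)
    (h : ∀ c, ∃ b, (Ustar *ᵥ c - Q *ᵥ b) ⬝ᵥ (Ustar *ᵥ c - Q *ᵥ b) ≤ δ ^ 2 * (c ⬝ᵥ c)) :
    subspaceDist Q Ustar ≤ δ := by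
  rw [subspaceDist, specNorm, l2_opNorm_def]
  refine ContinuousLinearMap.opNorm_le_bound _ hδ fun c => ?_
  have hnorm : ∀ {m : ℕ} (x : EuclideanSpace ℝ (Fin m)), ‖x‖ ^ 2 = x.ofLp ⬝ᵥ x.ofLp := fun x => by
    rw [EuclideanSpace.norm_sq_eq]
    simp [dotProduct, sq]
  refine le_of_sq_le_sq ?_ (by positivity)
  rw [mul_pow, hnorm, hnorm]
  obtain ⟨b, hb⟩ := h c.ofLp
  have h1 : (projPerp Q * Ustar) *ᵥ c.ofLp = projPerp Q *ᵥ (Ustar *ᵥ c.ofLp - Q *ᵥ b) := by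
    have : projPerp Q * Q = 0 := by
      rw [projPerp, Matrix.sub_mul, Matrix.mul_assoc, hQ, Matrix.mul_one, Matrix.one_mul, sub_self]
    rw [mulVec_sub, mulVec_mulVec, mulVec_mulVec, this, zero_mulVec, sub_zero]
  refine le_trans (le_of_eq ?_) ((projPerp_mulVec_self_le hQ _).trans hb)
  rw [← h1]
  rfl

end SubspaceDist

/-! ### The standard Gaussian measure on coordinate vectors -/

section StdGauss

/-- The law of a vector with independent standard Gaussian entries. -/
noncomputable def stdGauss (ι : Type*) [Fintype ι] : Measure (ι → ℝ) :=
  Measure.pi fun _ => gaussianReal 0 1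

variable {ι : Type*} [Fintype ι]

instance : IsProbabilityMeasure (stdGauss ι) := by unfold stdGauss; infer_instance

lemma hasGaussianLaw_id_stdGauss : HasGaussianLaw (fun x : ι → ℝ => x) (stdGauss ι) := by
  have h2 := iIndepFun_pi (μ := fun _ : ι => gaussianReal 0 1) (X := fun _ => id)
    (fun i => aemeasurable_id)
  refine iIndepFun.hasGaussianLaw (X := fun i (x : ι → ℝ) => x i) (fun i => ?_) h2
  exact (measurePreserving_eval (fun _ : ι => gaussianReal 0 1) i).hasLaw.hasGaussianLaw

/-- The linear form `x ↦ u ⬝ᵥ x`. -/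
noncomputable def dotCLM (u : ι → ℝ) : (ι → ℝ) →L[ℝ] ℝ :=
  ∑ i, u i • ContinuousLinearMap.proj i

lemma dotCLM_apply (u x : ι → ℝ) : dotCLM u x = u ⬝ᵥ x := by
  simp [dotCLM, dotProduct]

@[fun_prop]
lemma continuous_dotProduct_right (u : ι → ℝ) : Continuous fun x : ι → ℝ => u ⬝ᵥ x :=
  (dotCLM u).continuous.congr (dotCLM_apply u)

@[fun_prop]
lemma measurable_dotProduct_right (u : ι → ℝ) : Measurable fun x : ι → ℝ => u ⬝ᵥ x :=
  (continuous_dotProduct_right u).measurable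

lemma hasGaussianLaw_dotProduct (u : ι → ℝ) :
    HasGaussianLaw (fun x => u ⬝ᵥ x) (stdGauss ι) := by
  have := hasGaussianLaw_id_stdGauss (ι := ι).map_of_measurable (dotCLM u)
    (dotCLM u).continuous.measurable
  simpa only [Function.comp_def, dotCLM_apply] using this

lemma memLp_dotProduct (u : ι → ℝ) (p : ℝ≥0∞) (hp : p ≠ ∞) :
    MemLp (fun x => u ⬝ᵥ x) p (stdGauss ι) :=
  (hasGaussianLaw_dotProduct u).memLp hp

lemma integral_dotProduct (u : ι → ℝ) : ∫ x, u ⬝ᵥ x ∂(stdGauss ι) = 0 := by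
  have hcoord : ∀ i : ι, Integrable (fun x : ι → ℝ => x i) (stdGauss ι) := fun i =>
    (measurePreserving_eval (fun _ : ι => gaussianReal 0 1) i).integrable_comp_of_integrable
      (g := fun y => y) ((memLp_id_gaussianReal 1).integrable le_rfl)
  simp only [dotProduct]
  rw [integral_finsetSum _ fun i _ => (hcoord i).const_mul _]
  refine Finset.sum_eq_zero fun i _ => ?_
  rw [integral_const_mul]
  have h := (measurePreserving_eval (fun _ : ι => gaussianReal 0 1) i).map_eq
  have h2 : ∫ x : ι → ℝ, x i ∂(stdGauss ι) = ∫ y, y ∂(gaussianReal 0 1) := by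
    rw [← h, integral_map (measurable_pi_apply i).aemeasurable (by fun_prop)]; rfl
  rw [h2, integral_id_gaussianReal, mul_zero]

lemma variance_dotProduct (u : ι → ℝ) : Var[fun x => u ⬝ᵥ x; stdGauss ι] = u ⬝ᵥ u := by
  have h := variance_sum_pi (μ := fun _ : ι => gaussianReal 0 1) (X := fun i y => u i * y)
    (fun i => (memLp_id_gaussianReal 2).const_mul _)
  have h2 : (∑ i, fun ω : ι → ℝ => u i * ω i) = fun x => u ⬝ᵥ x := by
    ext x; simp [dotProduct]
  rw [h2] at h
  rw [stdGauss, h, dotProduct]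
  refine Finset.sum_congr rfl fun i _ => ?_
  rw [variance_const_mul, variance_fun_id_gaussianReal]
  simp [sq]

lemma map_dotProduct (u : ι → ℝ) :
    (stdGauss ι).map (fun x => u ⬝ᵥ x) = gaussianReal 0 (u ⬝ᵥ u).toNNReal := by
  rw [(hasGaussianLaw_dotProduct u).map_eq_gaussianReal, integral_dotProduct, variance_dotProduct]

/-- Uncorrelated jointly Gaussian variables are independent; the covariance is read off from the
variance of the sum. -/
lemma indepFun_dotProduct {u θ : ι → ℝ} (h : u ⬝ᵥ θ = 0) :
    IndepFun (fun x => u ⬝ᵥ x) (fun x => θ ⬝ᵥ x) (stdGauss ι) := by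
  have hpair : HasGaussianLaw (fun x => (u ⬝ᵥ x, θ ⬝ᵥ x)) (stdGauss ι) := by
    have := hasGaussianLaw_id_stdGauss (ι := ι).map_of_measurable ((dotCLM u).prod (dotCLM θ))
      ((dotCLM u).prod (dotCLM θ)).continuous.measurable
    simpa only [Function.comp_def, ContinuousLinearMap.prod_apply, dotCLM_apply] using this
  refine hpair.indepFun_of_covariance_eq_zero ?_
  have h1 := variance_add (memLp_dotProduct u 2 (by simp)) (memLp_dotProduct θ 2 (by simp))
  have h2 : (fun x => u ⬝ᵥ x) + (fun x => θ ⬝ᵥ x) = fun x : ι → ℝ => (u + θ) ⬝ᵥ x := by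
    ext x; simp [add_dotProduct]
  rw [h2, variance_dotProduct, variance_dotProduct, variance_dotProduct] at h1
  simp only [add_dotProduct, dotProduct_add, h, dotProduct_comm θ u] at h1
  linarith

lemma integral_dotProduct_sq (u : ι → ℝ) : ∫ x, (u ⬝ᵥ x) ^ 2 ∂(stdGauss ι) = u ⬝ᵥ u := by
  rw [← variance_dotProduct u, variance_of_integral_eq_zero
    (measurable_dotProduct_right u).aemeasurable (integral_dotProduct u)]

lemma hasSubgaussianMGF_dotProduct {u : ι → ℝ} (hu : u ⬝ᵥ u ≤ 1) :
    HasSubgaussianMGF (fun x => u ⬝ᵥ x) 1 (stdGauss ι) := by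
  refine HasSubgaussianMGF.of_map (Y := fun x => u ⬝ᵥ x) (X := id)
    (measurable_dotProduct_right u).aemeasurable ?_
  rw [map_dotProduct]
  refine ⟨fun t => integrable_exp_mul_gaussianReal t, fun t => ?_⟩
  rw [mgf_id_gaussianReal]
  refine Real.exp_le_exp.2 ?_
  rw [Real.coe_toNNReal _ (dotProduct_self_nonneg' u)]
  simp only [NNReal.coe_one, zero_mul, zero_add]
  have := mul_le_mul_of_nonneg_right hu (sq_nonneg t)
  linarith

end StdGauss

/-! ### Fourth moments -/

lemma one_add_sq_add_pow_four_le_cosh (x : ℝ) : 1 + x ^ 2 / 2 + x ^ 4 / 24 ≤ Real.cosh x := by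
  have h := sum_le_hasSum (Finset.range 3) (fun i _ => by
    rw [pow_mul]; positivity) (Real.hasSum_cosh x)
  simp only [Finset.sum_range_succ, Finset.sum_range_zero] at h
  norm_num [Nat.factorial] at h
  linarith

/-- Integrating `x ^ 4 ≤ 24 (cosh x - 1 - x ^ 2 / 2)` gives `24 (e ^ (1/2) - 3/2)`, and `e ^ (1/2) ≤
33/20`. The true value is `3`; the slack is harmless. -/
lemma integral_pow_four_gaussianReal_le : ∫ x, x ^ 4 ∂(gaussianReal 0 1) ≤ 18 / 5 := by
  have hexp : ∀ t : ℝ, Integrable (fun x : ℝ => Real.exp (t * x)) (gaussianReal 0 1) := fun t =>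
    integrable_exp_mul_gaussianReal t
  have hmgf : ∀ t : ℝ, ∫ x, Real.exp (t * x) ∂(gaussianReal 0 1) = Real.exp (t ^ 2 / 2) := fun t => by
    have := congrFun (mgf_id_gaussianReal (μ := 0) (v := 1)) t
    simpa [mgf] using this
  have hcosh_int : Integrable (fun x : ℝ => Real.cosh x) (gaussianReal 0 1) := by
    have := ((hexp 1).add (hexp (-1))).div_const 2
    refine this.congr (Filter.Eventually.of_forall fun x => ?_)
    simp [Real.cosh_eq]
  have hcosh : ∫ x, Real.cosh x ∂(gaussianReal 0 1) = Real.exp (1 / 2) := by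
    have : ∀ x, Real.cosh x = (Real.exp (1 * x) + Real.exp (-1 * x)) / 2 := fun x => by
      simp [Real.cosh_eq]
    simp_rw [this]
    rw [integral_div, integral_add (hexp 1) (hexp (-1)), hmgf, hmgf]
    norm_num
  have hsq_int : Integrable (fun x : ℝ => x ^ 2) (gaussianReal 0 1) :=
    (memLp_id_gaussianReal 2).integrable_sq
  have hsq : ∫ x, x ^ 2 ∂(gaussianReal 0 1) = 1 := by
    have h := variance_id_gaussianReal (μ := 0) (v := 1)
    rw [variance_of_integral_eq_zero (by fun_prop) (by simp [integral_id_gaussianReal])] at h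
    simpa using h
  have hle : ∀ x : ℝ, x ^ 4 ≤ 24 * (Real.cosh x - 1 - x ^ 2 / 2) := fun x => by
    have := one_add_sq_add_pow_four_le_cosh x
    linarith
  have hmain : ∫ x, x ^ 4 ∂(gaussianReal 0 1)
      ≤ ∫ x, 24 * (Real.cosh x - 1 - x ^ 2 / 2) ∂(gaussianReal 0 1) :=
    integral_mono_of_nonneg (Filter.Eventually.of_forall fun x => by positivity)
      (((hcosh_int.sub (integrable_const 1)).sub (hsq_int.div_const 2)).const_mul 24)
      (Filter.Eventually.of_forall hle)
  have hsplit : ∫ x, (Real.cosh x - 1 - x ^ 2 / 2) ∂(gaussianReal 0 1)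
      = Real.exp (1 / 2) - 1 - 1 / 2 := by
    have h1 : Integrable (fun x : ℝ => Real.cosh x - 1) (gaussianReal 0 1) :=
      hcosh_int.sub (integrable_const 1)
    rw [integral_sub h1 (hsq_int.div_const 2), integral_sub hcosh_int (integrable_const 1),
      integral_div, hcosh, hsq]
    simp
  rw [integral_const_mul, hsplit] at hmain
  have he : Real.exp (1 / 2) ≤ 33 / 20 := by
    have h1 : Real.exp (1 / 2) ^ 2 = Real.exp 1 := by
      rw [← Real.exp_nat_mul]; norm_num
    have h2 := Real.exp_one_lt_d9
    have h3 := Real.exp_pos (1 / 2)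
    nlinarith
  linarith

section StdGauss

variable {ι : Type*} [Fintype ι]

lemma integral_dotProduct_pow_four_le (u : ι → ℝ) :
    ∫ x, (u ⬝ᵥ x) ^ 4 ∂(stdGauss ι) ≤ 18 / 5 * (u ⬝ᵥ u) ^ 2 := by
  have hw := dotProduct_self_nonneg' u
  have h1 : ∫ x, (u ⬝ᵥ x) ^ 4 ∂(stdGauss ι)
      = ∫ y, y ^ 4 ∂(gaussianReal 0 (u ⬝ᵥ u).toNNReal) := by
    rw [← map_dotProduct, integral_map (measurable_dotProduct_right u).aemeasurable (by fun_prop)]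
  have h2 : gaussianReal 0 (u ⬝ᵥ u).toNNReal
      = (gaussianReal 0 1).map (fun y => Real.sqrt (u ⬝ᵥ u) * y) := by
    rw [gaussianReal_map_const_mul, mul_zero, mul_one]
    congr 1
    ext
    simp [Real.sq_sqrt hw, hw]
  rw [h1, h2, integral_map (by fun_prop) (by fun_prop)]
  simp_rw [mul_pow]
  rw [integral_const_mul]
  have h3 : Real.sqrt (u ⬝ᵥ u) ^ 4 = (u ⬝ᵥ u) ^ 2 := by
    rw [show (4 : ℕ) = 2 * 2 from rfl, pow_mul, Real.sq_sqrt hw]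
  rw [h3, mul_comm]
  exact mul_le_mul_of_nonneg_right integral_pow_four_gaussianReal_le (sq_nonneg _)

lemma integrable_dotProduct_pow (u : ι → ℝ) (k : ℕ) :
    Integrable (fun x => (u ⬝ᵥ x) ^ k) (stdGauss ι) := by
  rcases Nat.eq_zero_or_pos k with rfl | hk
  · simp
  · have := (memLp_dotProduct u (k : ℝ≥0∞) (by simp)).integrable_norm_pow hk.ne'
    refine this.mono' (by fun_prop) (Filter.Eventually.of_forall fun x => ?_)
    simp

end StdGauss

/-! ### Small balls -/

/-- The density is at most `1/2` because `√(2π) ≥ 2`, and the interval has length `2 t`. -/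
lemma gaussianReal_Icc_le (t : ℝ) :
    gaussianReal 0 1 (Set.Icc (-t) t) ≤ ENNReal.ofReal t := by
  rw [gaussianReal_apply 0 one_ne_zero]
  have hpdf : ∀ x, gaussianPDF 0 1 x ≤ ENNReal.ofReal (1 / 2) := fun x => by
    rw [gaussianPDF, gaussianPDFReal]
    refine ENNReal.ofReal_le_ofReal ?_
    have h1 : Real.exp (-(x - 0) ^ 2 / (2 * (1 : ℝ≥0))) ≤ 1 := by
      rw [Real.exp_le_one_iff]
      have : 0 ≤ (x - 0) ^ 2 / (2 * ((1 : ℝ≥0) : ℝ)) := by positivity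
      rw [neg_div]; linarith
    have h2 : 2 ≤ Real.sqrt (2 * Real.pi * (1 : ℝ≥0)) := by
      rw [Real.le_sqrt' (by norm_num)]
      have := Real.pi_gt_three
      simp only [NNReal.coe_one, mul_one]
      linarith
    calc _ ≤ (2 : ℝ)⁻¹ * 1 := by gcongr
      _ = 1 / 2 := by norm_num
  calc ∫⁻ x in Set.Icc (-t) t, gaussianPDF 0 1 x
      ≤ ∫⁻ _ in Set.Icc (-t) t, ENNReal.ofReal (1 / 2) := lintegral_mono fun x => hpdf x
    _ = ENNReal.ofReal t := by
        rw [setLIntegral_const, Real.volume_Icc, ← ENNReal.ofReal_mul (by norm_num)]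
        congr 1; ring

lemma stdGauss_abs_dotProduct_le {ι : Type*} [Fintype ι] {y : ι → ℝ} (hy : y ⬝ᵥ y = 1) (t : ℝ) :
    stdGauss ι {x | |y ⬝ᵥ x| ≤ t} ≤ ENNReal.ofReal t := by
  have h := map_dotProduct y
  rw [hy, Real.toNNReal_one] at h
  have h2 := gaussianReal_Icc_le t
  rw [← h, Measure.map_apply (measurable_dotProduct_right y) measurableSet_Icc] at h2
  refine le_trans (measure_mono fun x hx => ?_) h2
  exact abs_le.1 hx

/-! ### Centred variables dominated by a sub-Gaussian one -/

lemma exp_le_one_add_add_sq_mul_exp_abs (x : ℝ) :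
    Real.exp x ≤ 1 + x + x ^ 2 * Real.exp |x| := by
  have h := Complex.norm_exp_sub_sum_le_norm_mul_exp (x : ℂ) 2
  have h1 : Complex.exp (x : ℂ) - ∑ m ∈ Finset.range 2, (x : ℂ) ^ m / (m.factorial : ℂ)
      = ((Real.exp x - (1 + x) : ℝ) : ℂ) := by
    simp [Finset.sum_range_succ]
  rw [h1, Complex.norm_real, Complex.norm_real, Real.norm_eq_abs, Real.norm_eq_abs, sq_abs] at h
  have := (le_abs_self _).trans h
  linarith

lemma exp_abs_le_add (b y : ℝ) :
    Real.exp (b * |y|) ≤ Real.exp (b * y) + Real.exp (-b * y) := by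
  rcases abs_cases y with ⟨h, _⟩ | ⟨h, _⟩ <;> rw [h]
  · linarith [Real.exp_pos (-b * y)]
  · rw [show b * -y = -b * y by ring]
    linarith [Real.exp_pos (b * y)]

section Subgaussian

variable {Ω : Type*} [MeasurableSpace Ω] {P : Measure Ω} {g W : Ω → ℝ}

lemma integrable_exp_mul_abs (hg : HasSubgaussianMGF g 1 P) (b : ℝ) :
    Integrable (fun ω => Real.exp (b * |g ω|)) P := by
  have hgm := hg.aemeasurable
  refine ((hg.integrable_exp_mul b).add (hg.integrable_exp_mul (-b))).mono'
    (Measurable.comp_aemeasurable (g := fun y : ℝ => Real.exp (b * |y|))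
      (by fun_prop) hgm).aestronglyMeasurable (Filter.Eventually.of_forall fun ω => ?_)
  rw [Real.norm_eq_abs, Real.abs_exp]
  exact exp_abs_le_add b (g ω)

lemma integral_exp_mul_abs_le (hg : HasSubgaussianMGF g 1 P) (b : ℝ) :
    ∫ ω, Real.exp (b * |g ω|) ∂P ≤ 2 * Real.exp (b ^ 2 / 2) := by
  have h1 := hg.mgf_le b
  have h2 := hg.mgf_le (-b)
  have h3 := integral_mono (integrable_exp_mul_abs hg b)
    ((hg.integrable_exp_mul b).add (hg.integrable_exp_mul (-b)))
    (fun ω => exp_abs_le_add b (g ω))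
  have h4 := integral_add (hg.integrable_exp_mul b) (hg.integrable_exp_mul (-b))
  simp only [mgf, NNReal.coe_one, one_mul, neg_sq] at h1 h2
  simp only [Pi.add_apply] at h3
  linarith

/-- A variable dominated by a multiple of a sub-Gaussian variable is sub-Gaussian after
centring. -/
lemma hasSubgaussianMGF_sub_integral_of_abs_le [IsProbabilityMeasure P] (hg : HasSubgaussianMGF g 1 P)
    (hW : AEStronglyMeasurable W P) {s : ℝ≥0} (hle : ∀ ω, |W ω| ≤ s * |g ω|) :
    HasSubgaussianMGF (fun ω => W ω - ∫ ω', W ω' ∂P) (60 * s ^ 2) P := by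
  set m := ∫ ω, W ω ∂P with hm
  have hgabs : Integrable (fun ω => |g ω|) P := hg.integrable.abs
  have hWint : Integrable W P := (hgabs.const_mul (s : ℝ)).mono' hW
    (Filter.Eventually.of_forall fun ω => by rw [Real.norm_eq_abs]; exact hle ω)
  have hexp_meas : ∀ t : ℝ, AEStronglyMeasurable (fun ω => Real.exp (t * W ω)) P := fun t =>
    Real.continuous_exp.comp_aestronglyMeasurable (hW.const_mul t)
  have habs : ∀ t ω, |t * W ω| ≤ |t| * s * |g ω| := fun t ω => by
    rw [abs_mul, mul_assoc]
    exact mul_le_mul_of_nonneg_left (hle ω) (abs_nonneg t)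
  have hexp_int : ∀ t : ℝ, Integrable (fun ω => Real.exp (t * W ω)) P := fun t => by
    refine (integrable_exp_mul_abs hg (|t| * s)).mono' (hexp_meas t)
      (Filter.Eventually.of_forall fun ω => ?_)
    rw [Real.norm_eq_abs, Real.abs_exp]
    exact Real.exp_le_exp.2 ((le_abs_self _).trans (habs t ω))
  have hrw : ∀ t : ℝ, (fun ω => Real.exp (t * (W ω - m)))
      = fun ω => Real.exp (-(t * m)) * Real.exp (t * W ω) := fun t => by
    ext ω
    rw [← Real.exp_add]
    congr 1; ring
  refine ⟨fun t => ?_, fun t => ?_⟩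
  · rw [hrw]
    exact (hexp_int t).const_mul _
  rw [mgf, hrw, integral_const_mul]
  set a := |t| * s with ha
  have ha0 : 0 ≤ a := by positivity
  have hcoef : ((60 * s ^ 2 : ℝ≥0) : ℝ) * t ^ 2 / 2 = 30 * a ^ 2 := by
    push_cast
    rw [ha, mul_pow, sq_abs]; ring
  rw [hcoef]
  have he1 := Real.exp_one_lt_d9
  -- For `a ≤ 1`, a second-order expansion exposes the mean, which the centring cancels, and leaves
  -- a remainder of order `a ^ 2`. For `a ≥ 1`, centring is not exploited: the crude exponent `4 a +
  -- 1 + a ^ 2 / 2` is already below `30 a ^ 2`.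
  rcases le_total a 1 with ha1 | ha1
  · have hpt : ∀ ω, Real.exp (t * W ω) ≤ 1 + t * W ω + 2 * a ^ 2 * Real.exp (2 * |g ω|) := by
      intro ω
      refine (exp_le_one_add_add_sq_mul_exp_abs _).trans ?_
      have h1 : (t * W ω) ^ 2 ≤ a ^ 2 * |g ω| ^ 2 := by
        rw [← sq_abs (t * W ω), ← mul_pow]
        exact pow_le_pow_left₀ (abs_nonneg _) (habs t ω) 2
      have h2 : Real.exp |t * W ω| ≤ Real.exp |g ω| := by
        refine Real.exp_le_exp.2 ((habs t ω).trans ?_)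
        have := mul_le_mul_of_nonneg_right ha1 (abs_nonneg (g ω))
        linarith
      have h3 : |g ω| ^ 2 ≤ 2 * Real.exp |g ω| := by
        have := Real.quadratic_le_exp_of_nonneg (abs_nonneg (g ω))
        have := abs_nonneg (g ω)
        linarith
      have h4 : Real.exp (2 * |g ω|) = Real.exp |g ω| * Real.exp |g ω| := by
        rw [← Real.exp_add]; congr 1; ring
      have h5 : (t * W ω) ^ 2 * Real.exp |t * W ω| ≤ a ^ 2 * (2 * Real.exp |g ω|) * Real.exp |g ω| :=
        mul_le_mul (h1.trans (mul_le_mul_of_nonneg_left h3 (sq_nonneg a))) h2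
          (Real.exp_pos _).le (by positivity)
      rw [h4]
      linarith
    have hInt : Integrable (fun ω => 1 + t * W ω) P :=
      (integrable_const 1).add (hWint.const_mul t)
    have h6 := integral_mono (hexp_int t)
      (hInt.add ((integrable_exp_mul_abs hg 2).const_mul (2 * a ^ 2))) hpt
    have h7 : ∫ ω, (1 + t * W ω + 2 * a ^ 2 * Real.exp (2 * |g ω|)) ∂P
        = 1 + t * m + 2 * a ^ 2 * ∫ ω, Real.exp (2 * |g ω|) ∂P := by
      rw [integral_add hInt ((integrable_exp_mul_abs hg 2).const_mul _),
        integral_add (integrable_const 1) (hWint.const_mul t), integral_const_mul,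
        integral_const_mul]
      simp [← hm]
    have h8 := integral_exp_mul_abs_le hg 2
    have h9 : Real.exp (2 ^ 2 / 2) ≤ 15 / 2 := by
      have : Real.exp (2 ^ 2 / 2) = Real.exp 1 ^ 2 := by rw [← Real.exp_nat_mul]; norm_num
      rw [this]
      nlinarith [Real.exp_pos 1]
    have h10 : ∫ ω, Real.exp (t * W ω) ∂P ≤ Real.exp (t * m + 30 * a ^ 2) := by
      have h11 : 2 * a ^ 2 * ∫ ω, Real.exp (2 * |g ω|) ∂P ≤ 2 * a ^ 2 * 15 :=
        mul_le_mul_of_nonneg_left (by linarith) (by positivity)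
      have h12 := Real.add_one_le_exp (t * m + 30 * a ^ 2)
      have h13 : ∫ ω, Real.exp (t * W ω) ∂P
          ≤ 1 + t * m + 2 * a ^ 2 * ∫ ω, Real.exp (2 * |g ω|) ∂P := h7 ▸ h6
      linarith
    calc Real.exp (-(t * m)) * ∫ ω, Real.exp (t * W ω) ∂P
        ≤ Real.exp (-(t * m)) * Real.exp (t * m + 30 * a ^ 2) :=
          mul_le_mul_of_nonneg_left h10 (Real.exp_pos _).le
      _ = Real.exp (30 * a ^ 2) := by rw [← Real.exp_add]; congr 1; ring
  · have h1 : ∫ ω, Real.exp (t * W ω) ∂P ≤ 2 * Real.exp (a ^ 2 / 2) :=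
      (integral_mono (hexp_int t) (integrable_exp_mul_abs hg a) fun ω =>
        Real.exp_le_exp.2 ((le_abs_self _).trans (habs t ω))).trans (integral_exp_mul_abs_le hg a)
    have h2 : ∫ ω, |g ω| ∂P ≤ 4 := by
      have h3 := integral_mono hgabs (integrable_exp_mul_abs hg 1) (fun ω => by
        have := Real.add_one_le_exp (1 * |g ω|)
        simp only [one_mul] at this ⊢
        linarith)
      have h4 := integral_exp_mul_abs_le hg 1
      have h5 : Real.exp (1 ^ 2 / 2) ≤ 2 := by
        have h6 : Real.exp (1 ^ 2 / 2) ^ 2 = Real.exp 1 := by rw [← Real.exp_nat_mul]; norm_num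
        nlinarith [Real.exp_pos (1 ^ 2 / 2)]
      linarith
    have h3 : -(t * m) ≤ 4 * a := by
      have h4 : |m| ≤ s * 4 := by
        refine (abs_integral_le_integral_abs).trans
          ((integral_mono hWint.abs (hgabs.const_mul (s : ℝ)) hle).trans ?_)
        rw [integral_const_mul]
        exact mul_le_mul_of_nonneg_left h2 s.2
      calc -(t * m) ≤ |t * m| := neg_le_abs _
        _ = |t| * |m| := abs_mul _ _
        _ ≤ |t| * (s * 4) := mul_le_mul_of_nonneg_left h4 (abs_nonneg t)
        _ = 4 * a := by rw [ha]; ring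
    have h4 : (2 : ℝ) ≤ Real.exp 1 := by
      have := Real.add_one_le_exp 1
      linarith
    calc Real.exp (-(t * m)) * ∫ ω, Real.exp (t * W ω) ∂P
        ≤ Real.exp (4 * a) * (Real.exp 1 * Real.exp (a ^ 2 / 2)) := by
          refine mul_le_mul (Real.exp_le_exp.2 h3) (h1.trans ?_)
            (integral_nonneg fun ω => (Real.exp_pos _).le) (Real.exp_pos _).le
          exact mul_le_mul_of_nonneg_right h4 (Real.exp_pos _).le
      _ = Real.exp (4 * a + (1 + a ^ 2 / 2)) := by rw [← Real.exp_add, ← Real.exp_add]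
      _ ≤ Real.exp (30 * a ^ 2) := Real.exp_le_exp.2 (by nlinarith)

lemma hasSubgaussianMGF_mono {X : Ω → ℝ} {c c' : ℝ≥0} (h : HasSubgaussianMGF X c P)
    (hc : c ≤ c') : HasSubgaussianMGF X c' P := by
  refine ⟨h.integrable_exp_mul, fun t => (h.mgf_le t).trans (Real.exp_le_exp.2 ?_)⟩
  have : (c : ℝ) ≤ c' := NNReal.coe_le_coe.2 hc
  gcongr

end Subgaussian

/-! ### Nets of the unit ball -/

/-- A maximal `1/2`-separated subset of the unit sphere works: the point nearest to `w / ‖w‖` has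
inner product at least `1/2` with it, whence the factor `4`. The alternative `w = 0` is needed for
`m = 0`, where the sphere is empty. -/
lemma exists_net (m : ℕ) : ∃ s : Finset (Fin m → ℝ), s.card ≤ 5 ^ m ∧ (∀ u ∈ s, u ⬝ᵥ u ≤ 1) ∧
    ∀ w : Fin m → ℝ, w = 0 ∨ ∃ u ∈ s, w ⬝ᵥ w ≤ 4 * (u ⬝ᵥ w) ^ 2 := by
  classical
  let E := EuclideanSpace ℝ (Fin m)
  have hinner : ∀ x y : E, inner ℝ x y = x.ofLp ⬝ᵥ y.ofLp := fun x y => by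
    rw [EuclideanSpace.inner_eq_star_dotProduct, dotProduct_comm]; simp
  let Sep : Finset E → Prop := fun s => (∀ c ∈ s, ‖c‖ = 1) ∧
    ∀ c ∈ s, ∀ c' ∈ s, c ≠ c' → 1 / 2 ≤ ‖c - c'‖
  have hcard : ∀ s, Sep s → s.card ≤ 5 ^ m := by
    intro s hs
    have h2 : (2 : ℝ) ≠ 0 := two_ne_zero
    -- Doubling turns `1/2`-separated unit vectors into `1`-separated points of the ball of radius
    -- `2`, the normalization of the packing bound `5 ^ m`.
    have h := Besicovitch.card_le_of_separated (s.image fun c : E => (2 : ℝ) • c) (by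
      intro c hc
      obtain ⟨c', hc', rfl⟩ := Finset.mem_image.1 hc
      rw [norm_smul, hs.1 c' hc']; norm_num) (by
      intro c hc c₂ hc₂ hne
      obtain ⟨c', hc', rfl⟩ := Finset.mem_image.1 hc
      obtain ⟨c₂', hc₂', rfl⟩ := Finset.mem_image.1 hc₂
      have := hs.2 c' hc' c₂' hc₂' (fun h => hne (by rw [h]))
      rw [← smul_sub, norm_smul]
      norm_num
      linarith)
    rw [Finset.card_image_of_injective _ (smul_right_injective E h2)] at h
    simpa [E] using h
  obtain ⟨s, hs, hmax⟩ : ∃ s, Sep s ∧ ∀ s', Sep s' → s'.card ≤ s.card := by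
    have hne : ∃ k, ∃ s, Sep s ∧ s.card = k := ⟨0, ∅, by simp [Sep], rfl⟩
    let K := Nat.findGreatest (fun k => ∃ s, Sep s ∧ s.card = k) (5 ^ m)
    obtain ⟨s, hs, hsK⟩ : ∃ s, Sep s ∧ s.card = K :=
      Nat.findGreatest_spec (P := fun k => ∃ s, Sep s ∧ s.card = k) (Nat.zero_le _)
        ⟨∅, by simp [Sep], rfl⟩
    refine ⟨s, hs, fun s' hs' => ?_⟩
    rw [hsK]
    exact Nat.le_findGreatest (hcard s' hs') ⟨s', hs', rfl⟩
  refine ⟨s.image WithLp.ofLp, Finset.card_image_le.trans (hcard s hs), ?_, ?_⟩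
  · intro u hu
    obtain ⟨c, hc, rfl⟩ := Finset.mem_image.1 hu
    rw [← hinner, real_inner_self_eq_norm_sq, hs.1 c hc]; norm_num
  · intro w
    by_cases hw : w = 0
    · exact Or.inl hw
    refine Or.inr ?_
    set w' : E := WithLp.toLp 2 w with hw'
    have hw'0 : w' ≠ 0 := fun h => hw (by
      have := congrArg WithLp.ofLp h
      simpa [hw'] using this)
    have hnpos : 0 < ‖w'‖ := norm_pos_iff.2 hw'0
    set e : E := ‖w'‖⁻¹ • w' with he
    have hen : ‖e‖ = 1 := by
      rw [he, norm_smul, norm_inv, norm_norm, inv_mul_cancel₀ hnpos.ne']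
    obtain ⟨c, hc, hce⟩ : ∃ c ∈ s, ‖e - c‖ ≤ 1 / 2 := by
      by_contra hcon
      push Not at hcon
      have hes : e ∉ s := fun h => by
        have := hcon e h
        norm_num at this
      have hsep : Sep (insert e s) := by
        refine ⟨fun c hc => ?_, fun c hc c' hc' hne => ?_⟩
        · rcases Finset.mem_insert.1 hc with rfl | hc
          · exact hen
          · exact hs.1 c hc
        · rcases Finset.mem_insert.1 hc with rfl | hc <;>
            rcases Finset.mem_insert.1 hc' with rfl | hc'
          · exact absurd rfl hne
          · exact (hcon c' hc').le
          · rw [norm_sub_rev]; exact (hcon c hc).le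
          · exact hs.2 c hc c' hc' hne
      have := hmax _ hsep
      rw [Finset.card_insert_of_notMem hes] at this
      omega
    refine ⟨c.ofLp, Finset.mem_image_of_mem _ hc, ?_⟩
    have h1 : 1 / 2 ≤ inner ℝ c e := by
      have h2 : inner ℝ (e - c) e ≤ ‖e - c‖ * ‖e‖ := real_inner_le_norm _ _
      rw [inner_sub_left, real_inner_self_eq_norm_sq, hen] at h2
      linarith
    have h3 : inner ℝ c w' = ‖w'‖ * inner ℝ c e := by
      rw [he, inner_smul_right, ← mul_assoc, mul_inv_cancel₀ hnpos.ne', one_mul]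
    have h4 : w ⬝ᵥ w = ‖w'‖ ^ 2 := by rw [← real_inner_self_eq_norm_sq, hinner]
    have h5 : c.ofLp ⬝ᵥ w = ‖w'‖ * inner ℝ c e := by rw [← h3, hinner]
    rw [h4, h5, mul_pow]
    have h6 : 1 ≤ 4 * (inner ℝ c e) ^ 2 := by nlinarith
    nlinarith [mul_le_mul_of_nonneg_left h6 (sq_nonneg ‖w'‖)]

/-- A net of the unit ball of `ℝ ^ m` with at most `5 ^ m` points. -/
noncomputable def net (m : ℕ) : Finset (Fin m → ℝ) := (exists_net m).choose

lemma card_net_le (m : ℕ) : (net m).card ≤ 5 ^ m := (exists_net m).choose_spec.1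

lemma dotProduct_self_le_one_of_mem_net {m : ℕ} {u : Fin m → ℝ} (hu : u ∈ net m) : u ⬝ᵥ u ≤ 1 :=
  (exists_net m).choose_spec.2.1 u hu

lemma exists_mem_net {m : ℕ} (w : Fin m → ℝ) : w = 0 ∨ ∃ u ∈ net m, w ⬝ᵥ w ≤ 4 * (u ⬝ᵥ w) ^ 2 :=
  (exists_net m).choose_spec.2.2 w

/-- Each of the two nets costs a factor `4` in the squared norm. -/
lemma dotProduct_transpose_mulVec_le_of_net {d T : ℕ} {N : Matrix (Fin d) (Fin T) ℝ} {ε : ℝ}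
    (h : ∀ u ∈ net d, ∀ v ∈ net T, |u ⬝ᵥ (N *ᵥ v)| ≤ ε) (y : Fin d → ℝ) :
    (Nᵀ *ᵥ y) ⬝ᵥ (Nᵀ *ᵥ y) ≤ 16 * ε ^ 2 * (y ⬝ᵥ y) := by
  have hy := dotProduct_self_nonneg' y
  have h1 : ∀ v ∈ net T, (N *ᵥ v) ⬝ᵥ (N *ᵥ v) ≤ 4 * ε ^ 2 := fun v hv => by
    rcases exists_mem_net (N *ᵥ v) with h0 | ⟨u, hu, hle⟩
    · rw [h0]; simp; positivity
    · have := h u hu v hv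
      have h2 : (u ⬝ᵥ (N *ᵥ v)) ^ 2 ≤ ε ^ 2 := sq_le_sq.2 (this.trans (le_abs_self ε))
      linarith
  rcases exists_mem_net (Nᵀ *ᵥ y) with h0 | ⟨v, hv, hle⟩
  · rw [h0]; simp; positivity
  · rw [← mulVec_dotProduct_eq N v y] at hle
    have h2 := dotProduct_sq_le (N *ᵥ v) y
    have h3 := mul_le_mul_of_nonneg_right (h1 v hv) hy
    linarith

/-! ### Truncated means -/

/-- Truncation of a number at the level `a` of its square. -/
noncomputable def truncNum (a y : ℝ) : ℝ := if y ^ 2 ≤ a then y else 0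

lemma measurable_truncNum : Measurable fun p : ℝ × ℝ => truncNum p.1 p.2 :=
  Measurable.ite (measurableSet_le (by fun_prop) (by fun_prop)) (by fun_prop) measurable_const

lemma abs_truncNum_le (a y : ℝ) : |truncNum a y| ≤ Real.sqrt a := by
  rw [truncNum]
  split_ifs with h
  · exact Real.abs_le_sqrt h
  · simp

lemma measurable_mul_truncNum {d : ℕ} (u θ : Fin d → ℝ) (a : ℝ) :
    Measurable fun x : Fin d → ℝ => (u ⬝ᵥ x) * truncNum a (θ ⬝ᵥ x) :=
  (measurable_dotProduct_right u).mul
    (measurable_truncNum.comp (measurable_const.prodMk (measurable_dotProduct_right θ)))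

lemma integrable_mul_truncNum {d : ℕ} (u θ : Fin d → ℝ) (a : ℝ) :
    Integrable (fun x => (u ⬝ᵥ x) * truncNum a (θ ⬝ᵥ x)) (stdGauss (Fin d)) := by
  refine (((memLp_dotProduct u 1 (by simp)).integrable le_rfl).abs.mul_const (Real.sqrt a)).mono'
    (measurable_mul_truncNum u θ a).aestronglyMeasurable (Filter.Eventually.of_forall fun x => ?_)
  rw [Real.norm_eq_abs, abs_mul]
  exact mul_le_mul_of_nonneg_left (abs_truncNum_le a _) (abs_nonneg _)

/-- The mean of `x · trunc(θ ⬝ᵥ x)` for a standard Gaussian vector `x`. -/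
noncomputable def truncMean {d : ℕ} (θ : Fin d → ℝ) (a : ℝ) : Fin d → ℝ :=
  fun b => ∫ x, x b * truncNum a (θ ⬝ᵥ x) ∂(stdGauss (Fin d))

/-- Measurability in the level is needed because the truncation level is itself a function of the
first sample. -/
lemma measurable_truncMean {d : ℕ} (θ : Fin d → ℝ) : Measurable (truncMean θ) := by
  refine measurable_pi_lambda _ fun b => ?_
  refine StronglyMeasurable.measurable (StronglyMeasurable.integral_prod_right'
    (f := fun p : ℝ × (Fin d → ℝ) => p.2 b * truncNum p.1 (θ ⬝ᵥ p.2)) ?_)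
  refine Measurable.stronglyMeasurable ?_
  exact ((measurable_pi_apply b).comp measurable_snd).mul (measurable_truncNum.comp
    (measurable_fst.prodMk ((measurable_dotProduct_right θ).comp measurable_snd)))

lemma dotProduct_truncMean {d : ℕ} (u θ : Fin d → ℝ) (a : ℝ) :
    u ⬝ᵥ truncMean θ a = ∫ x, (u ⬝ᵥ x) * truncNum a (θ ⬝ᵥ x) ∂(stdGauss (Fin d)) := by
  have hInt : ∀ b, Integrable (fun x : Fin d → ℝ => x b * truncNum a (θ ⬝ᵥ x))
      (stdGauss (Fin d)) := fun b => by
    have := integrable_mul_truncNum (Pi.single b 1) θ a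
    simpa using this
  simp only [truncMean, dotProduct, ← integral_const_mul, Finset.sum_mul, mul_assoc]
  rw [integral_finsetSum]
  intro b _
  exact (hInt b).const_mul (u b)

/-- `u ⬝ᵥ x` is centred and independent of `θ ⬝ᵥ x`, hence of its truncation. Thus truncation can
change the length of the mean but not its line. -/
lemma dotProduct_truncMean_of_orthogonal {d : ℕ} {u θ : Fin d → ℝ} (a : ℝ) (h : u ⬝ᵥ θ = 0) :
    u ⬝ᵥ truncMean θ a = 0 := by
  rw [dotProduct_truncMean]
  have hm : Measurable fun y => truncNum a y :=
    measurable_truncNum.comp (measurable_const.prodMk measurable_id)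
  have hind : IndepFun (fun x : Fin d → ℝ => u ⬝ᵥ x) (fun x => truncNum a (θ ⬝ᵥ x))
      (stdGauss (Fin d)) := (indepFun_dotProduct h).comp measurable_id hm
  rw [hind.integral_fun_mul_eq_mul_integral (by fun_prop)
    (hm.comp (measurable_dotProduct_right θ)).aestronglyMeasurable, integral_dotProduct, zero_mul]

/-- If the truncation level is large compared to the variance of `θ ⬝ᵥ x`, then the truncated mean
is at least half of `θ`. -/
lemma exists_truncMean_eq {d : ℕ} {θ : Fin d → ℝ} {a : ℝ} (ha : 36 / 5 * (θ ⬝ᵥ θ) ≤ a) :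
    ∃ β : ℝ, 1 / 2 ≤ β ∧ truncMean θ a = β • θ := by
  by_cases hθ : θ = 0
  · refine ⟨1, by norm_num, ?_⟩
    subst hθ
    ext b
    simp [truncMean, truncNum]
  have hw : 0 < θ ⬝ᵥ θ := lt_of_le_of_ne (dotProduct_self_nonneg' θ)
    (fun h => hθ (dotProduct_self_eq_zero.1 h.symm))
  have ha0 : 0 < a := by linarith
  set m := truncMean θ a with hm
  have hmeq : m = ((θ ⬝ᵥ m) / (θ ⬝ᵥ θ)) • θ := by
    set z := m - ((θ ⬝ᵥ m) / (θ ⬝ᵥ θ)) • θ with hz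
    have h1 : z ⬝ᵥ θ = 0 := by
      rw [hz, sub_dotProduct, smul_dotProduct, smul_eq_mul, div_mul_cancel₀ _ hw.ne',
        dotProduct_comm, sub_self]
    have h2 := dotProduct_truncMean_of_orthogonal a h1
    have h3 : z ⬝ᵥ z = 0 := by
      conv_lhs => rw [hz]
      rw [sub_dotProduct, smul_dotProduct, dotProduct_comm θ z, h1, dotProduct_comm, h2]
      simp
    exact sub_eq_zero.1 (dotProduct_self_eq_zero.1 h3)
  refine ⟨(θ ⬝ᵥ m) / (θ ⬝ᵥ θ), ?_, hmeq⟩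
  rw [le_div_iff₀ hw, hm, dotProduct_truncMean]
  -- What truncation removes is at most `y ^ 4 / a`, since `y ^ 2 > a` there. Its mean is at most
  -- `(18/5) w ^ 2 / a ≤ w / 2` for `w = θ ⬝ᵥ θ`, which explains the constant `36/5`.
  have hpt : ∀ x : Fin d → ℝ, (θ ⬝ᵥ x) ^ 2 - (θ ⬝ᵥ x) ^ 4 / a
      ≤ (θ ⬝ᵥ x) * truncNum a (θ ⬝ᵥ x) := fun x => by
    rw [truncNum]
    split_ifs with h
    · have : 0 ≤ (θ ⬝ᵥ x) ^ 4 / a := by positivity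
      linarith
    · push Not at h
      rw [mul_zero, sub_nonpos, le_div_iff₀ ha0]
      nlinarith [sq_nonneg (θ ⬝ᵥ x)]
  have hi2 := integrable_dotProduct_pow θ 2
  have hi4 := (integrable_dotProduct_pow θ 4).div_const a
  have h1 := integral_mono (hi2.sub hi4) (integrable_mul_truncNum θ θ a) hpt
  have h2 : ∫ x, ((θ ⬝ᵥ x) ^ 2 - (θ ⬝ᵥ x) ^ 4 / a) ∂(stdGauss (Fin d))
      = θ ⬝ᵥ θ - (∫ x, (θ ⬝ᵥ x) ^ 4 ∂(stdGauss (Fin d))) / a := by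
    rw [integral_sub hi2 hi4, integral_div, integral_dotProduct_sq]
  have h3 : (∫ x, (θ ⬝ᵥ x) ^ 4 ∂(stdGauss (Fin d))) / a ≤ 1 / 2 * (θ ⬝ᵥ θ) := by
    rw [div_le_iff₀ ha0]
    have := integral_dotProduct_pow_four_le θ
    nlinarith
  have h4 : θ ⬝ᵥ θ - (∫ x, (θ ⬝ᵥ x) ^ 4 ∂(stdGauss (Fin d))) / a
      ≤ ∫ x, (θ ⬝ᵥ x) * truncNum a (θ ⬝ᵥ x) ∂(stdGauss (Fin d)) := h2 ▸ h1
  linarith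

/-! ### Concentration of the truncated data matrix -/

/-- The law of a group of `n` standard Gaussian row vectors for each of `T` tasks. -/
noncomputable def sampleLaw (T n d : ℕ) : Measure (Fin T × Fin n → Fin d → ℝ) :=
  Measure.pi fun _ => stdGauss (Fin d)

instance (T n d : ℕ) : IsProbabilityMeasure (sampleLaw T n d) := by
  unfold sampleLaw; infer_instance

section Sample

variable {T n d : ℕ}

/-- The matrix with columns `(1/n) X_tᵀ y_{t,trnc}`, with truncation levels `a`. -/
noncomputable def dataMatrix (θ : Fin T → Fin d → ℝ) (a : Fin T → ℝ)
    (x : Fin T × Fin n → Fin d → ℝ) : Matrix (Fin d) (Fin T) ℝ :=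
  Matrix.of fun b t => (1 / (n : ℝ)) * ∑ i, x (t, i) b * truncNum (a t) (θ t ⬝ᵥ x (t, i))

/-- The expectation of the matrix `dataMatrix`. -/
noncomputable def meanMatrix (θ : Fin T → Fin d → ℝ) (a : Fin T → ℝ) : Matrix (Fin d) (Fin T) ℝ :=
  Matrix.of fun b t => truncMean (θ t) (a t) b

lemma dotProduct_noise_eq (hn : 0 < n) (θ : Fin T → Fin d → ℝ) (a : Fin T → ℝ)
    (x : Fin T × Fin n → Fin d → ℝ) (u : Fin d → ℝ) (v : Fin T → ℝ) :
    u ⬝ᵥ ((dataMatrix θ a x - meanMatrix θ a) *ᵥ v)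
      = ∑ p : Fin T × Fin n, v p.1 / n * ((u ⬝ᵥ x p) * truncNum (a p.1) (θ p.1 ⬝ᵥ x p)
        - ∫ z, (u ⬝ᵥ z) * truncNum (a p.1) (θ p.1 ⬝ᵥ z) ∂(stdGauss (Fin d))) := by
  have hn' : (n : ℝ) ≠ 0 := Nat.cast_ne_zero.2 hn.ne'
  rw [Fintype.sum_prod_type, dotProduct_mulVec, dotProduct]
  refine Finset.sum_congr rfl fun t _ => ?_
  dsimp only
  rw [← Finset.mul_sum, Finset.sum_sub_distrib, Finset.sum_const, Finset.card_univ,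
    Fintype.card_fin, ← dotProduct_truncMean]
  have h1 : (u ᵥ* (dataMatrix θ a x - meanMatrix θ a)) t
      = u ⬝ᵥ (fun b => dataMatrix θ a x b t) - u ⬝ᵥ truncMean (θ t) (a t) := by
    rw [← dotProduct_sub]; rfl
  have h2 : u ⬝ᵥ (fun b => dataMatrix θ a x b t)
      = (1 / (n : ℝ)) * ∑ i, (u ⬝ᵥ x (t, i)) * truncNum (a t) (θ t ⬝ᵥ x (t, i)) := by
    simp only [dataMatrix, of_apply, dotProduct, Finset.mul_sum, Finset.sum_mul]
    rw [Finset.sum_comm]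
    refine Finset.sum_congr rfl fun i _ => Finset.sum_congr rfl fun b _ => by ring
  rw [h1, h2, nsmul_eq_mul]
  field_simp

/-- The form is a sum of independent centred terms, each dominated before centring and weighting by
`√A |u ⬝ᵥ x|`. The weights `v_t / n`, repeated `n` times, have squares summing to `‖v‖² / n`. -/
lemma hasSubgaussianMGF_noise (hn : 0 < n) (θ : Fin T → Fin d → ℝ) {a : Fin T → ℝ} {A : ℝ≥0}
    (ha : ∀ t, a t ≤ A) {u : Fin d → ℝ} (hu : u ⬝ᵥ u ≤ 1) {v : Fin T → ℝ} (hv : v ⬝ᵥ v ≤ 1) :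
    HasSubgaussianMGF (fun x => u ⬝ᵥ ((dataMatrix θ a x - meanMatrix θ a) *ᵥ v))
      (60 * A / n) (sampleLaw T n d) := by
  have hn' : (n : ℝ) ≠ 0 := Nat.cast_ne_zero.2 hn.ne'
  set Y : Fin T × Fin n → (Fin d → ℝ) → ℝ := fun p z =>
    v p.1 / n * ((u ⬝ᵥ z) * truncNum (a p.1) (θ p.1 ⬝ᵥ z)
      - ∫ z, (u ⬝ᵥ z) * truncNum (a p.1) (θ p.1 ⬝ᵥ z) ∂(stdGauss (Fin d))) with hY
  have hYsub : ∀ p, HasSubgaussianMGF (Y p)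
      (Real.toNNReal ((v p.1 / n) ^ 2) * (60 * A)) (stdGauss (Fin d)) := fun p => by
    refine hasSubgaussianMGF_mono (HasSubgaussianMGF.const_mul
      (hasSubgaussianMGF_sub_integral_of_abs_le (s := NNReal.sqrt A)
      (hasSubgaussianMGF_dotProduct hu) (measurable_mul_truncNum u _ _).aestronglyMeasurable
      fun z => ?_) (v p.1 / n)) ?_
    · rw [abs_mul, mul_comm]
      refine mul_le_mul_of_nonneg_right ((abs_truncNum_le _ _).trans ?_) (abs_nonneg _)
      rw [Real.coe_sqrt]
      exact Real.sqrt_le_sqrt (ha p.1)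
    · rw [NNReal.sq_sqrt]
      exact mul_le_mul_left (NNReal.coe_le_coe.1 (Real.le_coe_toNNReal _)) _
  have hind : iIndepFun (fun p (x : Fin T × Fin n → Fin d → ℝ) => Y p (x p)) (sampleLaw T n d) :=
    iIndepFun_pi fun p => (hYsub p).aemeasurable
  have hsub : ∀ p ∈ (Finset.univ : Finset (Fin T × Fin n)),
      HasSubgaussianMGF (fun x : Fin T × Fin n → Fin d → ℝ => Y p (x p))
        (Real.toNNReal ((v p.1 / n) ^ 2) * (60 * A)) (sampleLaw T n d) := by
    intro p _
    have hmp := measurePreserving_eval (fun _ : Fin T × Fin n => stdGauss (Fin d)) p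
    refine HasSubgaussianMGF.of_map (Y := fun x : Fin T × Fin n → Fin d → ℝ => x p) (X := Y p)
      (measurable_pi_apply p).aemeasurable ?_
    have h2 : (sampleLaw T n d).map (fun x => x p) = stdGauss (Fin d) := hmp.map_eq
    rw [h2]
    exact hYsub p
  have hsum := HasSubgaussianMGF.sum_of_iIndepFun hind hsub
  have heq : (fun x : Fin T × Fin n → Fin d → ℝ => ∑ p, Y p (x p))
      = fun x => u ⬝ᵥ ((dataMatrix θ a x - meanMatrix θ a) *ᵥ v) := by
    ext x
    rw [dotProduct_noise_eq hn]
  rw [heq] at hsum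
  refine hasSubgaussianMGF_mono hsum ?_
  rw [← NNReal.coe_le_coe]
  push_cast
  rw [Fintype.sum_prod_type]
  simp only [Finset.sum_const, Finset.card_univ, Fintype.card_fin, nsmul_eq_mul,
    Real.coe_toNNReal _ (sq_nonneg _)]
  rw [← Finset.mul_sum, ← Finset.sum_mul]
  have h3 : ∑ t, (v t / n) ^ 2 ≤ 1 / (n : ℝ) ^ 2 := by
    simp only [div_pow]
    rw [← Finset.sum_div]
    have : ∑ t, v t ^ 2 = v ⬝ᵥ v := by simp [dotProduct, sq]
    rw [this]
    gcongr
  calc (n : ℝ) * ((∑ t, (v t / n) ^ 2) * (60 * A)) ≤ n * (1 / (n : ℝ) ^ 2 * (60 * A)) := by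
        gcongr
    _ = 60 * A / n := by field_simp

lemma sampleLaw_noise_le (hn : 0 < n) (θ : Fin T → Fin d → ℝ) {a : Fin T → ℝ} {A : ℝ}
    (hA : 0 ≤ A) (ha : ∀ t, a t ≤ A) {ε : ℝ} (hε : 0 ≤ ε) :
    sampleLaw T n d {x | ∃ u ∈ net d, ∃ v ∈ net T,
        ε ≤ |u ⬝ᵥ ((dataMatrix θ a x - meanMatrix θ a) *ᵥ v)|}
      ≤ ENNReal.ofReal (5 ^ d * (5 ^ T * (2 * Real.exp (-ε ^ 2 * n / (120 * A))))) := by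
  lift A to ℝ≥0 using hA
  set p := Real.exp (-ε ^ 2 * n / (120 * A)) with hp
  have hp0 : 0 ≤ p := (Real.exp_pos _).le
  have hone : ∀ u ∈ net d, ∀ v ∈ net T, sampleLaw T n d
      {x | ε ≤ |u ⬝ᵥ ((dataMatrix θ a x - meanMatrix θ a) *ᵥ v)|} ≤ ENNReal.ofReal (2 * p) := by
    intro u hu v hv
    have h := hasSubgaussianMGF_noise hn θ ha (dotProduct_self_le_one_of_mem_net hu)
      (dotProduct_self_le_one_of_mem_net hv)
    have hexp : Real.exp (-ε ^ 2 / (2 * ((60 * A / n : ℝ≥0) : ℝ))) = p := by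
      rw [hp]
      congr 1
      push_cast
      have hn' : (n : ℝ) ≠ 0 := Nat.cast_ne_zero.2 hn.ne'
      rw [show 2 * (60 * (A : ℝ) / n) = 120 * A / n by ring, div_div_eq_mul_div]
    have h1 := h.measure_ge_le hε
    have h2 := h.neg.measure_ge_le hε
    rw [hexp] at h1 h2
    have hsub : {x : Fin T × Fin n → Fin d → ℝ | ε ≤ |u ⬝ᵥ ((dataMatrix θ a x - meanMatrix θ a) *ᵥ v)|}
        ⊆ {x | ε ≤ u ⬝ᵥ ((dataMatrix θ a x - meanMatrix θ a) *ᵥ v)} ∪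
          {x | ε ≤ -(u ⬝ᵥ ((dataMatrix θ a x - meanMatrix θ a) *ᵥ v))} := fun x hx => by
      have h3 : ε ≤ |u ⬝ᵥ ((dataMatrix θ a x - meanMatrix θ a) *ᵥ v)| := hx
      exact le_abs.1 h3
    refine (measure_mono hsub).trans ((measure_union_le _ _).trans ?_)
    rw [two_mul, ENNReal.ofReal_add hp0 hp0]
    refine add_le_add ?_ ?_
    · exact (ENNReal.le_ofReal_iff_toReal_le (measure_ne_top _ _) hp0).2 h1
    · exact (ENNReal.le_ofReal_iff_toReal_le (measure_ne_top _ _) hp0).2 h2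
  have hset : {x : Fin T × Fin n → Fin d → ℝ | ∃ u ∈ net d, ∃ v ∈ net T,
        ε ≤ |u ⬝ᵥ ((dataMatrix θ a x - meanMatrix θ a) *ᵥ v)|}
      = ⋃ u ∈ net d, ⋃ v ∈ net T, {x | ε ≤ |u ⬝ᵥ ((dataMatrix θ a x - meanMatrix θ a) *ᵥ v)|} := by
    ext x; simp
  have hcard : ∀ m : ℕ, ((net m).card : ℝ≥0∞) ≤ ENNReal.ofReal (5 ^ m) := fun m => by
    rw [ENNReal.ofReal_pow (by norm_num)]
    have := card_net_le m
    calc ((net m).card : ℝ≥0∞) ≤ ((5 ^ m : ℕ) : ℝ≥0∞) := by exact_mod_cast this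
      _ = _ := by push_cast; simp
  rw [hset]
  refine (measure_biUnion_finset_le _ _).trans ?_
  rw [ENNReal.ofReal_mul (by positivity)]
  refine (Finset.sum_le_card_nsmul _ _ _ fun u hu => ?_).trans
    ((nsmul_eq_mul _ _).trans_le (mul_le_mul' (hcard d) le_rfl))
  refine (measure_biUnion_finset_le _ _).trans ?_
  rw [ENNReal.ofReal_mul (by positivity)]
  exact (Finset.sum_le_card_nsmul _ _ _ fun v hv => hone u hu v hv).trans
    ((nsmul_eq_mul _ _).trans_le (mul_le_mul' (hcard T) le_rfl))

/-! ### Concentration of the energy of the responses -/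

/-- The energy `∑_t ∑_i y_{ti}²` of all responses. -/
noncomputable def energy (θ : Fin T → Fin d → ℝ) (x : Fin T × Fin n → Fin d → ℝ) : ℝ :=
  ∑ p, (θ p.1 ⬝ᵥ x p) ^ 2

lemma measurable_energy (θ : Fin T → Fin d → ℝ) :
    Measurable (energy (n := n) θ) := by
  unfold energy
  exact Finset.measurable_sum _ fun p _ =>
    ((measurable_dotProduct_right (θ p.1)).comp (measurable_pi_apply p)).pow_const 2

/-- Chebyshev's inequality with variance at most `(18/5) w n F`, where `F = ∑ t, θ t ⬝ᵥ θ t`; the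
deviation `n F / 10` turns `18/5` into `360`. A polynomial tail is enough, because only failure
probability of order `1 / d` is wanted. -/
lemma sampleLaw_energy_le (hn : 0 < n) (θ : Fin T → Fin d → ℝ) {w : ℝ}
    (hw : ∀ t, θ t ⬝ᵥ θ t ≤ w) (hF : 0 < ∑ t, θ t ⬝ᵥ θ t) :
    sampleLaw T n d {x | n * (∑ t, θ t ⬝ᵥ θ t) / 10 ≤ |energy θ x - n * ∑ t, θ t ⬝ᵥ θ t|}
      ≤ ENNReal.ofReal (360 * w / (n * ∑ t, θ t ⬝ᵥ θ t)) := by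
  set F := ∑ t, θ t ⬝ᵥ θ t with hFdef
  have hnR : (0 : ℝ) < n := Nat.cast_pos.2 hn
  set Y : Fin T × Fin n → (Fin d → ℝ) → ℝ := fun p z => (θ p.1 ⬝ᵥ z) ^ 2 with hY
  have hYm : ∀ p, Measurable (Y p) := fun p => (measurable_dotProduct_right _).pow_const 2
  have hYLp : ∀ p, MemLp (Y p) 2 (stdGauss (Fin d)) := fun p => by
    rw [memLp_two_iff_integrable_sq (hYm p).aestronglyMeasurable]
    refine (integrable_dotProduct_pow (θ p.1) 4).congr (Filter.Eventually.of_forall fun z => ?_)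
    simp only [hY]; ring
  have hmp : ∀ p, MeasurePreserving (fun x : Fin T × Fin n → Fin d → ℝ => x p) (sampleLaw T n d)
      (stdGauss (Fin d)) := fun p =>
    measurePreserving_eval (fun _ : Fin T × Fin n => stdGauss (Fin d)) p
  have hYLp' : ∀ p, MemLp (fun x : Fin T × Fin n → Fin d → ℝ => Y p (x p)) 2 (sampleLaw T n d) :=
    fun p => (hYLp p).comp_measurePreserving (hmp p)
  have henergy : energy (n := n) θ = ∑ p, fun x : Fin T × Fin n → Fin d → ℝ => Y p (x p) := by
    ext x; simp [energy, hY]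
  have hLp : MemLp (energy (n := n) θ) 2 (sampleLaw T n d) := by
    rw [henergy]; exact memLp_finsetSum' _ fun p _ => hYLp' p
  have hmean : ∫ x, energy θ x ∂(sampleLaw T n d) = n * F := by
    simp only [henergy, Finset.sum_apply]
    rw [integral_finsetSum _ fun p _ => (hYLp' p).integrable one_le_two]
    have : ∀ p : Fin T × Fin n, ∫ x, Y p (x p) ∂(sampleLaw T n d) = θ p.1 ⬝ᵥ θ p.1 := by
      intro p
      rw [← integral_dotProduct_sq, ← (hmp p).map_eq, integral_map (hmp p).aemeasurable
        ((hYm p).aestronglyMeasurable)]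
    simp only [this]
    rw [Fintype.sum_prod_type, hFdef, Finset.mul_sum]
    simp
  have hvar : Var[energy (n := n) θ; sampleLaw T n d] ≤ 18 / 5 * w * (n * F) := by
    rw [henergy, sampleLaw, variance_sum_pi hYLp]
    have h1 : ∀ p : Fin T × Fin n, Var[Y p; stdGauss (Fin d)] ≤ 18 / 5 * w * (θ p.1 ⬝ᵥ θ p.1) := by
      intro p
      refine (variance_le_expectation_sq (hYm p).aestronglyMeasurable).trans ?_
      have h2 := integral_dotProduct_pow_four_le (θ p.1)
      have h3 : ∫ z, (Y p ^ 2) z ∂(stdGauss (Fin d)) = ∫ z, (θ p.1 ⬝ᵥ z) ^ 4 ∂(stdGauss (Fin d)) := by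
        congr 1; ext z; simp only [hY, Pi.pow_apply]; ring
      rw [h3]
      have := mul_le_mul_of_nonneg_right (hw p.1) (dotProduct_self_nonneg' (θ p.1))
      nlinarith
    refine (Finset.sum_le_sum fun p _ => h1 p).trans (le_of_eq ?_)
    rw [← Finset.mul_sum, Fintype.sum_prod_type, hFdef, Finset.mul_sum (a := (n : ℝ))]
    simp
  have hc : 0 < n * F / 10 := by positivity
  have h := meas_ge_le_variance_div_sq hLp hc
  rw [hmean] at h
  refine h.trans (ENNReal.ofReal_le_ofReal ?_)
  rw [div_le_div_iff₀ (by positivity) (by positivity)]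
  have h5 := mul_le_mul_of_nonneg_right hvar (by positivity : 0 ≤ n * F)
  calc _ ≤ 18 / 5 * w * (n * F) * (n * F) := h5
    _ = _ := by ring

end Sample

/-! ### The random start -/

section Start

/-- The form in which conditioning is used: a bound uniform over the earlier sample passes to the
product. -/
lemma measure_prod_le_of_slice_le {α β : Type*} [MeasurableSpace α] [MeasurableSpace β]
    {μ : Measure α} {ν : Measure β} [IsProbabilityMeasure μ] [SFinite ν] {s : Set (α × β)}
    (hs : MeasurableSet s) {p : ℝ≥0∞} (h : ∀ x, ν (Prod.mk x ⁻¹' s) ≤ p) :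
    (μ.prod ν) s ≤ p := by
  rw [Measure.prod_apply hs]
  calc ∫⁻ x, ν (Prod.mk x ⁻¹' s) ∂μ ≤ ∫⁻ _, p ∂μ := lintegral_mono h
    _ = p := by simp

lemma measure_prod_le_of_slice_le' {α β : Type*} [MeasurableSpace α] [MeasurableSpace β]
    {μ : Measure α} {ν : Measure β} [SFinite μ] [IsProbabilityMeasure ν] {s : Set (α × β)}
    (hs : MeasurableSet s) {p : ℝ≥0∞} (h : ∀ y, μ ((fun x => (x, y)) ⁻¹' s) ≤ p) :
    (μ.prod ν) s ≤ p := by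
  rw [Measure.prod_apply_symm hs]
  calc ∫⁻ y, μ ((fun x => (x, y)) ⁻¹' s) ∂ν ≤ ∫⁻ _, p ∂ν := lintegral_mono h
    _ = p := by simp

/-- Projection along a compact factor is a closed map. This gives measurability of events with an
uncountable quantifier over unit vectors. -/
lemma isClosed_exists_mulVec_le {d r : ℕ} {K : Set (Fin r → ℝ)} (hK : IsCompact K) (c : ℝ) :
    IsClosed {A : Fin d → Fin r → ℝ |
      ∃ a ∈ K, (Matrix.of A *ᵥ a) ⬝ᵥ (Matrix.of A *ᵥ a) ≤ c} := by
  have : CompactSpace K := isCompact_iff_compactSpace.1 hK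
  have hcont : Continuous fun p : (Fin d → Fin r → ℝ) × K =>
      (Matrix.of p.1 *ᵥ p.2.1) ⬝ᵥ (Matrix.of p.1 *ᵥ p.2.1) := by
    have h : ∀ i, Continuous fun p : (Fin d → Fin r → ℝ) × K => ∑ j, p.1 i j * p.2.1 j := fun i =>
      continuous_finsetSum _ fun j _ =>
        ((continuous_apply j).comp ((continuous_apply i).comp continuous_fst)).mul
          ((continuous_apply j).comp (continuous_subtype_val.comp continuous_snd))
    exact continuous_finsetSum _ fun i _ => (h i).mul (h i)
  have hcl : IsClosed {p : (Fin d → Fin r → ℝ) × K |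
      (Matrix.of p.1 *ᵥ p.2.1) ⬝ᵥ (Matrix.of p.1 *ᵥ p.2.1) ≤ c} :=
    isClosed_le hcont continuous_const
  convert isClosedMap_fst_of_compactSpace _ hcl
  ext A
  simp

lemma isCompact_sphere_dotProduct (r : ℕ) : IsCompact {a : Fin r → ℝ | a ⬝ᵥ a = 1} := by
  refine Metric.isCompact_of_isClosed_isBounded ?_ ?_
  · exact isClosed_eq (by simp only [dotProduct]; fun_prop) continuous_const
  · refine (Metric.isBounded_closedBall (x := (0 : Fin r → ℝ)) (r := 1)).subset fun a ha => ?_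
    rw [mem_closedBall_zero_iff, pi_norm_le_iff_of_nonneg zero_le_one]
    intro i
    have h1 : a i * a i ≤ a ⬝ᵥ a :=
      Finset.single_le_sum (f := fun i => a i * a i) (fun j _ => mul_self_nonneg _)
        (Finset.mem_univ i)
    have h2 : a ⬝ᵥ a = 1 := ha
    rw [h2, ← sq] at h1
    rw [Real.norm_eq_abs]
    exact abs_le_one_iff_mul_self_le_one.2 (by rwa [← sq])

/-- The law of the columns of the random start. -/
noncomputable def startLaw (r d : ℕ) : Measure (Fin r → Fin d → ℝ) :=
  Measure.pi fun _ => stdGauss (Fin d)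

instance (r d : ℕ) : IsProbabilityMeasure (startLaw r d) := by
  unfold startLaw; infer_instance

variable {r d : ℕ}

/-- The matrix with columns `z`. -/
def ofColumns (z : Fin r → Fin d → ℝ) : Matrix (Fin d) (Fin r) ℝ := Matrix.of fun a k => z k a

lemma ofColumns_mulVec (z : Fin r → Fin d → ℝ) (a : Fin r → ℝ) :
    ofColumns z *ᵥ a = ∑ k, a k • z k := by
  ext b
  simp [ofColumns, mulVec, dotProduct, mul_comm]

/-- Fix all columns but the `k`-th and choose `y` orthogonal to them. Then `y ⬝ᵥ (Z *ᵥ a) = a k * (y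
⬝ᵥ z k)`, where `y ⬝ᵥ z k` is standard Gaussian because `y` does not depend on column `k`. As `a k ^
2 ≥ 1 / r`, degeneracy forces `|y ⬝ᵥ z k| ≤ √r η`, whatever `a` is; no net over `a` is required. -/
lemma startLaw_exists_coord_le {K : Matrix (Fin d) (Fin d) ℝ} {ρ η : ℝ} (hρ : 0 < ρ)
    (hη : 0 ≤ η) (k : Fin r)
    (hK : ∀ z : Fin r → Fin d → ℝ, ∃ y : Fin d → ℝ, y ⬝ᵥ y = 1 ∧ (∀ j, j ≠ k → y ⬝ᵥ z j = 0) ∧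
      ∀ w, ρ * (y ⬝ᵥ w) ^ 2 ≤ (K *ᵥ w) ⬝ᵥ (K *ᵥ w)) :
    startLaw r d {z | ∃ a : Fin r → ℝ, (a ⬝ᵥ a = 1 ∧ 1 ≤ r * a k ^ 2) ∧
      ((K * ofColumns z) *ᵥ a) ⬝ᵥ ((K * ofColumns z) *ᵥ a) ≤ ρ * η ^ 2}
      ≤ ENNReal.ofReal (Real.sqrt r * η) := by
  obtain ⟨r, rfl⟩ : ∃ r', r = r' + 1 := ⟨r - 1, by have := k.pos; omega⟩
  set C : Set (Fin (r + 1) → ℝ) := {a | a ⬝ᵥ a = 1 ∧ 1 ≤ ((r + 1 : ℕ) : ℝ) * a k ^ 2} with hC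
  have hCcomp : IsCompact C := (isCompact_sphere_dotProduct (r + 1)).inter_right
    (isClosed_le (f := fun _ => (1 : ℝ)) continuous_const
      (continuous_const.mul ((continuous_apply k).pow 2)))
  set D : Set (Fin (r + 1) → Fin d → ℝ) := {z | ∃ a ∈ C,
      ((K * ofColumns z) *ᵥ a) ⬝ᵥ ((K * ofColumns z) *ᵥ a) ≤ ρ * η ^ 2} with hD
  have hDm : MeasurableSet D := by
    have hm : Measurable fun z : Fin (r + 1) → Fin d → ℝ =>
        (fun a j => (K * ofColumns z) a j : Fin d → Fin (r + 1) → ℝ) := by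
      refine measurable_pi_lambda _ fun a => measurable_pi_lambda _ fun j => ?_
      simp only [mul_apply, ofColumns, of_apply]
      fun_prop
    exact hm (isClosed_exists_mulVec_le hCcomp (ρ * η ^ 2)).measurableSet
  have hmp := (measurePreserving_piFinSuccAbove
    (fun _ : Fin (r + 1) => stdGauss (Fin d)) k).symm
  have hmeas : startLaw (r + 1) d D = ((stdGauss (Fin d)).prod
      (Measure.pi fun _ : Fin r => stdGauss (Fin d)))
        ((MeasurableEquiv.piFinSuccAbove (fun _ : Fin (r + 1) => Fin d → ℝ) k).symm ⁻¹' D) :=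
    (hmp.measure_preimage hDm.nullMeasurableSet).symm
  change startLaw (r + 1) d D ≤ _
  rw [hmeas]
  refine measure_prod_le_of_slice_le' (hmp.measurable hDm) fun z' => ?_
  -- The filler `0` in column `k` makes `y` a function of the other columns only; `hK` places no
  -- condition on that column.
  obtain ⟨y, hy1, hyz, hyK⟩ := hK (Fin.insertNth (α := fun _ => Fin d → ℝ) k 0 z')
  refine le_trans (measure_mono fun x hx => ?_) (stdGauss_abs_dotProduct_le hy1 _)
  obtain ⟨a, ⟨_, hak⟩, hle⟩ : (Fin.insertNth (α := fun _ => Fin d → ℝ) k x z') ∈ D := hx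
  have hdot : y ⬝ᵥ (ofColumns (Fin.insertNth (α := fun _ => Fin d → ℝ) k x z') *ᵥ a)
      = a k * (y ⬝ᵥ x) := by
    rw [ofColumns_mulVec, Fin.sum_univ_succAbove _ k, dotProduct_add, dotProduct_sum,
      Finset.sum_eq_zero]
    · simp [dotProduct_smul]
    · intro j _
      have := hyz (k.succAbove j) (Fin.succAbove_ne k j)
      simp only [Fin.insertNth_apply_succAbove] at this ⊢
      rw [dotProduct_smul, this, smul_zero]
  have h1 := hyK (ofColumns (Fin.insertNth (α := fun _ => Fin d → ℝ) k x z') *ᵥ a)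
  rw [mulVec_mulVec, hdot] at h1
  have h2 : (a k * (y ⬝ᵥ x)) ^ 2 ≤ η ^ 2 := le_of_mul_le_mul_left (h1.trans hle) hρ
  have h3 : (y ⬝ᵥ x) ^ 2 ≤ ((r + 1 : ℕ) : ℝ) * η ^ 2 := by
    calc (y ⬝ᵥ x) ^ 2 = 1 * (y ⬝ᵥ x) ^ 2 := (one_mul _).symm
      _ ≤ ((r + 1 : ℕ) : ℝ) * a k ^ 2 * (y ⬝ᵥ x) ^ 2 :=
          mul_le_mul_of_nonneg_right hak (sq_nonneg _)
      _ = ((r + 1 : ℕ) : ℝ) * (a k * (y ⬝ᵥ x)) ^ 2 := by ring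
      _ ≤ _ := mul_le_mul_of_nonneg_left h2 (Nat.cast_nonneg _)
  have h4 : |y ⬝ᵥ x| ≤ Real.sqrt (((r + 1 : ℕ) : ℝ) * η ^ 2) := Real.abs_le_sqrt h3
  rwa [Real.sqrt_mul (Nat.cast_nonneg _), Real.sqrt_sq hη] at h4

/-- With a matrix `K` that is well-conditioned on an `r`-dimensional space, it is unlikely that
`K * Z` nearly annihilates a unit vector. -/
lemma startLaw_exists_le (hr : 0 < r) {K : Matrix (Fin d) (Fin d) ℝ} {ρ η : ℝ} (hρ : 0 < ρ)
    (hη : 0 ≤ η)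
    (hK : ∀ (z : Fin r → Fin d → ℝ) (k : Fin r), ∃ y : Fin d → ℝ, y ⬝ᵥ y = 1 ∧
      (∀ j, j ≠ k → y ⬝ᵥ z j = 0) ∧ ∀ w, ρ * (y ⬝ᵥ w) ^ 2 ≤ (K *ᵥ w) ⬝ᵥ (K *ᵥ w)) :
    startLaw r d {z | ∃ a ∈ {a : Fin r → ℝ | a ⬝ᵥ a = 1},
      ((K * ofColumns z) *ᵥ a) ⬝ᵥ ((K * ofColumns z) *ᵥ a) ≤ ρ * η ^ 2}
      ≤ ENNReal.ofReal (r * (Real.sqrt r * η)) := by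
  have hsub : {z : Fin r → Fin d → ℝ | ∃ a ∈ {a : Fin r → ℝ | a ⬝ᵥ a = 1},
      ((K * ofColumns z) *ᵥ a) ⬝ᵥ ((K * ofColumns z) *ᵥ a) ≤ ρ * η ^ 2}
      ⊆ ⋃ k, {z | ∃ a : Fin r → ℝ, (a ⬝ᵥ a = 1 ∧ 1 ≤ r * a k ^ 2) ∧
        ((K * ofColumns z) *ᵥ a) ⬝ᵥ ((K * ofColumns z) *ᵥ a) ≤ ρ * η ^ 2} := by
    rintro z ⟨a, ha, hle⟩
    have ha1 : a ⬝ᵥ a = 1 := ha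
    -- Some coordinate of a unit vector has square at least `1 / r`, so a union over `r` coordinates
    -- covers all `a`.
    obtain ⟨k, hk⟩ : ∃ k, 1 ≤ r * a k ^ 2 := by
      by_contra hcon
      push Not at hcon
      have h1 : ∑ k, r * a k ^ 2 < ∑ _k : Fin r, (1 : ℝ) :=
        Finset.sum_lt_sum_of_nonempty ⟨⟨0, hr⟩, Finset.mem_univ _⟩ fun k _ => hcon k
      have h2 : ∑ k, a k ^ 2 = a ⬝ᵥ a := by simp [dotProduct, sq]
      rw [← Finset.mul_sum, h2, ha1] at h1
      simp at h1
    exact Set.mem_iUnion.2 ⟨k, a, ⟨ha1, hk⟩, hle⟩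
  refine (measure_mono hsub).trans ((measure_iUnion_le _).trans ?_)
  rw [tsum_fintype, ENNReal.ofReal_mul (Nat.cast_nonneg r), ENNReal.ofReal_natCast]
  refine (Finset.sum_le_card_nsmul _ _ _ fun k _ =>
    startLaw_exists_coord_le hρ hη k fun z => hK z k).trans (le_of_eq ?_)
  rw [nsmul_eq_mul, Finset.card_univ, Fintype.card_fin]

lemma ofColumns_mulVec_self_le (z : Fin r → Fin d → ℝ) (a : Fin r → ℝ) :
    (ofColumns z *ᵥ a) ⬝ᵥ (ofColumns z *ᵥ a) ≤ (∑ k, z k ⬝ᵥ z k) * (a ⬝ᵥ a) := by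
  have h : ∀ b, (ofColumns z *ᵥ a) b * (ofColumns z *ᵥ a) b
      ≤ (∑ k, z k b * z k b) * (a ⬝ᵥ a) := fun b => by
    rw [← sq]
    exact dotProduct_sq_le (fun k => z k b) a
  refine (Finset.sum_le_sum fun b _ => h b).trans (le_of_eq ?_)
  rw [← Finset.sum_mul, Finset.sum_comm]
  rfl

lemma startLaw_sum_sq_ge_le {R : ℝ} (hR : 0 < R) :
    startLaw r d {z | R ≤ ∑ k, z k ⬝ᵥ z k} ≤ ENNReal.ofReal (r * d / R) := by
  have hcoord : ∀ (k : Fin r) (b : Fin d),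
      Integrable (fun z : Fin r → Fin d → ℝ => z k b * z k b) (startLaw r d) ∧
      ∫ z, z k b * z k b ∂(startLaw r d) = 1 := by
    intro k b
    have hmp := measurePreserving_eval (fun _ : Fin r => stdGauss (Fin d)) k
    have h1 := integrable_dotProduct_pow (Pi.single b (1 : ℝ)) 2
    have h2 := integral_dotProduct_sq (Pi.single b (1 : ℝ))
    have h3 : (fun x : Fin d → ℝ => (Pi.single b (1 : ℝ) ⬝ᵥ x) ^ 2) = fun x => x b * x b := by
      ext x; simp [sq]
    rw [h3] at h1 h2
    refine ⟨hmp.integrable_comp_of_integrable (g := fun x : Fin d → ℝ => x b * x b) h1, ?_⟩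
    have h4 : (startLaw r d).map (fun z => z k) = stdGauss (Fin d) := hmp.map_eq
    rw [← h4, integral_map (measurable_pi_apply k).aemeasurable
      (by fun_prop)] at h2
    rw [h2]; simp
  have hInt : Integrable (fun z : Fin r → Fin d → ℝ => ∑ k, z k ⬝ᵥ z k) (startLaw r d) :=
    integrable_finsetSum _ fun k _ => integrable_finsetSum _ fun b _ => (hcoord k b).1
  have hmean : ∫ z, ∑ k, z k ⬝ᵥ z k ∂(startLaw r d) = r * d := by
    simp only [dotProduct]
    rw [integral_finsetSum _ fun k _ => integrable_finsetSum _ fun b _ => (hcoord k b).1]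
    have : ∀ k : Fin r, ∫ z : Fin r → Fin d → ℝ, ∑ b, z k b * z k b ∂(startLaw r d) = d :=
      fun k => by
        rw [integral_finsetSum _ fun b _ => (hcoord k b).1]
        simp [(hcoord k _).2]
    simp [this]
  have h := mul_meas_ge_le_integral_of_nonneg (Filter.Eventually.of_forall fun z =>
    Finset.sum_nonneg fun k _ => dotProduct_self_nonneg' (z k)) hInt R
  rw [hmean] at h
  refine (ENNReal.le_ofReal_iff_toReal_le (measure_ne_top _ _) (by positivity)).2 ?_
  rw [le_div_iff₀ hR, mul_comm]
  exact h

/-- In an `r`-dimensional leading eigenspace there is a unit vector orthogonal to any `r - 1`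
given vectors. -/
lemma IsEigenbasis.exists_unit_orthogonal {M : Matrix (Fin d) (Fin d) ℝ}
    {v : Fin d → Fin d → ℝ} {lam : Fin d → ℝ} (h : IsEigenbasis M v lam) {I : Finset (Fin d)}
    (hcard : I.card = r) {t₂ : ℝ} (ht₂ : 0 ≤ t₂) (hI : ∀ i ∈ I, t₂ ≤ lam i)
    (z : Fin r → Fin d → ℝ) (k : Fin r) :
    ∃ y : Fin d → ℝ, y ⬝ᵥ y = 1 ∧ (∀ j, j ≠ k → y ⬝ᵥ z j = 0) ∧
      ∀ w, t₂ ^ 2 * (y ⬝ᵥ w) ^ 2 ≤ (M *ᵥ w) ⬝ᵥ (M *ᵥ w) := by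
  classical
  -- Only `r - 1` linear conditions on `r` leading coordinates.
  let f : (I → ℝ) →ₗ[ℝ] ({j // j ≠ k} → ℝ) :=
    (Matrix.of (fun (j : {j // j ≠ k}) (i : I) => v i ⬝ᵥ z j)).mulVecLin
  have hlt : Module.finrank ℝ ({j // j ≠ k} → ℝ) < Module.finrank ℝ (I → ℝ) := by
    have := k.pos
    simp [hcard]
    omega
  obtain ⟨c, hc, hc0⟩ := Submodule.exists_mem_ne_zero_of_ne_bot
    (LinearMap.ker_ne_bot_of_finrank_lt (f := f) hlt)
  set c' : Fin d → ℝ := fun i => if hi : i ∈ I then c ⟨i, hi⟩ else 0 with hc'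
  set x : Fin d → ℝ := ∑ i ∈ I, c' i • v i with hx
  have hcoef : ∀ i, v i ⬝ᵥ x = c' i := fun i => by
    rw [hx, h.dotProduct_sum]
    by_cases hi : i ∈ I <;> simp [hi, hc']
  have hxz : ∀ j, j ≠ k → x ⬝ᵥ z j = 0 := fun j hj => by
    have h1 := congrFun (LinearMap.mem_ker.1 hc) ⟨j, hj⟩
    simp only [f, mulVecLin_apply, mulVec, dotProduct, of_apply, Pi.zero_apply] at h1
    rw [hx, sum_dotProduct, ← h1, ← Finset.sum_coe_sort I]
    refine Finset.sum_congr rfl fun i _ => ?_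
    rw [smul_dotProduct, smul_eq_mul, mul_comm]
    simp only [hc', dif_pos i.2, dotProduct]
  have hxpos : 0 < x ⬝ᵥ x := by
    refine lt_of_le_of_ne (dotProduct_self_nonneg' x) fun h0 => hc0 ?_
    have hx0 : x = 0 := dotProduct_self_eq_zero.1 h0.symm
    ext i
    have := hcoef i.1
    rw [hx0, dotProduct_zero] at this
    simpa [hc'] using this.symm
  set s := (Real.sqrt (x ⬝ᵥ x))⁻¹ with hs
  have hs2 : s ^ 2 * (x ⬝ᵥ x) = 1 := by
    rw [hs, inv_pow, Real.sq_sqrt hxpos.le, inv_mul_cancel₀ hxpos.ne']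
  have hyy : (s • x) ⬝ᵥ (s • x) = 1 := by
    rw [smul_dotProduct, dotProduct_smul, smul_eq_mul, smul_eq_mul, ← mul_assoc, ← sq, hs2]
  refine ⟨s • x, hyy, fun j hj => by rw [smul_dotProduct, hxz j hj, smul_zero], fun w => ?_⟩
  have hzero : ∀ i ∉ I, v i ⬝ᵥ (s • x) = 0 := fun i hi => by
    rw [dotProduct_smul, hcoef]; simp [hc', hi]
  have h1 : (s • x) ⬝ᵥ w = ∑ i ∈ I, (v i ⬝ᵥ (s • x)) * (v i ⬝ᵥ w) := by
    rw [h.dotProduct_eq]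
    refine (Finset.sum_subset (Finset.subset_univ I) fun i _ hi => ?_).symm
    rw [hzero i hi, zero_mul]
  have h2 : ((s • x) ⬝ᵥ w) ^ 2 ≤ ∑ i ∈ I, (v i ⬝ᵥ w) ^ 2 := by
    rw [h1]
    refine (Finset.sum_mul_sq_le_sq_mul_sq I _ _).trans ?_
    have h3 : ∑ i ∈ I, (v i ⬝ᵥ (s • x)) ^ 2 ≤ 1 := by
      rw [← hyy, h.self_eq (s • x)]
      exact Finset.sum_le_univ_sum_of_nonneg fun i => sq_nonneg _
    exact mul_le_of_le_one_left (Finset.sum_nonneg fun i _ => sq_nonneg _) h3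
  calc t₂ ^ 2 * ((s • x) ⬝ᵥ w) ^ 2 ≤ ∑ i ∈ I, t₂ ^ 2 * (v i ⬝ᵥ w) ^ 2 := by
        rw [← Finset.mul_sum]; exact mul_le_mul_of_nonneg_left h2 (sq_nonneg _)
    _ ≤ ∑ i ∈ I, lam i ^ 2 * (v i ⬝ᵥ w) ^ 2 := by
        refine Finset.sum_le_sum fun i hi => mul_le_mul_of_nonneg_right ?_ (sq_nonneg _)
        exact pow_le_pow_left₀ ht₂ (hI i hi) 2
    _ ≤ (M *ᵥ w) ⬝ᵥ (M *ᵥ w) := by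
        rw [h.mulVec_self_eq]
        exact Finset.sum_le_univ_sum_of_nonneg fun i => by positivity

end Start

/-! ### Consequences of the singular value decomposition -/

section SVD

variable {d T r : ℕ} {Θ : Matrix (Fin d) (Fin T) ℝ} {U : Matrix (Fin d) (Fin r) ℝ} {σ : Fin r → ℝ}
  {V : Matrix (Fin T) (Fin r) ℝ}

lemma sigmaMin_le (σ : Fin r → ℝ) (k : Fin r) : sigmaMin σ ≤ σ k :=
  ciInf_le (Set.finite_range σ).bddBelow k

lemma le_sigmaMax (σ : Fin r → ℝ) (k : Fin r) : σ k ≤ sigmaMax σ :=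
  le_ciSup (Set.finite_range σ).bddAbove k

lemma sigmaMin_pos (hr : 0 < r) (hσ : ∀ i, 0 < σ i) : 0 < sigmaMin σ := by
  have : Nonempty (Fin r) := ⟨⟨0, hr⟩⟩
  obtain ⟨i, hi⟩ := exists_eq_ciInf_of_finite (f := σ)
  rw [sigmaMin, ← hi]
  exact hσ i

lemma sigmaMin_le_sigmaMax (hr : 0 < r) (σ : Fin r → ℝ) : sigmaMin σ ≤ sigmaMax σ :=
  (sigmaMin_le σ ⟨0, hr⟩).trans (le_sigmaMax σ ⟨0, hr⟩)

lemma one_le_condNumber (hr : 0 < r) (hσ : ∀ i, 0 < σ i) : 1 ≤ condNumber σ := by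
  rw [condNumber, one_le_div (sigmaMin_pos hr hσ)]
  exact sigmaMin_le_sigmaMax hr σ

lemma IsReducedSVD.le_dim (h : IsReducedSVD Θ U σ V) : r ≤ d := by
  have hinj : Function.Injective U.mulVecLin := (injective_iff_map_eq_zero U.mulVecLin).2
    fun a ha => by
      rw [mulVecLin_apply] at ha
      rw [← one_mulVec a, ← h.left_orthonormal, ← mulVec_mulVec, ha, mulVec_zero]
  simpa using LinearMap.finrank_le_finrank_of_injective hinj

lemma IsReducedSVD.transpose_mulVec (h : IsReducedSVD Θ U σ V) (y : Fin d → ℝ) :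
    Θᵀ *ᵥ y = V *ᵥ (Matrix.diagonal σ *ᵥ (Uᵀ *ᵥ y)) := by
  rw [h.eq, transpose_mul, transpose_mul, transpose_transpose, diagonal_transpose, mulVec_mulVec,
    mulVec_mulVec, Matrix.mul_assoc]

lemma IsReducedSVD.transpose_mulVec_self_ge (h : IsReducedSVD Θ U σ V) (hr : 0 < r)
    (y : Fin d → ℝ) :
    sigmaMin σ ^ 2 * ((Uᵀ *ᵥ y) ⬝ᵥ (Uᵀ *ᵥ y)) ≤ (Θᵀ *ᵥ y) ⬝ᵥ (Θᵀ *ᵥ y) := by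
  rw [h.transpose_mulVec, mulVec_dotProduct_self_of_orthonormal h.right_orthonormal]
  simp only [dotProduct, mulVec_diagonal, Finset.mul_sum]
  refine Finset.sum_le_sum fun k _ => ?_
  have h1 := pow_le_pow_left₀ (sigmaMin_pos hr h.pos).le (sigmaMin_le σ k) 2
  nlinarith [mul_le_mul_of_nonneg_right h1 (sq_nonneg ((Uᵀ *ᵥ y) k))]

lemma IsReducedSVD.column_dotProduct (h : IsReducedSVD Θ U σ V) (t : Fin T) :
    (fun a => Θ a t) ⬝ᵥ (fun a => Θ a t) = ∑ k, (Matrix.diagonal σ * Vᵀ) k t ^ 2 := by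
  have h1 : (fun a => Θ a t) = U *ᵥ (fun k => (Matrix.diagonal σ * Vᵀ) k t) := by
    ext a
    rw [h.eq, Matrix.mul_assoc]; rfl
  rw [h1, mulVec_dotProduct_self_of_orthonormal h.left_orthonormal]
  simp [dotProduct, sq]

lemma IsReducedSVD.sum_column_dotProduct (h : IsReducedSVD Θ U σ V) :
    ∑ t, (fun a => Θ a t) ⬝ᵥ (fun a => Θ a t) = ∑ k, σ k ^ 2 := by
  simp only [h.column_dotProduct, diagonal_mul, transpose_apply, mul_pow]
  rw [Finset.sum_comm]
  refine Finset.sum_congr rfl fun k _ => ?_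
  have h1 := congrFun (congrFun h.right_orthonormal k) k
  rw [mul_apply, one_apply_eq] at h1
  rw [← Finset.mul_sum]
  simp only [transpose_apply, ← sq] at h1
  rw [h1, mul_one]

lemma meanMatrix_transpose_mulVec {θ : Fin T → Fin d → ℝ} {a : Fin T → ℝ} {β : Fin T → ℝ}
    (hβ : ∀ t, truncMean (θ t) (a t) = β t • θ t) (y : Fin d → ℝ) (t : Fin T) :
    ((meanMatrix θ a)ᵀ *ᵥ y) t = β t * (θ t ⬝ᵥ y) := by
  have : ((meanMatrix θ a)ᵀ *ᵥ y) t = truncMean (θ t) (a t) ⬝ᵥ y := rfl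
  rw [this, hβ, smul_dotProduct, smul_eq_mul]

/-- The mean matrix is `Θ` with columns scaled by factors at least `1/2`, so vectors orthogonal to
the range of `U` are still annihilated and squared lengths drop at most by the factor `4`. -/
lemma IsReducedSVD.meanMatrix_bounds (h : IsReducedSVD Θ U σ V) (hr : 0 < r) {a : Fin T → ℝ}
    (ha : ∀ t, 36 / 5 * ((fun b => Θ b t) ⬝ᵥ (fun b => Θ b t)) ≤ a t) (y : Fin d → ℝ) :
    (Uᵀ *ᵥ y = 0 → (meanMatrix (fun t b => Θ b t) a)ᵀ *ᵥ y = 0) ∧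
    sigmaMin σ ^ 2 / 4 * ((Uᵀ *ᵥ y) ⬝ᵥ (Uᵀ *ᵥ y))
      ≤ ((meanMatrix (fun t b => Θ b t) a)ᵀ *ᵥ y) ⬝ᵥ ((meanMatrix (fun t b => Θ b t) a)ᵀ *ᵥ y) := by
  choose β hβ1 hβ using fun t => exists_truncMean_eq (ha t)
  have hcoord := meanMatrix_transpose_mulVec (θ := fun t b => Θ b t) hβ y
  have hΘ : ∀ t, (fun b => Θ b t) ⬝ᵥ y = (Θᵀ *ᵥ y) t := fun t => rfl
  constructor
  · intro h0
    ext t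
    rw [hcoord, hΘ, h.transpose_mulVec, h0]
    simp
  · have h1 := h.transpose_mulVec_self_ge hr y
    have h2 : (Θᵀ *ᵥ y) ⬝ᵥ (Θᵀ *ᵥ y) ≤ 4 * (((meanMatrix (fun t b => Θ b t) a)ᵀ *ᵥ y) ⬝ᵥ
        ((meanMatrix (fun t b => Θ b t) a)ᵀ *ᵥ y)) := by
      simp only [dotProduct, Finset.mul_sum]
      refine Finset.sum_le_sum fun t _ => ?_
      rw [hcoord, hΘ]
      have h3 : 1 ≤ 4 * β t ^ 2 := by nlinarith [hβ1 t]
      nlinarith [mul_le_mul_of_nonneg_right h3 (sq_nonneg ((Θᵀ *ᵥ y) t))]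
    linarith

end SVD

/-! ### The leading eigenspace of the weighted Gram matrix -/

section Gram

variable {L d T n r : ℕ} {S : Fin L → Finset (Fin T)}

/-- The sample matrices of all tasks, from the family of their rows. -/
def samples (x : Fin T × Fin n → Fin d → ℝ) : Fin T → Matrix (Fin n) (Fin d) ℝ :=
  fun t => Matrix.of fun i => x (t, i)

/-- The node that holds a task. -/
noncomputable def node (hS : ∀ t, ∃! g, t ∈ S g) (t : Fin T) : Fin L := (hS t).choose

lemma mem_iff_node_eq (hS : ∀ t, ∃! g, t ∈ S g) (t : Fin T) (g : Fin L) :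
    t ∈ S g ↔ node hS t = g :=
  ⟨fun h => ((hS t).choose_spec.2 g h).symm, fun h => h ▸ (hS t).choose_spec.1⟩

lemma sum_sum_mem_eq (hS : ∀ t, ∃! g, t ∈ S g) (f : Fin L → Fin T → ℝ) :
    ∑ g, ∑ t ∈ S g, f g t = ∑ t, f (node hS t) t := by
  classical
  have h : ∀ g, ∑ t ∈ S g, f g t = ∑ t, if node hS t = g then f g t else 0 := fun g => by
    rw [← Finset.sum_filter]
    refine Finset.sum_congr ?_ fun _ _ => rfl
    ext t
    simp [mem_iff_node_eq hS]
  simp only [h]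
  rw [Finset.sum_comm]
  simp

lemma responses_samples (Θ : Matrix (Fin d) (Fin T) ℝ) (x : Fin T × Fin n → Fin d → ℝ)
    (t : Fin T) (i : Fin n) : responses Θ (samples x) t i = (fun a => Θ a t) ⬝ᵥ x (t, i) := by
  rw [dotProduct_comm]; rfl

/-- Since the local task sets partition the tasks, the node matrices assemble into one data matrix,
each task carrying the weight and threshold of its node. -/
lemma quadForm_gramMix (hS : ∀ t, ∃! g, t ∈ S g) (Θ : Matrix (Fin d) (Fin T) ℝ)
    (x : Fin T × Fin n → Fin d → ℝ) (α w : Fin L → ℝ) (y : Fin d → ℝ) :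
    y ⬝ᵥ (gramMix w (fun g => localTheta S (samples x) (responses Θ (samples x)) (α g) g) *ᵥ y)
      = ∑ t, w (node hS t) *
        ((dataMatrix (fun t a => Θ a t) (fun t => α (node hS t)) x)ᵀ *ᵥ y) t ^ 2 := by
  rw [gramMix, sum_mulVec, dotProduct_sum]
  have h : ∀ g, y ⬝ᵥ ((w g • (localTheta S (samples x) (responses Θ (samples x)) (α g) g *
      (localTheta S (samples x) (responses Θ (samples x)) (α g) g)ᵀ)) *ᵥ y)
      = ∑ t ∈ S g, w g * (∑ b, (1 / (n : ℝ) * ∑ i, x (t, i) b *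
          truncNum (α g) ((fun a => Θ a t) ⬝ᵥ x (t, i))) * y b) ^ 2 := fun g => by
    rw [smul_mulVec, dotProduct_smul, ← mulVec_mulVec, dotProduct_comm, mulVec_dotProduct_eq,
      dotProduct, smul_eq_mul, Finset.mul_sum, ← Finset.sum_coe_sort (S g)]
    refine Finset.sum_congr rfl fun t _ => ?_
    rw [← sq]
    have h2 : ((localTheta S (samples x) (responses Θ (samples x)) (α g) g)ᵀ *ᵥ y) t
        = ∑ b, (1 / (n : ℝ) * ∑ i, x (t.1, i) b *
          truncNum (α g) ((fun a => Θ a t.1) ⬝ᵥ x (t.1, i))) * y b := by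
      simp only [mulVec, dotProduct, transpose_apply, localTheta, of_apply, truncate]
      refine Finset.sum_congr rfl fun b _ => ?_
      congr 2
      refine Finset.sum_congr rfl fun i _ => ?_
      have h3 := responses_samples Θ x t.1 i
      simp only [dotProduct] at h3
      rw [h3, truncNum]
      rfl
    rw [h2]
  simp only [h]
  rw [sum_sum_mem_eq hS]
  rfl

/-- The spectral gap of the weighted Gram matrix. -/
lemma exists_leading_space {M : Matrix (Fin d) (Fin d) ℝ} (hM : M.IsHermitian)
    {U : Matrix (Fin d) (Fin r) ℝ} (hU : Uᵀ * U = 1) {Y E : Matrix (Fin d) (Fin T) ℝ}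
    {ℓ s q δ : ℝ} (hℓ : 0 < ℓ) (hs : 0 < s) (hδ0 : 0 < δ) (hδ : δ < 1)
    (hlow : ∀ y, 9 / 10 * ℓ * ((Yᵀ *ᵥ y) ⬝ᵥ (Yᵀ *ᵥ y)) ≤ y ⬝ᵥ (M *ᵥ y))
    (hupp : ∀ y, y ⬝ᵥ (M *ᵥ y) ≤ 11 / 10 * ℓ * ((Yᵀ *ᵥ y) ⬝ᵥ (Yᵀ *ᵥ y)))
    (hE0 : ∀ y, Uᵀ *ᵥ y = 0 → Eᵀ *ᵥ y = 0)
    (hE : ∀ y, s / 4 * ((Uᵀ *ᵥ y) ⬝ᵥ (Uᵀ *ᵥ y)) ≤ (Eᵀ *ᵥ y) ⬝ᵥ (Eᵀ *ᵥ y))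
    (hq : q = s * δ ^ 2 / 10000)
    (hN : ∀ y, ((Y - E)ᵀ *ᵥ y) ⬝ᵥ ((Y - E)ᵀ *ᵥ y) ≤ q * (y ⬝ᵥ y)) :
    ∃ v lam, ∃ I : Finset (Fin d), IsEigenbasis M v lam ∧ I.card = r ∧
      (∀ i ∈ I, ℓ * s / 10 ≤ lam i) ∧ (∀ i ∉ I, 0 ≤ lam i ∧ lam i ≤ ℓ * s / 5000) ∧
      ∀ y, (∀ i ∈ I, v i ⬝ᵥ y = 0) → (Uᵀ *ᵥ y) ⬝ᵥ (Uᵀ *ᵥ y) ≤ δ ^ 2 / 100 * (y ⬝ᵥ y) := by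
  obtain ⟨v, hv⟩ := exists_isEigenbasis hM
  set lam := hM.eigenvalues
  have hδ2 : δ ^ 2 < 1 := by nlinarith
  have hqs : q < s / 10000 := by rw [hq]; nlinarith
  have hq0 : 0 < q := by rw [hq]; positivity
  have hdec : ∀ y, Yᵀ *ᵥ y = Eᵀ *ᵥ y + (Y - E)ᵀ *ᵥ y := fun y => by
    rw [← add_mulVec, ← transpose_add]; simp
  have hEY : ∀ y, (Eᵀ *ᵥ y) ⬝ᵥ (Eᵀ *ᵥ y)
      ≤ 2 * ((Yᵀ *ᵥ y) ⬝ᵥ (Yᵀ *ᵥ y)) + 2 * (((Y - E)ᵀ *ᵥ y) ⬝ᵥ ((Y - E)ᵀ *ᵥ y)) := fun y => by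
    have h1 : Eᵀ *ᵥ y = Yᵀ *ᵥ y - (Y - E)ᵀ *ᵥ y := by rw [hdec]; simp
    conv_lhs => rw [h1]
    exact dotProduct_sub_self_le _ _
  -- Orthogonally to `U` only noise is seen, which gives `t₁`. On the range of `U` the form is at
  -- least `9/10 * ℓ * (s / 8 - s / 10000)` times the squared norm, which exceeds `t₂`.
  have hgap := hv.exists_spectral_gap hU (t₁ := 11 / 10 * ℓ * q) (t₂ := ℓ * s / 10)
    (by nlinarith [mul_pos hℓ hs, mul_lt_mul_of_pos_left hqs hℓ]) (fun x hx => by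
      refine (hupp x).trans ?_
      rw [hdec, hE0 x hx, zero_add, mul_assoc (11 / 10 * ℓ)]
      exact mul_le_mul_of_nonneg_left (hN x) (by positivity)) (fun c => by
      refine le_trans ?_ (hlow _)
      have h1 := hE (U *ᵥ c)
      have h2 := hEY (U *ᵥ c)
      have h3 := hN (U *ᵥ c)
      rw [mulVec_dotProduct_self_of_orthonormal hU] at h3
      rw [mulVec_mulVec, hU, one_mulVec] at h1
      have hc := dotProduct_self_nonneg' c
      have h4 : (s / 8 - s / 10000) * (c ⬝ᵥ c) ≤ (Yᵀ *ᵥ (U *ᵥ c)) ⬝ᵥ (Yᵀ *ᵥ (U *ᵥ c)) := by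
        nlinarith [mul_le_mul_of_nonneg_right hqs.le hc]
      have h5 := mul_le_mul_of_nonneg_left h4 (by positivity : 0 ≤ 9 / 10 * ℓ)
      nlinarith [mul_nonneg (mul_nonneg hℓ.le hs.le) hc])
  obtain ⟨I, hcard, hIhi, hIlo⟩ := hgap
  have hnn : ∀ i, 0 ≤ lam i := fun i => by
    have h1 := hlow (v i)
    rw [hv.eig, dotProduct_smul, hv.orth, if_pos rfl, smul_eq_mul, mul_one] at h1
    exact le_trans (mul_nonneg (by positivity) (dotProduct_self_nonneg' _)) h1
  refine ⟨v, lam, I, hv, hcard, hIhi, fun i hi => ⟨hnn i, (hIlo i hi).trans ?_⟩, fun y hy => ?_⟩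
  · nlinarith [mul_le_mul_of_nonneg_left hqs.le hℓ.le, mul_pos hℓ hs]
  · have h1 : y ⬝ᵥ (M *ᵥ y) ≤ 11 / 10 * ℓ * q * (y ⬝ᵥ y) := by
      rw [hv.quadForm_eq, hv.self_eq, Finset.mul_sum]
      refine Finset.sum_le_sum fun i _ => ?_
      by_cases hi : i ∈ I
      · simp [hy i hi]
      · exact mul_le_mul_of_nonneg_right (hIlo i hi) (sq_nonneg _)
    have h2 := (hlow y).trans h1
    have hyy := dotProduct_self_nonneg' y
    have h3 : (Yᵀ *ᵥ y) ⬝ᵥ (Yᵀ *ᵥ y) ≤ 11 / 9 * q * (y ⬝ᵥ y) := by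
      have h4 : (9 / 10 * ℓ) * ((Yᵀ *ᵥ y) ⬝ᵥ (Yᵀ *ᵥ y))
          ≤ (9 / 10 * ℓ) * (11 / 9 * q * (y ⬝ᵥ y)) := by
        refine h2.trans (le_of_eq ?_); ring
      exact le_of_mul_le_mul_left h4 (by positivity)
    have h5 := hE y
    have h6 := hEY y
    have h7 := hN y
    -- Signal plus noise is small on the trailing eigenspace, hence so is the signal: the left side
    -- is at most `4 (22/9 + 2) q (y ⬝ᵥ y)`, and `q = s δ ^ 2 / 10000`.
    have h8 : s * ((Uᵀ *ᵥ y) ⬝ᵥ (Uᵀ *ᵥ y)) ≤ s * (δ ^ 2 / 100 * (y ⬝ᵥ y)) := by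
      have h9 : q * (y ⬝ᵥ y) = s * δ ^ 2 / 10000 * (y ⬝ᵥ y) := by rw [hq]
      have h10 : 0 ≤ s * δ ^ 2 * (y ⬝ᵥ y) := by positivity
      nlinarith
    exact le_of_mul_le_mul_left h8 hs

end Gram

/-! ### Deterministic analysis of the power method -/

section Deterministic

variable {L d r : ℕ} {G : SimpleGraph (Fin L)} [DecidableRel G.Adj]
  {W : Matrix (Fin L) (Fin L) ℝ} {qr : Matrix (Fin d) (Fin r) ℝ → Matrix (Fin d) (Fin r) ℝ}

/-- If `M` has a spectral gap and the start is generic with respect to `M ^ k`, then after `k` rounds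
all nodes agree on an orthonormal basis that is close to the leading space. -/
lemma pmRound_iterate_spec [NeZero L] (hG : G.Connected) (hW : IsWeightMatrix G W)
    (hqr : IsQRRoutine qr) (hr : 0 < r) {ι : Fin L → Type*} [∀ g, Fintype (ι g)] (Tcon : ℕ)
    (Θ₀ : ∀ g, Matrix (Fin d) (ι g) ℝ) {Z U : Matrix (Fin d) (Fin r) ℝ} (hU : Uᵀ * U = 1) {k : ℕ}
    {v : Fin d → Fin d → ℝ} {lam : Fin d → ℝ} {I : Finset (Fin d)} {t₁ R ρ δ : ℝ}
    (hv : IsEigenbasis (gramMix (fun j => (W ^ Tcon) 0 j) Θ₀) v lam) (hcard : I.card = r)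
    (hlam : ∀ i ∉ I, 0 ≤ lam i ∧ lam i ≤ t₁)
    (hUI : ∀ y, (∀ i ∈ I, v i ⬝ᵥ y = 0) → (Uᵀ *ᵥ y) ⬝ᵥ (Uᵀ *ᵥ y) ≤ δ ^ 2 / 100 * (y ⬝ᵥ y))
    (hρ : 0 < ρ) (hδ0 : 0 < δ) (hδ : δ < 1)
    (hZ : ∀ a, (Z *ᵥ a) ⬝ᵥ (Z *ᵥ a) ≤ R * (a ⬝ᵥ a))
    (hMZ : ∀ a : Fin r → ℝ, a ⬝ᵥ a = 1 →
      ρ ≤ ((gramMix (fun j => (W ^ Tcon) 0 j) Θ₀ ^ k * Z) *ᵥ a) ⬝ᵥ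
        ((gramMix (fun j => (W ^ Tcon) 0 j) Θ₀ ^ k * Z) *ᵥ a))
    (hε : t₁ ^ (2 * k) * R ≤ δ ^ 2 / 8 * ρ) :
    ∃ Q : Matrix (Fin d) (Fin r) ℝ, (pmRound G W qr Tcon Θ₀)^[k] (fun _ => qr Z) = (fun _ => Q) ∧
      Qᵀ * Q = 1 ∧ subspaceDist Q U ≤ δ := by
  set M := gramMix (fun j => (W ^ Tcon) 0 j) Θ₀ with hM
  have hMZ' : ∀ a, ρ * (a ⬝ᵥ a) ≤ ((M ^ k * Z) *ᵥ a) ⬝ᵥ ((M ^ k * Z) *ᵥ a) := by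
    intro a
    rcases (dotProduct_self_nonneg' a).eq_or_lt with h0 | h0
    · rw [← h0, mul_zero]; exact dotProduct_self_nonneg' _
    · set s := (Real.sqrt (a ⬝ᵥ a))⁻¹ with hs
      have hs2 : s ^ 2 * (a ⬝ᵥ a) = 1 := by
        rw [hs, inv_pow, Real.sq_sqrt h0.le, inv_mul_cancel₀ h0.ne']
      have h1 := hMZ (s • a) (by
        rw [smul_dotProduct, dotProduct_smul, smul_eq_mul, smul_eq_mul, ← mul_assoc, ← sq, hs2])
      rw [mulVec_smul, smul_dotProduct, dotProduct_smul, smul_eq_mul, smul_eq_mul, ← mul_assoc,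
        ← sq] at h1
      calc ρ * (a ⬝ᵥ a) ≤ s ^ 2 * (((M ^ k * Z) *ᵥ a) ⬝ᵥ ((M ^ k * Z) *ᵥ a)) * (a ⬝ᵥ a) :=
            mul_le_mul_of_nonneg_right h1 h0.le
        _ = s ^ 2 * (a ⬝ᵥ a) * (((M ^ k * Z) *ᵥ a) ⬝ᵥ ((M ^ k * Z) *ᵥ a)) := by ring
        _ = _ := by rw [hs2, one_mul]
  have hinj : ∀ a, (M ^ k * Z) *ᵥ a = 0 → a = 0 := fun a ha => by
    have h1 := hMZ' a
    rw [ha, dotProduct_zero] at h1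
    have h2 := dotProduct_self_nonneg' a
    exact dotProduct_self_eq_zero.1 (by nlinarith)
  obtain ⟨Q, R', hQ, horth, hQR⟩ := pmRound_iterate hG hW hqr hr Tcon Θ₀ Z k hinj
  refine ⟨Q, hQ, horth, subspaceDist_le horth hδ0.le fun c => ?_⟩
  have hδ2 : δ ^ 2 < 1 := by nlinarith
  -- The error is `2 δ ^ 2 / 100` from the eigenspace plus `4 δ ^ 2 / 8` from stopping after
  -- finitely many rounds, below `δ ^ 2` in total.
  obtain ⟨a, ha⟩ := hv.exists_power_approx hcard hρ (by positivity : 0 ≤ δ ^ 2 / 100)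
    (by positivity : 0 ≤ δ ^ 2 / 8) hlam hZ hMZ' hε (by linarith) hUI hU c
  refine ⟨R' *ᵥ a, ?_⟩
  rw [← hM] at hQR
  rw [mulVec_mulVec, ← hQR]
  refine ha.trans (mul_le_mul_of_nonneg_right ?_ (dotProduct_self_nonneg' c))
  nlinarith [sq_nonneg δ]

end Deterministic

/-! ### Thresholds -/

section Threshold

variable {L d T n r : ℕ} {S : Fin L → Finset (Fin T)} {G : SimpleGraph (Fin L)}
  [DecidableRel G.Adj] {W : Matrix (Fin L) (Fin L) ℝ}

/-- The thresholds of all nodes as a function of the first sample. -/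
noncomputable def thresholds (G : SimpleGraph (Fin L)) [DecidableRel G.Adj]
    (W : Matrix (Fin L) (Fin L) ℝ) (S : Fin L → Finset (Fin T)) (κ μ : ℝ) (Tcon : ℕ)
    (Θ : Matrix (Fin d) (Fin T) ℝ) (x : Fin T × Fin n → Fin d → ℝ) : Fin L → ℝ :=
  agree G W Tcon (thresholdIn S κ μ (responses Θ (samples x)))

lemma thresholdIn_nonneg (S : Fin L → Finset (Fin T)) (κ μ : ℝ) (y : Fin T → Fin n → ℝ)
    (g : Fin L) : 0 ≤ thresholdIn S κ μ y g := by
  unfold thresholdIn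
  have : 0 ≤ ∑ t ∈ S g, ∑ i, y t i ^ 2 :=
    Finset.sum_nonneg fun t _ => Finset.sum_nonneg fun i _ => sq_nonneg _
  positivity

lemma sum_thresholdIn (hS : ∀ t, ∃! g, t ∈ S g) (κ μ : ℝ) (Θ : Matrix (Fin d) (Fin T) ℝ)
    (x : Fin T × Fin n → Fin d → ℝ) :
    ∑ g, thresholdIn S κ μ (responses Θ (samples x)) g
      = 9 * κ ^ 2 * μ ^ 2 * ((L : ℝ) / ((n : ℝ) * (T : ℝ))) * energy (fun t a => Θ a t) x := by
  unfold thresholdIn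
  rw [← Finset.mul_sum, sum_sum_mem_eq hS, energy, Fintype.sum_prod_type]
  simp only [responses_samples]

/-- Because the local inputs are nonnegative, entrywise relative accuracy of the weights gives
relative accuracy of the consensus value. The factor `L` in the inputs cancels the averaging. -/
lemma thresholds_bounds (hW : IsWeightMatrix G W) (hS : ∀ t, ∃! g, t ∈ S g) (κ μ : ℝ) {Tcon : ℕ}
    (hL : 0 < L)
    (hw : ∀ g j, 9 / 10 * (1 / (L : ℝ)) ≤ (W ^ Tcon) g j ∧ (W ^ Tcon) g j ≤ 11 / 10 * (1 / (L : ℝ)))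
    (Θ : Matrix (Fin d) (Fin T) ℝ) (x : Fin T × Fin n → Fin d → ℝ) (g : Fin L) :
    9 / 10 * (9 * κ ^ 2 * μ ^ 2 / ((n : ℝ) * (T : ℝ)) * energy (fun t a => Θ a t) x)
      ≤ thresholds G W S κ μ Tcon Θ x g ∧
    thresholds G W S κ μ Tcon Θ x g
      ≤ 11 / 10 * (9 * κ ^ 2 * μ ^ 2 / ((n : ℝ) * (T : ℝ)) * energy (fun t a => Θ a t) x) := by
  have hL' : (L : ℝ) ≠ 0 := Nat.cast_ne_zero.2 hL.ne'
  have hsum := sum_thresholdIn hS κ μ Θ x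
  rw [thresholds, agree_eq hW]
  set τ := thresholdIn S κ μ (responses Θ (samples x)) with hτ
  have hτ0 : ∀ j, 0 ≤ τ j := fun j => thresholdIn_nonneg _ _ _ _ _
  have hmean : 9 * κ ^ 2 * μ ^ 2 / ((n : ℝ) * (T : ℝ)) * energy (fun t a => Θ a t) x
      = 1 / (L : ℝ) * ∑ j, τ j := by
    rw [hsum]
    field_simp
  rw [hmean, ← mul_assoc, ← mul_assoc, Finset.mul_sum, Finset.mul_sum]
  exact ⟨Finset.sum_le_sum fun j _ => mul_le_mul_of_nonneg_right (hw g j).1 (hτ0 j),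
    Finset.sum_le_sum fun j _ => mul_le_mul_of_nonneg_right (hw g j).2 (hτ0 j)⟩

lemma measurable_thresholds (hW : IsWeightMatrix G W) (κ μ : ℝ) (Tcon : ℕ)
    (Θ : Matrix (Fin d) (Fin T) ℝ) :
    Measurable (thresholds (n := n) G W S κ μ Tcon Θ) := by
  refine measurable_pi_lambda _ fun g => ?_
  simp only [thresholds, agree_eq hW, thresholdIn, responses_samples, smul_eq_mul]
  refine Finset.measurable_sum _ fun j _ => Measurable.const_mul (Measurable.const_mul ?_ _) _
  exact Finset.measurable_sum _ fun t _ => Finset.measurable_sum _ fun i _ =>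
    ((measurable_dotProduct_right _).comp (measurable_pi_apply _)).pow_const 2

end Threshold

/-! ### Numerical estimates -/

section Numerics

/-- With `d ≥ 2` and `C ≥ 4`, the term `C log d` is at least `log 16`, so `γ ^ Tcon ≤ 1 / (16 L)`.
For `γ = 0` the logarithmic condition is void and `Tcon ≥ 1` does the work. -/
lemma pow_le_of_log_bound {γ κ δ C : ℝ} {L d Tcon : ℕ} (hγ0 : 0 ≤ γ) (hγ1 : γ < 1)
    (hT : 0 < Tcon) (hL : 0 < L) (hd : 2 ≤ d) (hκ : 1 ≤ κ) (hδ0 : 0 < δ) (hδ1 : δ < 1)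
    (hC : 4 ≤ C)
    (h : C * (1 / Real.log (1 / γ)) *
      (Real.log L + Real.log d + Real.log κ + Real.log (1 / δ)) ≤ Tcon) :
    γ ^ Tcon ≤ 1 / 10 * (1 / (L : ℝ)) := by
  have hLR : (0 : ℝ) < L := Nat.cast_pos.2 hL
  rcases hγ0.eq_or_lt with h0 | h0
  · rw [← h0, zero_pow hT.ne']; positivity
  have hl : 0 < Real.log (1 / γ) := Real.log_pos (by rw [lt_div_iff₀ h0]; linarith)
  have hlogL : 0 ≤ Real.log L := Real.log_natCast_nonneg L
  have hlogd : Real.log 2 ≤ Real.log d :=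
    Real.log_le_log (by norm_num) (by exact_mod_cast hd)
  have hlogκ : 0 ≤ Real.log κ := Real.log_nonneg hκ
  have hlogδ : 0 ≤ Real.log (1 / δ) := Real.log_nonneg (by rw [le_div_iff₀ hδ0]; linarith)
  have h1 : C * (Real.log L + Real.log d + Real.log κ + Real.log (1 / δ))
      ≤ Tcon * Real.log (1 / γ) := by
    have h2 := mul_le_mul_of_nonneg_right h hl.le
    calc _ = C * (1 / Real.log (1 / γ)) *
      (Real.log L + Real.log d + Real.log κ + Real.log (1 / δ)) * Real.log (1 / γ) := by
          field_simp
      _ ≤ _ := h2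
  have hlog2 : 0 < Real.log 2 := Real.log_pos (by norm_num)
  have h3 : Real.log L + Real.log 16 ≤ Tcon * Real.log (1 / γ) := by
    have h16 : Real.log 16 = 4 * Real.log 2 := by
      rw [show (16 : ℝ) = 2 ^ 4 by norm_num, Real.log_pow]; norm_num
    rw [h16]
    nlinarith
  have h4 : γ ^ Tcon = Real.exp (-(Tcon * Real.log (1 / γ))) := by
    rw [one_div, Real.log_inv, mul_neg, neg_neg, Real.exp_nat_mul, Real.exp_log h0]
  rw [h4]
  calc Real.exp (-(Tcon * Real.log (1 / γ))) ≤ Real.exp (-(Real.log L + Real.log 16)) :=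
        Real.exp_le_exp.2 (by linarith)
    _ = 1 / 16 * (1 / (L : ℝ)) := by
        rw [Real.exp_neg, Real.exp_add, Real.exp_log hLR, Real.exp_log (by norm_num)]
        field_simp
    _ ≤ _ := by gcongr; norm_num

/-- The eigenvalue levels differ by the factor `500 ≥ e`, so `2 k` powers gain at least `(d / δ) ^
24`. This beats the loss `4096 d ^ 9 / δ ^ 2` from the size of the start and its possible
degeneracy. -/
lemma power_gap_bound {d k : ℕ} (hd : 2 ≤ d) {t δ : ℝ} (hδ0 : 0 < δ) (hδ1 : δ < 1)
    (hk : 12 * Real.log (d / δ) ≤ k) :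
    (t / 5000) ^ (2 * k) * (8 * (d : ℝ) ^ 3)
      ≤ δ ^ 2 / 8 * (((t / 10) ^ k) ^ 2 * (1 / (8 * (d : ℝ) ^ 3)) ^ 2) := by
  have hdR : (2 : ℝ) ≤ d := by exact_mod_cast hd
  have hd0 : (0 : ℝ) < d := by linarith
  have hx0 : 0 < δ / d := by positivity
  have h1 : Real.exp (-(2 * k : ℝ)) ≤ (δ / d) ^ 24 := by
    have h2 : Real.log ((δ / d) ^ 24) = -(24 * Real.log (d / δ)) := by
      rw [Real.log_pow, ← inv_div, Real.log_inv]; push_cast; ring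
    rw [← Real.exp_log (pow_pos hx0 24), h2]
    exact Real.exp_le_exp.2 (by linarith)
  have h2 : (1 / 500 : ℝ) ^ (2 * k) ≤ Real.exp (-(2 * k : ℝ)) := by
    have h3 : (1 / 500 : ℝ) ≤ Real.exp (-1) := by
      rw [Real.exp_neg, ← one_div]
      have := Real.exp_one_lt_d9
      exact one_div_le_one_div_of_le (Real.exp_pos 1) (by linarith)
    calc (1 / 500 : ℝ) ^ (2 * k) ≤ Real.exp (-1) ^ (2 * k) := by gcongr
      _ = Real.exp (-(2 * k : ℝ)) := by rw [← Real.exp_nat_mul]; push_cast; congr 1; ring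
  have h4 : (δ / d) ^ 24 ≤ δ ^ 2 / (4096 * (d : ℝ) ^ 9) := by
    rw [div_pow, div_le_div_iff₀ (by positivity) (by positivity)]
    have h5 : δ ^ 24 ≤ δ ^ 2 := pow_le_pow_of_le_one hδ0.le hδ1.le (by norm_num)
    have h6 : (4096 : ℝ) ≤ (d : ℝ) ^ 15 := by
      calc (4096 : ℝ) ≤ 2 ^ 15 := by norm_num
        _ ≤ _ := by gcongr
    calc δ ^ 24 * (4096 * (d : ℝ) ^ 9) ≤ δ ^ 2 * ((d : ℝ) ^ 15 * (d : ℝ) ^ 9) := by gcongr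
      _ = δ ^ 2 * (d : ℝ) ^ 24 := by ring
  have h7 : (1 / 500 : ℝ) ^ (2 * k) ≤ δ ^ 2 / (4096 * (d : ℝ) ^ 9) := h2.trans (h1.trans h4)
  have h8 : (t / 5000) ^ (2 * k) = (1 / 500 : ℝ) ^ (2 * k) * ((t / 10) ^ k) ^ 2 := by
    rw [← pow_mul, mul_comm k 2, ← mul_pow]; congr 1; ring
  rw [h8]
  calc (1 / 500 : ℝ) ^ (2 * k) * ((t / 10) ^ k) ^ 2 * (8 * (d : ℝ) ^ 3)
      ≤ δ ^ 2 / (4096 * (d : ℝ) ^ 9) * ((t / 10) ^ k) ^ 2 * (8 * (d : ℝ) ^ 3) := by gcongr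
    _ = _ := by field_simp; ring

lemma net_union_bound {d T : ℕ} {e : ℝ} (he : 5 * ((d : ℝ) + T) ≤ e) (hd : 0 < d) (hT : 0 < T) :
    5 ^ d * (5 ^ T * (2 * Real.exp (-e))) ≤ 1 / (4 * (d : ℝ)) := by
  have hdR : (0 : ℝ) < d := Nat.cast_pos.2 hd
  have hTR : (1 : ℝ) ≤ T := by exact_mod_cast hT
  have h5 : (5 : ℝ) ≤ Real.exp 2 := by
    have := Real.quadratic_le_exp_of_nonneg (x := 2) (by norm_num)
    linarith
  have hpow : ∀ m : ℕ, (5 : ℝ) ^ m ≤ Real.exp (2 * m) := fun m => by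
    calc (5 : ℝ) ^ m ≤ Real.exp 2 ^ m := by gcongr
      _ = _ := by rw [← Real.exp_nat_mul, mul_comm]
  calc (5 : ℝ) ^ d * (5 ^ T * (2 * Real.exp (-e)))
      ≤ Real.exp (2 * d) * (Real.exp (2 * T) * (2 * Real.exp (-(5 * ((d : ℝ) + T))))) := by
        have h3 := hpow d
        have h4 := hpow T
        have : Real.exp (-e) ≤ Real.exp (-(5 * ((d : ℝ) + T))) := Real.exp_le_exp.2 (by linarith)
        gcongr
    _ = 2 * Real.exp (-(3 * ((d : ℝ) + T))) := by
        rw [mul_left_comm (Real.exp (2 * T)), mul_left_comm (Real.exp (2 * d)), ← Real.exp_add,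
          ← Real.exp_add]
        congr 2; ring
    _ ≤ 2 * Real.exp (-(3 * d + 3)) := by gcongr; linarith
    _ ≤ 1 / (4 * (d : ℝ)) := by
        rw [Real.exp_neg, ← div_eq_mul_inv, div_le_div_iff₀ (Real.exp_pos _) (by positivity),
          Real.exp_add]
        have h3 : (8 : ℝ) ≤ Real.exp 3 := by
          have := Real.quadratic_le_exp_of_nonneg (x := 3) (by norm_num)
          linarith
        have h4 : (d : ℝ) ≤ Real.exp (3 * d) := by
          have := Real.add_one_le_exp (3 * (d : ℝ))
          linarith
        calc (2 : ℝ) * (4 * d) = d * 8 := by ring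
          _ ≤ Real.exp (3 * d) * Real.exp 3 := by gcongr
          _ = _ := by ring

end Numerics

/-! ### Measurability of the algorithm -/

section Measurability

variable {α : Type*} [MeasurableSpace α] {m k l : ℕ}

lemma measurable_matrix_mul {A : α → Matrix (Fin m) (Fin k) ℝ} {B : α → Matrix (Fin k) (Fin l) ℝ}
    (hA : ∀ i j, Measurable fun x => A x i j) (hB : ∀ i j, Measurable fun x => B x i j) (i : Fin m)
    (j : Fin l) : Measurable fun x => (A x * B x) i j := by
  simp only [mul_apply]
  exact Finset.measurable_sum _ fun c _ => (hA i c).mul (hB c j)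

lemma measurable_matrix_pow {A : α → Matrix (Fin m) (Fin m) ℝ}
    (hA : ∀ i j, Measurable fun x => A x i j) (p : ℕ) (i j : Fin m) :
    Measurable fun x => (A x ^ p) i j := by
  induction p generalizing i j with
  | zero => simp only [pow_zero]; exact measurable_const
  | succ p ih => simp only [pow_succ]; exact measurable_matrix_mul ih hA i j

variable {L d T n r : ℕ} {S : Fin L → Finset (Fin T)} {G : SimpleGraph (Fin L)}
  [DecidableRel G.Adj] {W : Matrix (Fin L) (Fin L) ℝ}

lemma measurable_dataMatrix {θ : Fin T → Fin d → ℝ} {a : α → Fin T → ℝ} (ha : Measurable a)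
    {x : α → Fin T × Fin n → Fin d → ℝ} (hx : Measurable x) (b : Fin d) (t : Fin T) :
    Measurable fun q => dataMatrix θ (a q) (x q) b t := by
  simp only [dataMatrix, of_apply]
  refine Measurable.const_mul (Finset.measurable_sum _ fun i _ => ?_) _
  have h1 : Measurable fun q => x q (t, i) := (measurable_pi_apply _).comp hx
  exact ((measurable_pi_apply b).comp h1).mul (measurable_truncNum.comp
    (((measurable_pi_apply t).comp ha).prodMk ((measurable_dotProduct_right (θ t)).comp h1)))

lemma measurable_meanMatrix {θ : Fin T → Fin d → ℝ} {a : α → Fin T → ℝ} (ha : Measurable a)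
    (b : Fin d) (t : Fin T) : Measurable fun q => meanMatrix θ (a q) b t := by
  simp only [meanMatrix, of_apply]
  exact (measurable_pi_apply b).comp ((measurable_truncMean (θ t)).comp
    ((measurable_pi_apply t).comp ha))

lemma measurable_gramMix_localTheta (w : Fin L → ℝ) (Θ : Matrix (Fin d) (Fin T) ℝ)
    {a : α → Fin L → ℝ} (ha : Measurable a) {x : α → Fin T × Fin n → Fin d → ℝ}
    (hx : Measurable x) (i j : Fin d) :
    Measurable fun q => gramMix w (fun g => localTheta S (samples (x q))
      (responses Θ (samples (x q))) (a q g) g) i j := by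
  have hloc : ∀ g (b : Fin d) (t : {t // t ∈ S g}), Measurable fun q =>
      localTheta S (samples (x q)) (responses Θ (samples (x q))) (a q g) g b t := by
    intro g b t
    have h : ∀ q, localTheta S (samples (x q)) (responses Θ (samples (x q))) (a q g) g b t
        = dataMatrix (fun t a => Θ a t) (fun _ => a q g) (x q) b t := fun q => by
      simp only [localTheta, of_apply, dataMatrix, mulVec, dotProduct, transpose_apply, truncate]
      congr 1
      refine Finset.sum_congr rfl fun i _ => ?_
      have h3 := responses_samples Θ (x q) t.1 i
      simp only [dotProduct] at h3
      rw [h3, truncNum]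
      rfl
    simp only [h]
    exact measurable_dataMatrix
      (measurable_pi_lambda _ fun _ => (measurable_pi_apply g).comp ha) hx b t.1
  simp only [gramMix, Matrix.sum_apply, Matrix.smul_apply, mul_apply, transpose_apply, smul_eq_mul]
  exact Finset.measurable_sum _ fun g _ => Measurable.const_mul
    (Finset.measurable_sum _ fun t _ => (hloc g i t).mul (hloc g j t)) _

end Measurability

/-! ### Sample size -/

section SampleSize

variable {d T n r : ℕ} {κ μ δ smin F : ℝ}

lemma pos_of_sample_bound (hr : 0 < r) (hd : 0 < d) (hκ : 1 ≤ κ) (hμ : 1 < μ) (hδ : 0 < δ)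
    (h : (10 : ℝ) ^ 10 * (κ ^ 4 * μ ^ 2 * ((d : ℝ) + T) * (r / δ ^ 2)) ≤ (n : ℝ) * T) :
    0 < n ∧ 0 < T := by
  have hrR : (0 : ℝ) < r := Nat.cast_pos.2 hr
  have hdR : (0 : ℝ) < d := Nat.cast_pos.2 hd
  have h1 : 0 < (n : ℝ) * T := lt_of_lt_of_le (by positivity) h
  have h2 : 0 < n * T := by exact_mod_cast h1
  exact ⟨Nat.pos_of_mul_pos_right h2, Nat.pos_of_mul_pos_left h2⟩

lemma energy_failure_bound (hr : 0 < r) (hd : 0 < d) (hn : 0 < n) (hT : 0 < T) (hκ : 1 ≤ κ)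
    (hμ : 1 < μ) (hδ0 : 0 < δ) (hδ1 : δ < 1) (hs : 0 < smin) (hF : r * smin ^ 2 ≤ F)
    (h : (10 : ℝ) ^ 10 * (κ ^ 4 * μ ^ 2 * ((d : ℝ) + T) * (r / δ ^ 2)) ≤ (n : ℝ) * T) :
    360 * (μ ^ 2 * ((r : ℝ) / T) * (κ * smin) ^ 2) / (n * F) ≤ 1 / (4 * (d : ℝ)) := by
  have hrR : (1 : ℝ) ≤ r := by exact_mod_cast hr
  have hdR : (0 : ℝ) < d := Nat.cast_pos.2 hd
  have hnR : (0 : ℝ) < n := Nat.cast_pos.2 hn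
  have hTR : (0 : ℝ) < T := Nat.cast_pos.2 hT
  have hF0 : 0 < F := lt_of_lt_of_le (by positivity) hF
  have h1 : κ ^ 2 * μ ^ 2 * d ≤ κ ^ 4 * μ ^ 2 * ((d : ℝ) + T) * (r / δ ^ 2) := by
    have h2 : 1 ≤ (r : ℝ) / δ ^ 2 := by
      rw [le_div_iff₀ (by positivity)]; nlinarith
    have h3 : κ ^ 2 ≤ κ ^ 4 := pow_le_pow_right₀ hκ (by norm_num)
    calc κ ^ 2 * μ ^ 2 * d = κ ^ 2 * μ ^ 2 * d * 1 := by ring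
      _ ≤ κ ^ 4 * μ ^ 2 * ((d : ℝ) + T) * (r / δ ^ 2) := by
        gcongr
        linarith
  have h4 : 1440 * (κ ^ 2 * μ ^ 2 * d) ≤ (n : ℝ) * T := by
    have : 0 ≤ κ ^ 2 * μ ^ 2 * d := by positivity
    nlinarith
  rw [div_le_div_iff₀ (by positivity) (by positivity)]
  calc 360 * (μ ^ 2 * ((r : ℝ) / T) * (κ * smin) ^ 2) * (4 * d)
      = 1440 * (κ ^ 2 * μ ^ 2 * d) * (r * smin ^ 2 / T) := by ring
    _ ≤ (n : ℝ) * T * (F / T) := by gcongr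
    _ = 1 * (n * F) := by field_simp

/-- The condition that governs the sample size: `κ ^ 4` is `κ ^ 2` from the threshold times `κ ^ 2`
from incoherence relative to `σ_max`. It needs the constant `6600 * 160000`, about `10 ^ 9`, the
largest demand made on `C`. -/
lemma noise_exponent_bound (hr : 0 < r) (hT : 0 < T) (hκ : 1 ≤ κ) (hμ : 1 < μ)
    (hδ0 : 0 < δ) (hs : 0 < smin)
    (h : (10 : ℝ) ^ 10 * (κ ^ 4 * μ ^ 2 * ((d : ℝ) + T) * (r / δ ^ 2)) ≤ (n : ℝ) * T) :
    5 * ((d : ℝ) + T) ≤ (smin * δ / 400) ^ 2 * n /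
      (120 * (11 * κ ^ 2 * (μ ^ 2 * ((r : ℝ) / T) * (κ * smin) ^ 2))) := by
  have hrR : (0 : ℝ) < r := by exact_mod_cast hr
  have hTR : (0 : ℝ) < T := Nat.cast_pos.2 hT
  have h0 : 0 ≤ κ ^ 4 * μ ^ 2 * ((d : ℝ) + T) * (r / δ ^ 2) := by positivity
  rw [le_div_iff₀ (by positivity)]
  calc 5 * ((d : ℝ) + T) * (120 * (11 * κ ^ 2 * (μ ^ 2 * ((r : ℝ) / T) * (κ * smin) ^ 2)))
      = 6600 * (κ ^ 4 * μ ^ 2 * ((d : ℝ) + T) * (r / δ ^ 2)) * (smin ^ 2 * δ ^ 2 / T) := by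
        field_simp; ring
    _ ≤ (n * T / 160000) * (smin ^ 2 * δ ^ 2 / T) := by
        gcongr
        linarith
    _ = (smin * δ / 400) ^ 2 * n := by field_simp; ring

/-- One ten-percent error comes from consensus and one from the energy: `9 (9/10)² = 7.29 ≥ 36/5`
and `9 (11/10)² = 10.89 ≤ 11`. -/
lemma level_bounds {τ e : ℝ} (hn : 0 < n) (hT : 0 < T) (hκ : 1 ≤ κ) (hF : r * smin ^ 2 ≤ F)
    (hF' : F ≤ r * (κ * smin) ^ 2) (he : |e - n * F| < n * F / 10)
    (h₁ : 9 / 10 * (9 * κ ^ 2 * μ ^ 2 / ((n : ℝ) * (T : ℝ)) * e) ≤ τ)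
    (h₂ : τ ≤ 11 / 10 * (9 * κ ^ 2 * μ ^ 2 / ((n : ℝ) * (T : ℝ)) * e)) :
    36 / 5 * (μ ^ 2 * ((r : ℝ) / T) * (κ * smin) ^ 2) ≤ τ ∧
      τ ≤ 11 * κ ^ 2 * (μ ^ 2 * ((r : ℝ) / T) * (κ * smin) ^ 2) := by
  have hnR : (0 : ℝ) < n := Nat.cast_pos.2 hn
  have hTR : (0 : ℝ) < T := Nat.cast_pos.2 hT
  obtain ⟨h3, h4⟩ := abs_lt.1 he
  constructor
  · calc 36 / 5 * (μ ^ 2 * ((r : ℝ) / T) * (κ * smin) ^ 2)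
        = 36 / 5 * (κ ^ 2 * μ ^ 2 / T) * (r * smin ^ 2) := by ring
      _ ≤ 36 / 5 * (κ ^ 2 * μ ^ 2 / T) * F := by gcongr
      _ ≤ 729 / 100 * (κ ^ 2 * μ ^ 2 / T) * F := by
          have h5 : 0 ≤ F := by nlinarith [sq_nonneg smin, Nat.cast_nonneg (α := ℝ) r]
          have h6 : 0 ≤ κ ^ 2 * μ ^ 2 / T * F := by positivity
          linarith
      _ = 9 / 10 * (9 * κ ^ 2 * μ ^ 2 / ((n : ℝ) * T) * (9 / 10 * (n * F))) := by
          field_simp; ring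
      _ ≤ 9 / 10 * (9 * κ ^ 2 * μ ^ 2 / ((n : ℝ) * T) * e) := by gcongr; linarith
      _ ≤ τ := h₁
  · calc τ ≤ 11 / 10 * (9 * κ ^ 2 * μ ^ 2 / ((n : ℝ) * T) * e) := h₂
      _ ≤ 11 / 10 * (9 * κ ^ 2 * μ ^ 2 / ((n : ℝ) * T) * (11 / 10 * (n * F))) := by
          gcongr; linarith
      _ = 1089 / 100 * (κ ^ 2 * μ ^ 2 / T) * F := by field_simp; ring
      _ ≤ 11 * (κ ^ 2 * μ ^ 2 / T) * (r * (κ * smin) ^ 2) := by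
          have : 0 ≤ F := by nlinarith [sq_nonneg smin, Nat.cast_nonneg (α := ℝ) r]
          gcongr; norm_num
      _ = 11 * κ ^ 2 * (μ ^ 2 * ((r : ℝ) / T) * (κ * smin) ^ 2) := by ring

end SampleSize

/-! ### The exceptional set -/

section Exceptional

variable {L d T n r : ℕ} {Θ : Matrix (Fin d) (Fin T) ℝ} {U : Matrix (Fin d) (Fin r) ℝ}
  {σ : Fin r → ℝ} {V : Matrix (Fin T) (Fin r) ℝ} {μ δ : ℝ} {S : Fin L → Finset (Fin T)}
  {G : SimpleGraph (Fin L)} [DecidableRel G.Adj] {W : Matrix (Fin L) (Fin L) ℝ}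

/-- The matrix whose powers node `0` applies to the start, as a function of the two samples. -/
noncomputable def mixedGram [NeZero L] (G : SimpleGraph (Fin L)) [DecidableRel G.Adj]
    (W : Matrix (Fin L) (Fin L) ℝ) (S : Fin L → Finset (Fin T)) (κ μ : ℝ) (Tcon : ℕ)
    (Θ : Matrix (Fin d) (Fin T) ℝ)
    (q : (Fin T × Fin n → Fin d → ℝ) × (Fin T × Fin n → Fin d → ℝ)) : Matrix (Fin d) (Fin d) ℝ :=
  gramMix (fun j => (W ^ Tcon) 0 j) (fun g => localTheta S (samples q.2)
    (responses Θ (samples q.2)) (thresholds G W S κ μ Tcon Θ q.1 g) g)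

/-- The noise of the second sample at the truncation levels given by the first. -/
noncomputable def noise (G : SimpleGraph (Fin L)) [DecidableRel G.Adj]
    (W : Matrix (Fin L) (Fin L) ℝ) (hS : ∀ t, ∃! g, t ∈ S g) (κ μ : ℝ) (Tcon : ℕ)
    (Θ : Matrix (Fin d) (Fin T) ℝ)
    (q : (Fin T × Fin n → Fin d → ℝ) × (Fin T × Fin n → Fin d → ℝ)) : Matrix (Fin d) (Fin T) ℝ :=
  dataMatrix (fun t a => Θ a t) (fun t => thresholds G W S κ μ Tcon Θ q.1 (node hS t)) q.2
    - meanMatrix (fun t a => Θ a t) (fun t => thresholds G W S κ μ Tcon Θ q.1 (node hS t))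

lemma condNumber_mul_sigmaMin (hr : 0 < r) (hσ : ∀ i, 0 < σ i) :
    condNumber σ * sigmaMin σ = sigmaMax σ := by
  rw [condNumber, div_mul_cancel₀ _ (sigmaMin_pos hr hσ).ne']

lemma sum_sq_bounds (hr : 0 < r) (hσ : ∀ i, 0 < σ i) :
    r * sigmaMin σ ^ 2 ≤ ∑ k, σ k ^ 2 ∧ ∑ k, σ k ^ 2 ≤ r * (condNumber σ * sigmaMin σ) ^ 2 := by
  rw [condNumber_mul_sigmaMin hr hσ]
  constructor
  · have h := Finset.card_nsmul_le_sum Finset.univ (fun k => σ k ^ 2) (sigmaMin σ ^ 2)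
      fun k _ => pow_le_pow_left₀ (sigmaMin_pos hr hσ).le (sigmaMin_le σ k) 2
    simpa using h
  · have h := Finset.sum_le_card_nsmul Finset.univ (fun k => σ k ^ 2) (sigmaMax σ ^ 2)
      fun k _ => pow_le_pow_left₀ (hσ k).le (le_sigmaMax σ k) 2
    simpa using h

/-- The net level `σ_min δ / 400` becomes `16 (σ_min δ / 400)² = σ_min² δ² / 10000`, the noise level
`q` that `exists_leading_space` allows. -/
lemma mixedGram_leading_space [NeZero L] (hr : 0 < r) (hΘ : IsReducedSVD Θ U σ V)
    (hS : ∀ t, ∃! g, t ∈ S g) {Tcon : ℕ}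
    (hw : ∀ g j, 9 / 10 * (1 / (L : ℝ)) ≤ (W ^ Tcon) g j ∧ (W ^ Tcon) g j ≤ 11 / 10 * (1 / (L : ℝ)))
    (hδ0 : 0 < δ) (hδ1 : δ < 1)
    {q : (Fin T × Fin n → Fin d → ℝ) × (Fin T × Fin n → Fin d → ℝ)}
    (hlevel : ∀ t g, 36 / 5 * ((fun a => Θ a t) ⬝ᵥ (fun a => Θ a t))
      ≤ thresholds G W S (condNumber σ) μ Tcon Θ q.1 g)
    (hnoise : ∀ u ∈ net d, ∀ v ∈ net T,
      |u ⬝ᵥ (noise G W hS (condNumber σ) μ Tcon Θ q *ᵥ v)| ≤ sigmaMin σ * δ / 400) :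
    ∃ v lam, ∃ I : Finset (Fin d),
      IsEigenbasis (mixedGram G W S (condNumber σ) μ Tcon Θ q) v lam ∧ I.card = r ∧
      (∀ i ∈ I, 1 / (L : ℝ) * sigmaMin σ ^ 2 / 10 ≤ lam i) ∧
      (∀ i ∉ I, 0 ≤ lam i ∧ lam i ≤ 1 / (L : ℝ) * sigmaMin σ ^ 2 / 5000) ∧
      ∀ y, (∀ i ∈ I, v i ⬝ᵥ y = 0) → (Uᵀ *ᵥ y) ⬝ᵥ (Uᵀ *ᵥ y) ≤ δ ^ 2 / 100 * (y ⬝ᵥ y) := by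
  have hLR : (0 : ℝ) < L := Nat.cast_pos.2 (Nat.pos_of_ne_zero (NeZero.ne L))
  have hs := sigmaMin_pos hr hΘ.pos
  set a : Fin T → ℝ := fun t => thresholds G W S (condNumber σ) μ Tcon Θ q.1 (node hS t) with ha
  have hmean := hΘ.meanMatrix_bounds hr (a := a) fun t => hlevel t _
  refine exists_leading_space (M := mixedGram G W S (condNumber σ) μ Tcon Θ q)
    (gramMix_isHermitian _ _) hΘ.left_orthonormal
    (Y := dataMatrix (fun t a => Θ a t) a q.2) (E := meanMatrix (fun t a => Θ a t) a)
    (q := sigmaMin σ ^ 2 * δ ^ 2 / 10000) (by positivity) (by positivity) hδ0 hδ1 ?_ ?_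
    (fun y => (hmean y).1) (fun y => (hmean y).2) rfl ?_
  · intro y
    rw [mixedGram, quadForm_gramMix hS, dotProduct, Finset.mul_sum]
    refine Finset.sum_le_sum fun t _ => ?_
    rw [← sq]
    exact mul_le_mul_of_nonneg_right (hw _ _).1 (sq_nonneg _)
  · intro y
    rw [mixedGram, quadForm_gramMix hS, dotProduct, Finset.mul_sum]
    refine Finset.sum_le_sum fun t _ => ?_
    rw [← sq]
    exact mul_le_mul_of_nonneg_right (hw _ _).2 (sq_nonneg _)
  · intro y
    refine (dotProduct_transpose_mulVec_le_of_net hnoise y).trans (le_of_eq ?_)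
    ring

lemma measurable_mixedGram [NeZero L] (hW : IsWeightMatrix G W) (κ μ : ℝ) (Tcon : ℕ)
    (Θ : Matrix (Fin d) (Fin T) ℝ) (i j : Fin d) :
    Measurable fun q => mixedGram (n := n) G W S κ μ Tcon Θ q i j :=
  measurable_gramMix_localTheta _ Θ ((measurable_thresholds hW κ μ Tcon Θ).comp measurable_fst)
    measurable_snd i j

lemma measurable_noise (hW : IsWeightMatrix G W) (hS : ∀ t, ∃! g, t ∈ S g) (κ μ : ℝ) (Tcon : ℕ)
    (Θ : Matrix (Fin d) (Fin T) ℝ) (b : Fin d) (t : Fin T) :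
    Measurable fun q => noise (n := n) G W hS κ μ Tcon Θ q b t := by
  have ha : Measurable fun q : (Fin T × Fin n → Fin d → ℝ) × (Fin T × Fin n → Fin d → ℝ) =>
      fun t => thresholds G W S κ μ Tcon Θ q.1 (node hS t) :=
    measurable_pi_lambda _ fun t => (measurable_pi_apply (node hS t)).comp
      ((measurable_thresholds hW κ μ Tcon Θ).comp measurable_fst)
  exact (measurable_dataMatrix ha measurable_snd b t).sub (measurable_meanMatrix ha b t)

lemma measurableSet_noise (hW : IsWeightMatrix G W) (hS : ∀ t, ∃! g, t ∈ S g) (κ μ : ℝ) (Tcon : ℕ)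
    (Θ : Matrix (Fin d) (Fin T) ℝ) (ε : ℝ) :
    MeasurableSet {q | ∃ u ∈ net d, ∃ v ∈ net T,
      ε ≤ |u ⬝ᵥ (noise (n := n) G W hS κ μ Tcon Θ q *ᵥ v)|} := by
  have hset : {q | ∃ u ∈ net d, ∃ v ∈ net T,
      ε ≤ |u ⬝ᵥ (noise (n := n) G W hS κ μ Tcon Θ q *ᵥ v)|}
      = ⋃ u ∈ net d, ⋃ v ∈ net T, {q | ε ≤ |u ⬝ᵥ (noise (n := n) G W hS κ μ Tcon Θ q *ᵥ v)|} := by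
    ext q; simp
  rw [hset]
  refine Finset.measurableSet_biUnion _ fun u _ => Finset.measurableSet_biUnion _ fun v _ =>
    measurableSet_le measurable_const ?_
  refine measurable_norm.comp (f := fun q => u ⬝ᵥ (noise (n := n) G W hS κ μ Tcon Θ q *ᵥ v)) ?_
  simp only [dotProduct, mulVec]
  exact Finset.measurable_sum _ fun b _ => Measurable.const_mul (Finset.measurable_sum _
    fun t _ => (measurable_noise hW hS κ μ Tcon Θ b t).mul_const _) _

lemma measurableSet_degenerate_start [NeZero L] (hW : IsWeightMatrix G W) (κ μ : ℝ) (Tcon k : ℕ)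
    (Θ : Matrix (Fin d) (Fin T) ℝ) (c : ℝ) :
    MeasurableSet {p : ((Fin T × Fin n → Fin d → ℝ) × (Fin T × Fin n → Fin d → ℝ)) ×
        (Fin r → Fin d → ℝ) | ∃ a ∈ {a : Fin r → ℝ | a ⬝ᵥ a = 1},
      ((mixedGram G W S κ μ Tcon Θ p.1 ^ k * ofColumns p.2) *ᵥ a) ⬝ᵥ
        ((mixedGram G W S κ μ Tcon Θ p.1 ^ k * ofColumns p.2) *ᵥ a) ≤ c} := by
  have hmeas : Measurable fun p : ((Fin T × Fin n → Fin d → ℝ) × (Fin T × Fin n → Fin d → ℝ)) ×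
      (Fin r → Fin d → ℝ) => fun (i : Fin d) (j : Fin r) =>
      (mixedGram G W S κ μ Tcon Θ p.1 ^ k * ofColumns p.2) i j := by
    refine measurable_pi_lambda _ fun i => measurable_pi_lambda _ fun j =>
      measurable_matrix_mul (measurable_matrix_pow (fun i j =>
        (measurable_mixedGram hW κ μ Tcon Θ i j).comp measurable_fst) k) (fun i j => ?_) i j
    exact (measurable_pi_apply i).comp ((measurable_pi_apply j).comp measurable_snd)
  exact (isClosed_exists_mulVec_le (isCompact_sphere_dotProduct r) c).measurableSet.preimage hmeas

/-- The union bound for events that depend on more and more of three independent samples. -/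
lemma measure_exceptional_le {α β γ : Type*} [MeasurableSpace α] [MeasurableSpace β]
    [MeasurableSpace γ] {P : Measure α} {P' : Measure β} {P'' : Measure γ} [IsProbabilityMeasure P]
    [IsProbabilityMeasure P'] [IsProbabilityMeasure P''] {A : Set α} {B : Set (α × β)}
    {C : Set ((α × β) × γ)} {D : Set γ} (hA : MeasurableSet A) (hB : MeasurableSet B)
    (hD : MeasurableSet D) {x : ℝ} (hx : 0 < x) (hA' : P A ≤ ENNReal.ofReal (1 / (4 * x)))
    (hB' : P.prod P' B ≤ ENNReal.ofReal (1 / (4 * x)))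
    (hC' : (P.prod P').prod P'' C ≤ ENNReal.ofReal (1 / (8 * x)))
    (hD' : P'' D ≤ ENNReal.ofReal (1 / (8 * x))) :
    (P.prod P').prod P'' (((Prod.fst ⁻¹' (Prod.fst ⁻¹' A) ∪ Prod.fst ⁻¹' B) ∪ C) ∪ Prod.snd ⁻¹' D)
      ≤ ENNReal.ofReal (1 / x) := by
  have h1 : (P.prod P').prod P'' (Prod.fst ⁻¹' (Prod.fst ⁻¹' A)) = P A := by
    rw [measurePreserving_fst.measure_preimage (hA.preimage measurable_fst).nullMeasurableSet,
      measurePreserving_fst.measure_preimage hA.nullMeasurableSet]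
  have h2 : (P.prod P').prod P'' (Prod.fst ⁻¹' B) = P.prod P' B :=
    measurePreserving_fst.measure_preimage hB.nullMeasurableSet
  have h3 : (P.prod P').prod P'' (Prod.snd ⁻¹' D) = P'' D :=
    measurePreserving_snd.measure_preimage hD.nullMeasurableSet
  refine (measure_union_le _ _).trans ((add_le_add ((measure_union_le _ _).trans
    (add_le_add ((measure_union_le _ _).trans (add_le_add (h1.trans_le hA') (h2.trans_le hB')))
      hC')) (h3.trans_le hD')).trans ?_)
  rw [← ENNReal.ofReal_add (by positivity) (by positivity),
    ← ENNReal.ofReal_add (by positivity) (by positivity),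
    ← ENNReal.ofReal_add (by positivity) (by positivity)]
  refine ENNReal.ofReal_le_ofReal ?_
  have h : 1 / x - (1 / (4 * x) + 1 / (4 * x) + 1 / (8 * x) + 1 / (8 * x)) = 1 / (4 * x) := by
    field_simp; norm_num
  rw [← sub_nonneg, h]
  positivity

/-- Outside an exceptional set of probability at most `1 / d`, the nodes agree on an accurate
orthonormal basis. -/
lemma exists_exceptional_set [NeZero L] (hr : 0 < r) (hd : 2 ≤ d) (hΘ : IsReducedSVD Θ U σ V)
    (hμ : 1 < μ) (hinc : Incoherent σ V μ) (hG : G.Connected) (hW : IsWeightMatrix G W)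
    (hγ : connectivity W hW.hermitian < 1) (hS : ∀ t, ∃! g, t ∈ S g)
    {qr : Matrix (Fin d) (Fin r) ℝ → Matrix (Fin d) (Fin r) ℝ} (hqr : IsQRRoutine qr)
    (hδ0 : 0 < δ) (hδ1 : δ < 1) {Tcon Tpm : ℕ} (hTcon : 0 < Tcon)
    (hcon : (10 : ℝ) ^ 10 * (1 / Real.log (1 / connectivity W hW.hermitian)) *
      (Real.log L + Real.log d + Real.log (condNumber σ) + Real.log (1 / δ)) ≤ Tcon)
    (hpm : (10 : ℝ) ^ 10 * condNumber σ ^ 2 * Real.log (d / δ) ≤ Tpm)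
    (hnT : (10 : ℝ) ^ 10 * (condNumber σ ^ 4 * μ ^ 2 * ((d : ℝ) + T) * (r / δ ^ 2))
      ≤ (n : ℝ) * T) :
    ∃ B : Set (((Fin T × Fin n → Fin d → ℝ) × (Fin T × Fin n → Fin d → ℝ)) ×
        (Fin r → Fin d → ℝ)), MeasurableSet B ∧
      ((sampleLaw T n d).prod (sampleLaw T n d)).prod (startLaw r d) B
        ≤ ENNReal.ofReal (1 / (d : ℝ)) ∧
      ∀ p ∉ B, ∃ Q : Matrix (Fin d) (Fin r) ℝ,
        spectralInit G W qr S (condNumber σ) μ Tcon Tpm (responses Θ (samples p.1.1))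
          (samples p.1.2) (responses Θ (samples p.1.2)) (ofColumns p.2) = (fun _ => Q) ∧
        Qᵀ * Q = 1 ∧ subspaceDist Q U ≤ δ := by
  have hL : 0 < L := Nat.pos_of_ne_zero (NeZero.ne L)
  have hLR : (0 : ℝ) < L := Nat.cast_pos.2 hL
  have hd0 : 0 < d := by omega
  have hdR : (2 : ℝ) ≤ d := by exact_mod_cast hd
  have hs := sigmaMin_pos hr hΘ.pos
  have hκ := one_le_condNumber hr hΘ.pos
  obtain ⟨hn, hT⟩ := pos_of_sample_bound hr hd0 hκ hμ hδ0 hnT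
  set κ := condNumber σ with hκdef
  set s := sigmaMin σ with hsdef
  have hmax : κ * s = sigmaMax σ := condNumber_mul_sigmaMin hr hΘ.pos
  set θ : Fin T → Fin d → ℝ := fun t a => Θ a t with hθ
  set F := ∑ t, θ t ⬝ᵥ θ t with hF
  set ω := μ ^ 2 * ((r : ℝ) / T) * (κ * s) ^ 2 with hω
  have hω0 : 0 ≤ ω := by positivity
  have hcol : ∀ t, θ t ⬝ᵥ θ t ≤ ω := fun t => by
    rw [hω, hmax]
    exact (hΘ.column_dotProduct t).trans_le (hinc t)
  obtain ⟨hFlo, hFhi⟩ := sum_sq_bounds hr hΘ.pos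
  rw [← hΘ.sum_column_dotProduct] at hFlo hFhi
  have hFpos : 0 < F := lt_of_lt_of_le (by positivity) hFlo
  have hw : ∀ g j, 9 / 10 * (1 / (L : ℝ)) ≤ (W ^ Tcon) g j ∧
      (W ^ Tcon) g j ≤ 11 / 10 * (1 / (L : ℝ)) := fun g j => by
    have h1 := abs_pow_sub_le hW hγ Tcon g j
    have h2 := pow_le_of_log_bound (connectivity_nonneg _) hγ hTcon hL hd hκ hδ0 hδ1
      (by norm_num) hcon
    obtain ⟨h3, h4⟩ := abs_le.1 (h1.trans h2)
    constructor <;> linarith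
  have hgap := power_gap_bound hd (t := 1 / (L : ℝ) * s ^ 2) hδ0 hδ1 (k := Tpm) (by
    refine le_trans ?_ hpm
    have hlog : 0 ≤ Real.log (d / δ) := Real.log_nonneg (by
      rw [le_div_iff₀ hδ0]; linarith)
    have : 12 ≤ (10 : ℝ) ^ 10 * κ ^ 2 := by nlinarith
    exact mul_le_mul_of_nonneg_right this hlog)
  -- The least squared gain of `M ^ Tpm` on the leading eigenspace. The choice of `η` below makes `r
  -- √r η ≤ 1 / (8 d)`, using `r ≤ d`.
  set ρ := ((1 / (L : ℝ) * s ^ 2 / 10) ^ Tpm) ^ 2 with hρ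
  have hρ0 : 0 < ρ := by positivity
  set η := 1 / (8 * (d : ℝ) ^ 3) with hη
  have hη0 : 0 < η := by positivity
  set B₁ : Set (Fin T × Fin n → Fin d → ℝ) := {x | n * F / 10 ≤ |energy θ x - n * F|} with hB₁
  set N : Set ((Fin T × Fin n → Fin d → ℝ) × (Fin T × Fin n → Fin d → ℝ)) :=
    {q | ∃ u ∈ net d, ∃ v ∈ net T,
      s * δ / 400 ≤ |u ⬝ᵥ (noise (n := n) G W hS κ μ Tcon Θ q *ᵥ v)|} with hN
  set H : Set (((Fin T × Fin n → Fin d → ℝ) × (Fin T × Fin n → Fin d → ℝ)) ×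
      (Fin r → Fin d → ℝ)) := {p | ∃ a ∈ {a : Fin r → ℝ | a ⬝ᵥ a = 1},
      ((mixedGram G W S κ μ Tcon Θ p.1 ^ Tpm * ofColumns p.2) *ᵥ a) ⬝ᵥ
        ((mixedGram G W S κ μ Tcon Θ p.1 ^ Tpm * ofColumns p.2) *ᵥ a) ≤ ρ * η ^ 2} with hH
  set R : Set (Fin r → Fin d → ℝ) := {z | 8 * (d : ℝ) ^ 3 ≤ ∑ k, z k ⬝ᵥ z k} with hR
  have hlevel : ∀ x ∉ B₁, ∀ g, 36 / 5 * ω ≤ thresholds G W S κ μ Tcon Θ x g ∧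
      thresholds G W S κ μ Tcon Θ x g ≤ 11 * κ ^ 2 * ω := fun x hx g => by
    obtain ⟨h1, h2⟩ := thresholds_bounds hW hS κ μ hL hw Θ x g
    exact level_bounds hn hT hκ hFlo hFhi (not_le.1 hx) h1 h2
  have hlead : ∀ q : (Fin T × Fin n → Fin d → ℝ) × (Fin T × Fin n → Fin d → ℝ), q.1 ∉ B₁ →
      q ∉ N → _ := fun q h1 h2 => mixedGram_leading_space (μ := μ) (q := q) hr hΘ hS hw hδ0 hδ1
    (fun t g => (mul_le_mul_of_nonneg_left (hcol t) (by norm_num)).trans (hlevel q.1 h1 g).1)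
    (fun u hu v hv => le_of_not_ge fun h => h2 ⟨u, hu, v, hv, h⟩)
  have hB₁m : MeasurableSet B₁ :=
    measurableSet_le measurable_const
      (measurable_norm.comp ((measurable_energy θ).sub measurable_const))
  have hNm : MeasurableSet N := measurableSet_noise hW hS κ μ Tcon Θ _
  have hHm : MeasurableSet H := measurableSet_degenerate_start hW κ μ Tcon Tpm Θ _
  have hRm : MeasurableSet R := measurableSet_le measurable_const
    (Finset.measurable_sum _ fun k _ => Finset.measurable_sum _ fun b _ => by fun_prop)
  have hB₁p : sampleLaw T n d B₁ ≤ ENNReal.ofReal (1 / (4 * (d : ℝ))) :=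
    (sampleLaw_energy_le hn θ hcol hFpos).trans (ENNReal.ofReal_le_ofReal
      (energy_failure_bound hr hd0 hn hT hκ hμ hδ0 hδ1 hs hFlo hnT))
  -- Intersecting with the complement of `B₁` makes the slice bound uniform: where it is nonempty,
  -- the thresholds are constants bounded by `11 κ ^ 2 ω`.
  have hNp : (sampleLaw T n d).prod (sampleLaw T n d) (Prod.fst ⁻¹' B₁ᶜ ∩ N)
      ≤ ENNReal.ofReal (1 / (4 * (d : ℝ))) := by
    refine measure_prod_le_of_slice_le ((hB₁m.compl.preimage measurable_fst).inter hNm) fun x => ?_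
    by_cases hx : x ∈ B₁
    · have : Prod.mk x ⁻¹' (Prod.fst ⁻¹' B₁ᶜ ∩ N) = ∅ := by
        ext y; simp [hx]
      rw [this, measure_empty]; exact zero_le
    · refine (measure_mono ?_).trans ((sampleLaw_noise_le hn θ
        (a := fun t => thresholds G W S κ μ Tcon Θ x (node hS t)) (A := 11 * κ ^ 2 * ω)
        (by positivity) (fun t => (hlevel x hx _).2) (ε := s * δ / 400) (by positivity)).trans
        (ENNReal.ofReal_le_ofReal ?_))
      · exact fun y hy => hy.2
      · have := net_union_bound (noise_exponent_bound hr hT hκ hμ hδ0 hs hnT) hd0 hT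
        rwa [neg_mul, neg_div]
  have hHp : ((sampleLaw T n d).prod (sampleLaw T n d)).prod (startLaw r d)
      (Prod.fst ⁻¹' (Prod.fst ⁻¹' B₁ᶜ ∩ Nᶜ) ∩ H) ≤ ENNReal.ofReal (1 / (8 * (d : ℝ))) := by
    refine measure_prod_le_of_slice_le
      ((((hB₁m.compl.preimage measurable_fst).inter hNm.compl).preimage measurable_fst).inter hHm)
      fun q => ?_
    by_cases hq : q.1 ∉ B₁ ∧ q ∉ N
    · obtain ⟨v, lam, I, hv, hcard, hIhi, -, -⟩ := hlead q hq.1 hq.2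
      refine (measure_mono fun z hz => hz.2).trans ((startLaw_exists_le hr hρ0 hη0.le
        (K := mixedGram G W S κ μ Tcon Θ q ^ Tpm) fun z k => ?_).trans
        (ENNReal.ofReal_le_ofReal ?_))
      · exact (hv.pow Tpm).exists_unit_orthogonal hcard (by positivity)
          (fun i hi => pow_le_pow_left₀ (by positivity) (hIhi i hi) Tpm) z k
      · have hrd : (r : ℝ) ≤ d := by exact_mod_cast hΘ.le_dim
        have hsq : Real.sqrt r ≤ d := by
          refine (Real.sqrt_le_sqrt hrd).trans ?_
          rw [Real.sqrt_le_left (by linarith)]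
          nlinarith
        calc (r : ℝ) * (Real.sqrt r * η) ≤ d * (d * η) := by gcongr
          _ = 1 / (8 * (d : ℝ)) := by rw [hη]; field_simp
    · have : Prod.mk q ⁻¹' (Prod.fst ⁻¹' (Prod.fst ⁻¹' B₁ᶜ ∩ Nᶜ) ∩ H) = ∅ := by
        ext z
        simp only [Set.mem_preimage, Set.mem_inter_iff, Set.mem_compl_iff, Set.mem_empty_iff_false,
          iff_false]
        exact fun h => hq h.1
      rw [this, measure_empty]; exact zero_le
  have hRp : startLaw r d R ≤ ENNReal.ofReal (1 / (8 * (d : ℝ))) := by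
    refine (startLaw_sum_sq_ge_le (by positivity)).trans (ENNReal.ofReal_le_ofReal ?_)
    have hrd : (r : ℝ) ≤ d := by exact_mod_cast hΘ.le_dim
    rw [div_le_div_iff₀ (by positivity) (by positivity)]
    calc (r : ℝ) * d * (8 * d) ≤ d * d * (8 * d) := by gcongr
      _ = 1 * (8 * (d : ℝ) ^ 3) := by ring
  refine ⟨((Prod.fst ⁻¹' (Prod.fst ⁻¹' B₁) ∪ Prod.fst ⁻¹' (Prod.fst ⁻¹' B₁ᶜ ∩ N)) ∪
    (Prod.fst ⁻¹' (Prod.fst ⁻¹' B₁ᶜ ∩ Nᶜ) ∩ H)) ∪ Prod.snd ⁻¹' R, ?_, ?_, ?_⟩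
  · exact ((((hB₁m.preimage measurable_fst).preimage measurable_fst).union
      (((hB₁m.compl.preimage measurable_fst).inter hNm).preimage measurable_fst)).union
      ((((hB₁m.compl.preimage measurable_fst).inter hNm.compl).preimage measurable_fst).inter
        hHm)).union (hRm.preimage measurable_snd)
  · exact measure_exceptional_le hB₁m ((hB₁m.compl.preimage measurable_fst).inter hNm) hRm
      (by linarith) hB₁p hNp hHp hRp
  · intro p hp
    simp only [Set.mem_union, not_or] at hp
    obtain ⟨⟨⟨h1, h2⟩, h3⟩, h4⟩ := hp
    have hb : p.1.1 ∉ B₁ := h1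
    have hn' : p.1 ∉ N := fun h => h2 ⟨hb, h⟩
    have hh : p ∉ H := fun h => h3 ⟨⟨hb, hn'⟩, h⟩
    have hz : ∑ k, p.2 k ⬝ᵥ p.2 k ≤ 8 * (d : ℝ) ^ 3 := le_of_not_ge h4
    obtain ⟨v, lam, I, hv, hcard, -, hIlo, hUI⟩ := hlead p.1 hb hn'
    exact pmRound_iterate_spec hG hW hqr hr Tcon _ hΘ.left_orthonormal hv hcard hIlo hUI
      (by positivity : 0 < ρ * η ^ 2) hδ0 hδ1
      (fun a => (ofColumns_mulVec_self_le p.2 a).trans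
        (mul_le_mul_of_nonneg_right hz (dotProduct_self_nonneg' a)))
      (fun a ha => le_of_not_ge fun h => hh ⟨a, ha, h⟩) hgap

end Exceptional

/-! ### The law of the random inputs -/

section Law

variable {T n d r : ℕ}

/-- All inputs as one family of scalars, from the two samples and the columns of the start. -/
def joinEntries (p : ((Fin T × Fin n → Fin d → ℝ) × (Fin T × Fin n → Fin d → ℝ)) ×
    (Fin r → Fin d → ℝ)) :
    (Fin T × Fin n × Fin d) ⊕ (Fin T × Fin n × Fin d) ⊕ (Fin d × Fin r) → ℝ
  | .inl (t, i, a) => p.1.1 (t, i) a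
  | .inr (.inl (t, i, a)) => p.1.2 (t, i) a
  | .inr (.inr (a, k)) => p.2 k a

/-- The inverse of `joinEntries`. -/
def splitEntries (f : (Fin T × Fin n × Fin d) ⊕ (Fin T × Fin n × Fin d) ⊕ (Fin d × Fin r) → ℝ) :
    ((Fin T × Fin n → Fin d → ℝ) × (Fin T × Fin n → Fin d → ℝ)) × (Fin r → Fin d → ℝ) :=
  ((fun p a => f (.inl (p.1, p.2, a)), fun p a => f (.inr (.inl (p.1, p.2, a)))),
    fun k a => f (.inr (.inr (a, k))))

lemma measurable_joinEntries : Measurable (joinEntries (T := T) (n := n) (d := d) (r := r)) := by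
  refine measurable_pi_lambda _ fun k => ?_
  rcases k with ⟨t, i, a⟩ | ⟨t, i, a⟩ | ⟨a, k⟩
  · exact (measurable_pi_apply a).comp ((measurable_pi_apply (t, i)).comp
      (measurable_fst.comp measurable_fst))
  · exact (measurable_pi_apply a).comp ((measurable_pi_apply (t, i)).comp
      (measurable_snd.comp measurable_fst))
  · exact (measurable_pi_apply a).comp ((measurable_pi_apply k).comp measurable_snd)

lemma measurable_splitEntries : Measurable (splitEntries (T := T) (n := n) (d := d) (r := r)) := by
  refine Measurable.prodMk (Measurable.prodMk ?_ ?_) ?_ <;>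
  exact measurable_pi_lambda _ fun _ => measurable_pi_lambda _ fun _ => measurable_pi_apply _

/-- Product measures are determined by boxes, and a box of scalar entries splits into boxes for the
two samples and the columns of the start. -/
lemma map_joinEntries :
    (((sampleLaw T n d).prod (sampleLaw T n d)).prod (startLaw r d)).map joinEntries
      = Measure.pi fun _ => gaussianReal 0 1 := by
  refine (Measure.pi_eq fun s hs => ?_).symm
  rw [Measure.map_apply measurable_joinEntries (MeasurableSet.univ_pi hs)]
  have hset : joinEntries ⁻¹' (Set.univ.pi s)
      = ((Set.univ.pi fun p : Fin T × Fin n => Set.univ.pi fun a => s (.inl (p.1, p.2, a))) ×ˢ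
        (Set.univ.pi fun p : Fin T × Fin n => Set.univ.pi fun a => s (.inr (.inl (p.1, p.2, a)))))
        ×ˢ (Set.univ.pi fun k => Set.univ.pi fun a => s (.inr (.inr (a, k)))) := by
    ext p
    simp only [Set.mem_preimage, Set.mem_pi, Set.mem_univ, true_imp_iff, Sum.forall, Prod.forall,
      Set.mem_prod, joinEntries, and_assoc]
    exact and_congr Iff.rfl (and_congr Iff.rfl forall_comm)
  rw [hset, Measure.prod_prod, Measure.prod_prod]
  simp only [sampleLaw, startLaw, stdGauss, Measure.pi_pi]
  rw [Fintype.prod_sum_type, Fintype.prod_sum_type, mul_assoc]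
  simp only [Fintype.prod_prod_type]
  rw [Finset.prod_comm (s := (Finset.univ : Finset (Fin r)))]

lemma map_splitEntries :
    (Measure.pi fun _ => gaussianReal 0 1).map splitEntries
      = ((sampleLaw T n d).prod (sampleLaw T n d)).prod (startLaw r d) := by
  rw [← map_joinEntries, Measure.map_map measurable_splitEntries measurable_joinEntries]
  exact Measure.map_id

lemma IIDStdGaussian.map_splitEntries {Ω : Type*} [MeasurableSpace Ω] {P : Measure Ω}
    [IsProbabilityMeasure P] {X₀₀ X₀ : Ω → Fin T → Matrix (Fin n) (Fin d) ℝ}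
    {Z : Ω → Matrix (Fin d) (Fin r) ℝ} (h : IIDStdGaussian P X₀₀ X₀ Z)
    {B : Set (((Fin T × Fin n → Fin d → ℝ) × (Fin T × Fin n → Fin d → ℝ)) ×
      (Fin r → Fin d → ℝ))} (hB : MeasurableSet B) :
    P {ω | splitEntries (fun k => randomEntries X₀₀ X₀ Z k ω) ∈ B}
      = ((sampleLaw T n d).prod (sampleLaw T n d)).prod (startLaw r d) B := by
  have hm : ∀ k, AEMeasurable (randomEntries X₀₀ X₀ Z k) P := fun k => (h.law k).aemeasurable
  have hmap : P.map (fun ω k => randomEntries X₀₀ X₀ Z k ω)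
      = Measure.pi fun _ => gaussianReal 0 1 := by
    rw [(iIndepFun_iff_map_fun_eq_pi_map hm).1 h.indep]
    congr 1
    ext1 k
    exact (h.law k).map_eq
  rw [← DecMTRL.map_splitEntries, ← hmap,
    Measure.map_apply measurable_splitEntries hB,
    Measure.map_apply_of_aemeasurable (aemeasurable_pi_lambda _ hm) (measurable_splitEntries hB)]
  rfl

end Law

lemma frobNorm_zero {m k : ℕ} : frobNorm (0 : Matrix (Fin m) (Fin k) ℝ) = 0 := by
  unfold frobNorm
  exact @norm_zero _ Matrix.frobeniusSeminormedAddCommGroup.toSeminormedAddGroup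

end DecMTRL

/-! ### The main theorem. -/

open DecMTRL in
theorem proposition2 :
    ∃ C : ℝ, 1 < C ∧
      ∀ (d T n r L : ℕ) [NeZero L]
        -- feature matrix of rank `r ≥ 1` and its reduced singular value decomposition
        (Θ : Matrix (Fin d) (Fin T) ℝ) (Ustar : Matrix (Fin d) (Fin r) ℝ) (σ : Fin r → ℝ)
        (V : Matrix (Fin T) (Fin r) ℝ) (μ : ℝ)
        -- network, weights and partition of the tasks
        (G : SimpleGraph (Fin L)) [DecidableRel G.Adj] (W : Matrix (Fin L) (Fin L) ℝ)
        (hW : IsWeightMatrix G W) (S : Fin L → Finset (Fin T))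
        -- QR routine and parameters of the algorithm
        (qr : Matrix (Fin d) (Fin r) ℝ → Matrix (Fin d) (Fin r) ℝ)
        (Tcon Tpm : ℕ) (δ₀ : ℝ)
        -- random inputs
        (Ω : Type u) [MeasurableSpace Ω] (P : MeasureTheory.Measure Ω)
        [MeasureTheory.IsProbabilityMeasure P]
        (X₀₀ X₀ : Ω → Fin T → Matrix (Fin n) (Fin d) ℝ) (Z : Ω → Matrix (Fin d) (Fin r) ℝ),
        0 < r →
        IsReducedSVD Θ Ustar σ V →
        1 < μ →
        Incoherent σ V μ →
        IIDStdGaussian P X₀₀ X₀ Z →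
        G.Connected →
        connectivity W hW.hermitian < 1 →
        (∀ t, ∃! g, t ∈ S g) →
        IsQRRoutine qr →
        0 < δ₀ → δ₀ < 1 →
        0 < Tcon →
        C * (1 / Real.log (1 / connectivity W hW.hermitian)) *
            (Real.log L + Real.log d + Real.log (condNumber σ) + Real.log (1 / δ₀)) ≤ Tcon →
        C * condNumber σ ^ 2 * Real.log (d / δ₀) ≤ Tpm →
        C * (condNumber σ ^ 4 * μ ^ 2 * ((d : ℝ) + T) * (r / δ₀ ^ 2)) ≤ (n : ℝ) * T →
        ∃ E : Set Ω, MeasurableSet E ∧ ENNReal.ofReal (1 - 1 / (d : ℝ)) ≤ P E ∧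
          ∀ ω ∈ E,
            let U : Fin L → Matrix (Fin d) (Fin r) ℝ :=
              spectralInit G W qr S (condNumber σ) μ Tcon Tpm
                (responses Θ (X₀₀ ω)) (X₀ ω) (responses Θ (X₀ ω)) (Z ω)
            (∀ g g', frobNorm (U g - U g') = 0) ∧
            (∀ g g', frobNorm (projPerp Ustar * (U g - U g')) = 0) ∧
            (∀ g, (U g)ᵀ * U g = 1 ∧ subspaceDist (U g) Ustar ≤ δ₀) := by
  refine ⟨10 ^ 10, by norm_num, ?_⟩
  intro d T n r L _ Θ Ustar σ V μ G _ W hW S qr Tcon Tpm δ₀ Ω _ P _ X₀₀ X₀ Z hr hΘ hμ hinc hlaw hG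
    hγ hS hqr hδ0 hδ1 hTcon hcon hpm hnT
  have hdr := hΘ.le_dim
  rcases (show d = 1 ∨ 2 ≤ d by omega) with rfl | hd
  -- For `d = 1` the required probability `1 - 1 / d` is zero.
  · exact ⟨∅, MeasurableSet.empty, by simp, fun ω hω => hω.elim⟩
  obtain ⟨B, hB, hBp, hgood⟩ := exists_exceptional_set hr hd hΘ hμ hinc hG hW hγ hS hqr hδ0 hδ1
    hTcon hcon hpm hnT
  set A : Set Ω := {ω | splitEntries (fun k => randomEntries X₀₀ X₀ Z k ω) ∈ B}
  have hA : P A ≤ ENNReal.ofReal (1 / (d : ℝ)) := (hlaw.map_splitEntries hB).trans_le hBp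
  -- The inputs are only almost everywhere measurable, so `A` itself need not be measurable; its
  -- measurable hull has the same probability.
  refine ⟨(MeasureTheory.toMeasurable P A)ᶜ, (MeasureTheory.measurableSet_toMeasurable P A).compl,
    ?_, fun ω hω => ?_⟩
  · rw [MeasureTheory.prob_compl_eq_one_sub (MeasureTheory.measurableSet_toMeasurable P A),
      MeasureTheory.measure_toMeasurable, ENNReal.ofReal_sub _ (by positivity),
      ENNReal.ofReal_one]
    exact tsub_le_tsub_left hA 1
  · obtain ⟨Q, hQ, horth, hdist⟩ := hgood _ fun h => hω (MeasureTheory.subset_toMeasurable P A h)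
    have hU : spectralInit G W qr S (condNumber σ) μ Tcon Tpm (responses Θ (X₀₀ ω)) (X₀ ω)
      (responses Θ (X₀ ω)) (Z ω) = fun _ => Q := hQ
    intro U
    have hUQ : ∀ g, U g = Q := fun g => congrFun hU g
    simp only [hUQ, sub_self, Matrix.mul_zero]
    exact ⟨fun _ _ => frobNorm_zero, fun _ _ => frobNorm_zero, fun _ => ⟨horth, hdist⟩⟩
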